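/- Work in homotopy type theory: intensional Martin-Löf type theory with a cumulative hierarchy of universes, $\Pi$- and $\Sigma$-types (with judgmental $\beta$ and $\eta$), coproducts, the empty type $0$, the unit type $1$ (with element $\bullet$), natural numbers, identity types, propositional truncation, function extensionality and univalence. Fix one of the universes and call it $\mathsf{Type}$. **Definitions.** A map $f:A\to B$ is an *equivalence* if for every $y:B$ the type $\sum_{x:A} f(x)=y$ is contractible; $A\simeq B$ is the type of equivalences. A point $a:A$ is *isolated* if $\prod_{b:A}\big((a=b)+\neg(a=b)\big)$; $A^{\circ}$ is the type of isolated points of $A$, and $A\setminus a:=\sum_{b:A}\neg(a=b)$. A *container* $F=(S\triangleright P)$ is a type $S:\mathsf{Type}$ of shapes with a family $P:S\to\mathsf{Type}$ of positions; no truncation is assumed. A *cartesian morphism* $(f,u):F\multimap G$ from $(S\triangleright P)$ to $(T\triangleright Q)$ is a map $f:S\to T$ with a family $u:\prod_{s:S}Q_{f(s)}\simeq P_s$. Identities and composites are given by identities and composites of maps and of equivalences. Put $(S\triangleright P)\times(T\triangleright Q):=(S\times T\triangleright\lambda(s,t).\,P_s+Q_t)$, $\mathrm{Id}:=(1\triangleright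 1)$, and $$\partial(S\triangleright P):=\Big(\textstyle\sum_{s:S}P_s^{\circ}\;\triangleright\;\lambda(s,p).\,P_s\setminus p\Big).$$ For $(f,u):(S\triangleright P)\multimap(T\triangleright Q)$, let $\partial(f,u)$ be $(s,p)\mapsto(f(s),u_s^{-1}(p))$ on shapes and the equivalence $Q_{f(s)}\setminus u_s^{-1}(p)\simeq P_s\setminus p$ obtained by restricting $u_s$ on positions; let $(f,u)\times\mathrm{Id}$ be $(s,x)\mapsto(f(s),x)$ on shapes and $u_s+\mathrm{id}$ on positions. Let $\eta_F:F\multimap\partial(F\times\mathrm{Id})$ be $s\mapsto((s,\bullet),\mathsf{inr}(\bullet))$ on shapes and the equivalence $(P_s+1)\setminus\mathsf{inr}(\bullet)\simeq P_s$, $\mathsf{inl}(p)\mapsto p$, on positions. Let $\varepsilon_G:\partial G\times\mathrm{Id}\multimap G$, for $G=(T\triangleright Q)$, be $((t,q),x)\mapsto t$ on shapes and, on positions, the equivalence $Q_t\simeq(Q_t\setminus q)+1$ inverse to the map with $\mathsf{inl}(q')\mapsto q'$ and $\mathsf{inr}(x)\mapsto q$. **Statement.** The maps on positions used above are indeed equivalences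 and the points used above are indeed isolated, so that the cartesian morphisms above are well defined. Moreover, elements of all the following types of paths between cartesian morphisms can be constructed, for all containers and all cartesian morphisms of the indicated types: 1. (wild category) $\mathrm{id}\circ f=f$, $f\circ\mathrm{id}=f$ and $h\circ(g\circ f)=(h\circ g)\circ f$; 2. (wild endofunctors) $\partial(\mathrm{id})=\mathrm{id}$, $\partial(g\circ f)=\partial g\circ\partial f$, $\mathrm{id}\times\mathrm{Id}=\mathrm{id}$ and $(g\circ f)\times\mathrm{Id}=(g\times\mathrm{Id})\circ(f\times\mathrm{Id})$; 3. (naturality of $\eta$ and $\varepsilon$) $\partial(f\times\mathrm{Id})\circ\eta_F=\eta_G\circ f$ and $f\circ\varepsilon_F=\varepsilon_G\circ(\partial f\times\mathrm{Id})$ for $f:F\multimap G$; 4. (zigzags) $\varepsilon_{F\times\mathrm{Id}}\circ(\eta_F\times\mathrm{Id})=\mathrm{id}_{F\times\mathrm{Id}}$ and $\partial(\varepsilon_G)\circ\eta_{\partial G}=\mathrm{id}_{\partial G}$. That is, $(\eta,\varepsilon):(-)\times\mathrm{Id}\dashv\partial$ is a wild adjunction on the wild category of containers and cartesian morphisms.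 Finally, for all containers $F$ and $G$ the map $$(-)^{\sharp}:(F\multimap\partial G)\to(F\times\mathrm{Id}\multimap G),\qquad f^{\sharp}:=\varepsilon_G\circ(f\times\mathrm{Id}),$$ is an equivalence of types, natural in $F$ and $G$: elements of $(f\circ h)^{\sharp}=f^{\sharp}\circ(h\times\mathrm{Id})$ and $(\partial g\circ f)^{\sharp}=g\circ f^{\sharp}$ can be constructed for all $h:F'\multimap F$, $f:F\multimap\partial G$ and $g:G\multimap G'$. -/

import Mathlib

namespace HoTT

/-! ## Raw terms

Terms of (book) homotopy type theory, with de Bruijn indices.  Types are the terms that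
inhabit some universe.  Comments show which variables an argument binds. -/

inductive Tm : Type
  | var (n : ℕ)
  | univ (i : ℕ)
  | pi (A B : Tm)                 -- Π (x : A), B           B binds x
  | lam (A b : Tm)                -- λ (x : A), b           b binds x
  | app (f a : Tm)
  | sg (A B : Tm)                 -- Σ (x : A), B           B binds x
  | pair (a b : Tm)
  | fst (p : Tm)
  | snd (p : Tm)
  | sum (A B : Tm)                -- A + B
  | inl (a : Tm)
  | inr (b : Tm)
  | sumInd (C c d e : Tm)         -- C binds z : A + B,  c binds x : A,  d binds y : B
  | zero
  | zeroInd (C e : Tm)            -- C binds z : 0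
  | one
  | star
  | oneInd (C c e : Tm)           -- C binds z : 1
  | nat
  | natZero
  | natSucc (n : Tm)
  | natInd (C c d e : Tm)         -- C binds n : ℕ,  d binds n : ℕ and y : C n
  | id (A a b : Tm)               -- the identity type a =_A b
  | refl (a : Tm)
  | idInd (C c p : Tm)            -- based path induction; C binds y : A and q : a = y
  | trunc (A : Tm)                -- propositional truncation
  | tr (a : Tm)
  | squash (x y : Tm)
  | truncRec (B h f e : Tm)       -- h : Π x y : B, x = y,  f : A → B
  | funext (i : ℕ)
  | ua (i : ℕ)

namespace Tm

/-- Extend a renaming under a binder. -/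
def upr (ρ : ℕ → ℕ) : ℕ → ℕ
  | 0 => 0
  | n + 1 => ρ n + 1

def rename : (ℕ → ℕ) → Tm → Tm
  | ρ, var n => var (ρ n)
  | _, univ i => univ i
  | ρ, pi A B => pi (A.rename ρ) (B.rename (upr ρ))
  | ρ, lam A b => lam (A.rename ρ) (b.rename (upr ρ))
  | ρ, app f a => app (f.rename ρ) (a.rename ρ)
  | ρ, sg A B => sg (A.rename ρ) (B.rename (upr ρ))
  | ρ, pair a b => pair (a.rename ρ) (b.rename ρ)
  | ρ, fst p => fst (p.rename ρ)
  | ρ, snd p => snd (p.rename ρ)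
  | ρ, sum A B => sum (A.rename ρ) (B.rename ρ)
  | ρ, inl a => inl (a.rename ρ)
  | ρ, inr b => inr (b.rename ρ)
  | ρ, sumInd C c d e =>
      sumInd (C.rename (upr ρ)) (c.rename (upr ρ)) (d.rename (upr ρ)) (e.rename ρ)
  | _, zero => zero
  | ρ, zeroInd C e => zeroInd (C.rename (upr ρ)) (e.rename ρ)
  | _, one => one
  | _, star => star
  | ρ, oneInd C c e => oneInd (C.rename (upr ρ)) (c.rename ρ) (e.rename ρ)
  | _, nat => nat
  | _, natZero => natZero
  | ρ, natSucc n => natSucc (n.rename ρ)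
  | ρ, natInd C c d e =>
      natInd (C.rename (upr ρ)) (c.rename ρ) (d.rename (upr (upr ρ))) (e.rename ρ)
  | ρ, id A a b => id (A.rename ρ) (a.rename ρ) (b.rename ρ)
  | ρ, refl a => refl (a.rename ρ)
  | ρ, idInd C c p => idInd (C.rename (upr (upr ρ))) (c.rename ρ) (p.rename ρ)
  | ρ, trunc A => trunc (A.rename ρ)
  | ρ, tr a => tr (a.rename ρ)
  | ρ, squash x y => squash (x.rename ρ) (y.rename ρ)
  | ρ, truncRec B h f e => truncRec (B.rename ρ) (h.rename ρ) (f.rename ρ) (e.rename ρ)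
  | _, funext i => funext i
  | _, ua i => ua i

/-- Weakening by `k` variables. -/
def shift (k : ℕ) (t : Tm) : Tm := t.rename (fun n => n + k)

/-- Extend a substitution by one term. -/
def scons (a : Tm) (σ : ℕ → Tm) : ℕ → Tm
  | 0 => a
  | n + 1 => σ n

/-- Extend a substitution under a binder. -/
def up (σ : ℕ → Tm) : ℕ → Tm := scons (var 0) (fun n => (σ n).shift 1)

/-- Simultaneous capture-avoiding substitution. -/
def subst : (ℕ → Tm) → Tm → Tm
  | σ, var n => σ n
  | _, univ i => univ i
  | σ, pi A B => pi (A.subst σ) (B.subst (up σ))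
  | σ, lam A b => lam (A.subst σ) (b.subst (up σ))
  | σ, app f a => app (f.subst σ) (a.subst σ)
  | σ, sg A B => sg (A.subst σ) (B.subst (up σ))
  | σ, pair a b => pair (a.subst σ) (b.subst σ)
  | σ, fst p => fst (p.subst σ)
  | σ, snd p => snd (p.subst σ)
  | σ, sum A B => sum (A.subst σ) (B.subst σ)
  | σ, inl a => inl (a.subst σ)
  | σ, inr b => inr (b.subst σ)
  | σ, sumInd C c d e =>
      sumInd (C.subst (up σ)) (c.subst (up σ)) (d.subst (up σ)) (e.subst σ)
  | _, zero => zero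
  | σ, zeroInd C e => zeroInd (C.subst (up σ)) (e.subst σ)
  | _, one => one
  | _, star => star
  | σ, oneInd C c e => oneInd (C.subst (up σ)) (c.subst σ) (e.subst σ)
  | _, nat => nat
  | _, natZero => natZero
  | σ, natSucc n => natSucc (n.subst σ)
  | σ, natInd C c d e =>
      natInd (C.subst (up σ)) (c.subst σ) (d.subst (up (up σ))) (e.subst σ)
  | σ, id A a b => id (A.subst σ) (a.subst σ) (b.subst σ)
  | σ, refl a => refl (a.subst σ)
  | σ, idInd C c p => idInd (C.subst (up (up σ))) (c.subst σ) (p.subst σ)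
  | σ, trunc A => trunc (A.subst σ)
  | σ, tr a => tr (a.subst σ)
  | σ, squash x y => squash (x.subst σ) (y.subst σ)
  | σ, truncRec B h f e => truncRec (B.subst σ) (h.subst σ) (f.subst σ) (e.subst σ)
  | _, funext i => funext i
  | _, ua i => ua i

/-- `B[a]`: instantiate the innermost variable. -/
def inst (B a : Tm) : Tm := B.subst (scons a var)

/-- `B[a, b]`: instantiate the two innermost variables, the innermost one by `b`. -/
def inst₂ (B a b : Tm) : Tm := B.subst (scons b (scons a var))

/-- For `B` over a context `Γ, z`, and `a` over `Γ, x₁, …, x_k`: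
the term `B[a/z]` over `Γ, x₁, …, x_k`. -/
def instUnder (k : ℕ) (B a : Tm) : Tm := B.subst (scons a (fun n => var (n + k)))

end Tm

/-! ## Named binders

An `Exp` is a term given at every context depth, so that binders can be written with Lean
functions: `pi A fun x => B x`.  A bound variable introduced at depth `n` is the index
`m - (n + 1)` at depth `m`.  A closed expression `e` denotes the closed term `e 0`. -/

abbrev Exp : Type := ℕ → Tm

def bind (B : Exp → Exp) : Exp := fun n => B (fun m => .var (m - (n + 1))) (n + 1)

def bind₂ (B : Exp → Exp → Exp) : Exp := fun n =>
  B (fun m => .var (m - (n + 1))) (fun m => .var (m - (n + 2))) (n + 2)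

def univ (i : ℕ) : Exp := fun _ => .univ i
def pi (A : Exp) (B : Exp → Exp) : Exp := fun n => .pi (A n) (bind B n)
def lam (A : Exp) (b : Exp → Exp) : Exp := fun n => .lam (A n) (bind b n)
def app (f a : Exp) : Exp := fun n => .app (f n) (a n)
def sg (A : Exp) (B : Exp → Exp) : Exp := fun n => .sg (A n) (bind B n)
def pair (a b : Exp) : Exp := fun n => .pair (a n) (b n)
def fst (p : Exp) : Exp := fun n => .fst (p n)
def snd (p : Exp) : Exp := fun n => .snd (p n)
def sum (A B : Exp) : Exp := fun n => .sum (A n) (B n)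
def inl (a : Exp) : Exp := fun n => .inl (a n)
def inr (b : Exp) : Exp := fun n => .inr (b n)
def sumInd (C c d : Exp → Exp) (e : Exp) : Exp := fun n =>
  .sumInd (bind C n) (bind c n) (bind d n) (e n)
def zero : Exp := fun _ => .zero
def zeroInd (C : Exp → Exp) (e : Exp) : Exp := fun n => .zeroInd (bind C n) (e n)
def one : Exp := fun _ => .one
def star : Exp := fun _ => .star
def oneInd (C : Exp → Exp) (c e : Exp) : Exp := fun n => .oneInd (bind C n) (c n) (e n)
def eq (A a b : Exp) : Exp := fun n => .id (A n) (a n) (b n)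
def refl (a : Exp) : Exp := fun n => .refl (a n)
def idInd (C : Exp → Exp → Exp) (c p : Exp) : Exp := fun n =>
  .idInd (bind₂ C n) (c n) (p n)

infixl:100 " ⬝ₑ " => HoTT.app

/-- Non-dependent functions and products. -/
def arr (A B : Exp) : Exp := pi A fun _ => B
def prod (A B : Exp) : Exp := sg A fun _ => B

/-! ## Equivalences -/

def isContr (A : Exp) : Exp := sg A fun a => pi A fun b => eq A a b

def fiber (A B f y : Exp) : Exp := sg A fun x => eq B (f ⬝ₑ x) y

def isEquiv (A B f : Exp) : Exp := pi B fun y => isContr (fiber A B f y)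

def equiv (A B : Exp) : Exp := sg (arr A B) fun f => isEquiv A B f

/-- The proof that `λ (x : A), x` is an equivalence. -/
def idIsEquiv (A : Exp) : Exp :=
  let F : Exp → Exp := fun y => sg A fun x => eq A x y
  lam A fun y => pair (pair y (refl y)) (lam (F y) fun z =>
    idInd (fun y' q => eq (F y') (pair y' (refl y')) (pair (fst z) q))
      (refl (pair (fst z) (refl (fst z)))) (snd z))

/-- The underlying function of the inverse of an equivalence `f` with `e : isEquiv A B f`. -/
def inv (e b : Exp) : Exp := fst (fst (e ⬝ₑ b))

/-! ## The two axioms of homotopy type theory -/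

/-- Function extensionality: `(f = g) → Π x, f x = g x` is an equivalence. -/
def funextType (i : ℕ) : Exp :=
  pi (univ i) fun A => pi (arr A (univ i)) fun B =>
  pi (pi A fun x => B ⬝ₑ x) fun f => pi (pi A fun x => B ⬝ₑ x) fun g =>
    isEquiv (eq (pi A fun x => B ⬝ₑ x) f g) (pi A fun x => eq (B ⬝ₑ x) (f ⬝ₑ x) (g ⬝ₑ x))
      (lam (eq (pi A fun x => B ⬝ₑ x) f g) fun p =>
        idInd (fun g' _ => pi A fun x => eq (B ⬝ₑ x) (f ⬝ₑ x) (g' ⬝ₑ x))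
          (lam A fun x => refl (f ⬝ₑ x)) p)

/-- Univalence: `(A = B) → (A ≃ B)` is an equivalence. -/
def uaType (i : ℕ) : Exp :=
  pi (univ i) fun A => pi (univ i) fun B =>
    isEquiv (eq (univ i) A B) (equiv A B)
      (lam (eq (univ i) A B) fun p =>
        idInd (fun B' _ => equiv A B') (pair (lam A fun x => x) (idIsEquiv A)) p)

/-! ## Derivations -/

/-- Contexts; the head of the list is the most recent variable. -/
abbrev Ctx : Type := List Tm

/-- The judgements `Γ ctx`, `Γ ⊢ t : A` and `Γ ⊢ t ≡ u : A`. -/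
inductive Judgement : Type
  | ctx (Γ : Ctx)
  | tm (Γ : Ctx) (t A : Tm)
  | eq (Γ : Ctx) (t u A : Tm)

open Tm in
/-- Derivability in homotopy type theory: intensional Martin-Löf type theory with a cumulative
hierarchy of universes à la Russell, `Π` and `Σ` (with η), `+`, `0`, `1`, `ℕ`, identity types,
propositional truncation, function extensionality and univalence.  Substitution
(with weakening as a special case) is one of the rules. -/
inductive Der : Judgement → Prop
  -- contexts
  | nil : Der (.ctx [])
  | cons {Γ A i} : Der (.tm Γ A (.univ i)) → Der (.ctx (A :: Γ))
  -- structural rules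
  | var {Γ : Ctx} {n : ℕ} {A} : Der (.ctx Γ) → Γ[n]? = some A →
      Der (.tm Γ (.var n) (A.shift (n + 1)))
  | substTm {Γ Δ : Ctx} {σ : ℕ → Tm} {t A} : Der (.ctx Γ) →
      (∀ (n : ℕ) (B : Tm), Δ[n]? = some B → Der (.tm Γ (σ n) ((B.shift (n + 1)).subst σ))) →
      Der (.tm Δ t A) → Der (.tm Γ (t.subst σ) (A.subst σ))
  | substEq {Γ Δ : Ctx} {σ : ℕ → Tm} {t u A} : Der (.ctx Γ) →
      (∀ (n : ℕ) (B : Tm), Δ[n]? = some B → Der (.tm Γ (σ n) ((B.shift (n + 1)).subst σ))) →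
      Der (.eq Δ t u A) → Der (.eq Γ (t.subst σ) (u.subst σ) (A.subst σ))
  | conv {Γ t A B i} : Der (.tm Γ t A) → Der (.eq Γ A B (.univ i)) → Der (.tm Γ t B)
  | convEq {Γ t u A B i} : Der (.eq Γ t u A) → Der (.eq Γ A B (.univ i)) → Der (.eq Γ t u B)
  | rfl {Γ t A} : Der (.tm Γ t A) → Der (.eq Γ t t A)
  | symm {Γ t u A} : Der (.eq Γ t u A) → Der (.eq Γ u t A)
  | trans {Γ t u v A} : Der (.eq Γ t u A) → Der (.eq Γ u v A) → Der (.eq Γ t v A)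
  -- universes
  | univ {Γ i} : Der (.ctx Γ) → Der (.tm Γ (.univ i) (.univ (i + 1)))
  | cumul {Γ A i} : Der (.tm Γ A (.univ i)) → Der (.tm Γ A (.univ (i + 1)))
  | cumulEq {Γ A B i} : Der (.eq Γ A B (.univ i)) → Der (.eq Γ A B (.univ (i + 1)))
  -- dependent functions
  | pi {Γ A B i} : Der (.tm Γ A (.univ i)) → Der (.tm (A :: Γ) B (.univ i)) →
      Der (.tm Γ (.pi A B) (.univ i))
  | lam {Γ A B b i} : Der (.tm Γ A (.univ i)) → Der (.tm (A :: Γ) b B) →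
      Der (.tm Γ (.lam A b) (.pi A B))
  | app {Γ A B f a} : Der (.tm Γ f (.pi A B)) → Der (.tm Γ a A) →
      Der (.tm Γ (.app f a) (B.inst a))
  | piBeta {Γ A B b a} : Der (.tm (A :: Γ) b B) → Der (.tm Γ a A) →
      Der (.eq Γ (.app (.lam A b) a) (b.inst a) (B.inst a))
  | piEta {Γ A B f} : Der (.tm Γ f (.pi A B)) →
      Der (.eq Γ f (.lam A (.app (f.shift 1) (.var 0))) (.pi A B))
  | piCongr {Γ A A' B B' i} : Der (.eq Γ A A' (.univ i)) → Der (.eq (A :: Γ) B B' (.univ i)) →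
      Der (.eq Γ (.pi A B) (.pi A' B') (.univ i))
  | lamCongr {Γ A A' B b b' i} : Der (.eq Γ A A' (.univ i)) → Der (.eq (A :: Γ) b b' B) →
      Der (.eq Γ (.lam A b) (.lam A' b') (.pi A B))
  | appCongr {Γ A B f f' a a'} : Der (.eq Γ f f' (.pi A B)) → Der (.eq Γ a a' A) →
      Der (.eq Γ (.app f a) (.app f' a') (B.inst a))
  -- dependent pairs
  | sg {Γ A B i} : Der (.tm Γ A (.univ i)) → Der (.tm (A :: Γ) B (.univ i)) →
      Der (.tm Γ (.sg A B) (.univ i))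
  | pair {Γ A B a b i} : Der (.tm (A :: Γ) B (.univ i)) → Der (.tm Γ a A) →
      Der (.tm Γ b (B.inst a)) → Der (.tm Γ (.pair a b) (.sg A B))
  | fst {Γ A B p} : Der (.tm Γ p (.sg A B)) → Der (.tm Γ (.fst p) A)
  | snd {Γ A B p} : Der (.tm Γ p (.sg A B)) → Der (.tm Γ (.snd p) (B.inst (.fst p)))
  | fstBeta {Γ A B a b i} : Der (.tm (A :: Γ) B (.univ i)) → Der (.tm Γ a A) →
      Der (.tm Γ b (B.inst a)) → Der (.eq Γ (.fst (.pair a b)) a A)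
  | sndBeta {Γ A B a b i} : Der (.tm (A :: Γ) B (.univ i)) → Der (.tm Γ a A) →
      Der (.tm Γ b (B.inst a)) → Der (.eq Γ (.snd (.pair a b)) b (B.inst a))
  | sgEta {Γ A B p} : Der (.tm Γ p (.sg A B)) →
      Der (.eq Γ p (.pair (.fst p) (.snd p)) (.sg A B))
  | sgCongr {Γ A A' B B' i} : Der (.eq Γ A A' (.univ i)) → Der (.eq (A :: Γ) B B' (.univ i)) →
      Der (.eq Γ (.sg A B) (.sg A' B') (.univ i))
  | pairCongr {Γ A B a a' b b' i} : Der (.tm (A :: Γ) B (.univ i)) → Der (.eq Γ a a' A) →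
      Der (.eq Γ b b' (B.inst a)) → Der (.eq Γ (.pair a b) (.pair a' b') (.sg A B))
  | fstCongr {Γ A B p p'} : Der (.eq Γ p p' (.sg A B)) → Der (.eq Γ (.fst p) (.fst p') A)
  | sndCongr {Γ A B p p'} : Der (.eq Γ p p' (.sg A B)) →
      Der (.eq Γ (.snd p) (.snd p') (B.inst (.fst p)))
  -- coproducts
  | sum {Γ A B i} : Der (.tm Γ A (.univ i)) → Der (.tm Γ B (.univ i)) →
      Der (.tm Γ (.sum A B) (.univ i))
  | inl {Γ A B a i} : Der (.tm Γ B (.univ i)) → Der (.tm Γ a A) → Der (.tm Γ (.inl a) (.sum A B))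
  | inr {Γ A B b i} : Der (.tm Γ A (.univ i)) → Der (.tm Γ b B) → Der (.tm Γ (.inr b) (.sum A B))
  | sumInd {Γ A B C c d e i} : Der (.tm (.sum A B :: Γ) C (.univ i)) →
      Der (.tm (A :: Γ) c (C.instUnder 1 (.inl (.var 0)))) →
      Der (.tm (B :: Γ) d (C.instUnder 1 (.inr (.var 0)))) →
      Der (.tm Γ e (.sum A B)) → Der (.tm Γ (.sumInd C c d e) (C.inst e))
  | inlBeta {Γ A B C c d a i} : Der (.tm (.sum A B :: Γ) C (.univ i)) →
      Der (.tm (A :: Γ) c (C.instUnder 1 (.inl (.var 0)))) →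
      Der (.tm (B :: Γ) d (C.instUnder 1 (.inr (.var 0)))) →
      Der (.tm Γ a A) → Der (.eq Γ (.sumInd C c d (.inl a)) (c.inst a) (C.inst (.inl a)))
  | inrBeta {Γ A B C c d b i} : Der (.tm (.sum A B :: Γ) C (.univ i)) →
      Der (.tm (A :: Γ) c (C.instUnder 1 (.inl (.var 0)))) →
      Der (.tm (B :: Γ) d (C.instUnder 1 (.inr (.var 0)))) →
      Der (.tm Γ b B) → Der (.eq Γ (.sumInd C c d (.inr b)) (d.inst b) (C.inst (.inr b)))
  | sumCongr {Γ A A' B B' i} : Der (.eq Γ A A' (.univ i)) → Der (.eq Γ B B' (.univ i)) →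
      Der (.eq Γ (.sum A B) (.sum A' B') (.univ i))
  | inlCongr {Γ A B a a' i} : Der (.tm Γ B (.univ i)) → Der (.eq Γ a a' A) →
      Der (.eq Γ (.inl a) (.inl a') (.sum A B))
  | inrCongr {Γ A B b b' i} : Der (.tm Γ A (.univ i)) → Der (.eq Γ b b' B) →
      Der (.eq Γ (.inr b) (.inr b') (.sum A B))
  | sumIndCongr {Γ A B C C' c c' d d' e e' i} : Der (.eq (.sum A B :: Γ) C C' (.univ i)) →
      Der (.eq (A :: Γ) c c' (C.instUnder 1 (.inl (.var 0)))) →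
      Der (.eq (B :: Γ) d d' (C.instUnder 1 (.inr (.var 0)))) →
      Der (.eq Γ e e' (.sum A B)) →
      Der (.eq Γ (.sumInd C c d e) (.sumInd C' c' d' e') (C.inst e))
  -- the empty type
  | zero {Γ i} : Der (.ctx Γ) → Der (.tm Γ .zero (.univ i))
  | zeroInd {Γ C e i} : Der (.tm (.zero :: Γ) C (.univ i)) → Der (.tm Γ e .zero) →
      Der (.tm Γ (.zeroInd C e) (C.inst e))
  | zeroIndCongr {Γ C C' e e' i} : Der (.eq (.zero :: Γ) C C' (.univ i)) →
      Der (.eq Γ e e' .zero) → Der (.eq Γ (.zeroInd C e) (.zeroInd C' e') (C.inst e))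
  -- the unit type
  | one {Γ i} : Der (.ctx Γ) → Der (.tm Γ .one (.univ i))
  | star {Γ} : Der (.ctx Γ) → Der (.tm Γ .star .one)
  | oneInd {Γ C c e i} : Der (.tm (.one :: Γ) C (.univ i)) → Der (.tm Γ c (C.inst .star)) →
      Der (.tm Γ e .one) → Der (.tm Γ (.oneInd C c e) (C.inst e))
  | oneBeta {Γ C c i} : Der (.tm (.one :: Γ) C (.univ i)) → Der (.tm Γ c (C.inst .star)) →
      Der (.eq Γ (.oneInd C c .star) c (C.inst .star))
  | oneIndCongr {Γ C C' c c' e e' i} : Der (.eq (.one :: Γ) C C' (.univ i)) →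
      Der (.eq Γ c c' (C.inst .star)) → Der (.eq Γ e e' .one) →
      Der (.eq Γ (.oneInd C c e) (.oneInd C' c' e') (C.inst e))
  -- natural numbers
  | nat {Γ i} : Der (.ctx Γ) → Der (.tm Γ .nat (.univ i))
  | natZero {Γ} : Der (.ctx Γ) → Der (.tm Γ .natZero .nat)
  | natSucc {Γ n} : Der (.tm Γ n .nat) → Der (.tm Γ (.natSucc n) .nat)
  | natInd {Γ C c d e i} : Der (.tm (.nat :: Γ) C (.univ i)) →
      Der (.tm Γ c (C.inst .natZero)) →
      Der (.tm (C :: .nat :: Γ) d (C.instUnder 2 (.natSucc (.var 1)))) →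
      Der (.tm Γ e .nat) → Der (.tm Γ (.natInd C c d e) (C.inst e))
  | natZeroBeta {Γ C c d i} : Der (.tm (.nat :: Γ) C (.univ i)) →
      Der (.tm Γ c (C.inst .natZero)) →
      Der (.tm (C :: .nat :: Γ) d (C.instUnder 2 (.natSucc (.var 1)))) →
      Der (.eq Γ (.natInd C c d .natZero) c (C.inst .natZero))
  | natSuccBeta {Γ C c d n i} : Der (.tm (.nat :: Γ) C (.univ i)) →
      Der (.tm Γ c (C.inst .natZero)) →
      Der (.tm (C :: .nat :: Γ) d (C.instUnder 2 (.natSucc (.var 1)))) →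
      Der (.tm Γ n .nat) →
      Der (.eq Γ (.natInd C c d (.natSucc n)) (d.inst₂ n (.natInd C c d n))
        (C.inst (.natSucc n)))
  | natSuccCongr {Γ n n'} : Der (.eq Γ n n' .nat) → Der (.eq Γ (.natSucc n) (.natSucc n') .nat)
  | natIndCongr {Γ C C' c c' d d' e e' i} : Der (.eq (.nat :: Γ) C C' (.univ i)) →
      Der (.eq Γ c c' (C.inst .natZero)) →
      Der (.eq (C :: .nat :: Γ) d d' (C.instUnder 2 (.natSucc (.var 1)))) →
      Der (.eq Γ e e' .nat) → Der (.eq Γ (.natInd C c d e) (.natInd C' c' d' e') (C.inst e))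
  -- identity types
  | id {Γ A a b i} : Der (.tm Γ A (.univ i)) → Der (.tm Γ a A) → Der (.tm Γ b A) →
      Der (.tm Γ (.id A a b) (.univ i))
  | refl {Γ A a} : Der (.tm Γ a A) → Der (.tm Γ (.refl a) (.id A a a))
  | idInd {Γ A a b C c p i} :
      Der (.tm (.id (A.shift 1) (a.shift 1) (.var 0) :: A :: Γ) C (.univ i)) →
      Der (.tm Γ a A) → Der (.tm Γ c (C.inst₂ a (.refl a))) → Der (.tm Γ p (.id A a b)) →
      Der (.tm Γ (.idInd C c p) (C.inst₂ b p))
  | idBeta {Γ A a C c i} :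
      Der (.tm (.id (A.shift 1) (a.shift 1) (.var 0) :: A :: Γ) C (.univ i)) →
      Der (.tm Γ a A) → Der (.tm Γ c (C.inst₂ a (.refl a))) →
      Der (.eq Γ (.idInd C c (.refl a)) c (C.inst₂ a (.refl a)))
  | idCongr {Γ A A' a a' b b' i} : Der (.eq Γ A A' (.univ i)) → Der (.eq Γ a a' A) →
      Der (.eq Γ b b' A) → Der (.eq Γ (.id A a b) (.id A' a' b') (.univ i))
  | reflCongr {Γ A a a'} : Der (.eq Γ a a' A) →
      Der (.eq Γ (.refl a) (.refl a') (.id A a a))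
  | idIndCongr {Γ A a b C C' c c' p p' i} :
      Der (.eq (.id (A.shift 1) (a.shift 1) (.var 0) :: A :: Γ) C C' (.univ i)) →
      Der (.tm Γ a A) → Der (.eq Γ c c' (C.inst₂ a (.refl a))) →
      Der (.eq Γ p p' (.id A a b)) →
      Der (.eq Γ (.idInd C c p) (.idInd C' c' p') (C.inst₂ b p))
  -- propositional truncation
  | trunc {Γ A i} : Der (.tm Γ A (.univ i)) → Der (.tm Γ (.trunc A) (.univ i))
  | tr {Γ A a} : Der (.tm Γ a A) → Der (.tm Γ (.tr a) (.trunc A))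
  | squash {Γ A x y} : Der (.tm Γ x (.trunc A)) → Der (.tm Γ y (.trunc A)) →
      Der (.tm Γ (.squash x y) (.id (.trunc A) x y))
  | truncRec {Γ A B h f e i} : Der (.tm Γ B (.univ i)) →
      Der (.tm Γ h (.pi B (.pi (B.shift 1) (.id (B.shift 2) (.var 1) (.var 0))))) →
      Der (.tm Γ f (.pi A (B.shift 1))) → Der (.tm Γ e (.trunc A)) →
      Der (.tm Γ (.truncRec B h f e) B)
  | truncBeta {Γ A B h f a i} : Der (.tm Γ B (.univ i)) →
      Der (.tm Γ h (.pi B (.pi (B.shift 1) (.id (B.shift 2) (.var 1) (.var 0))))) →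
      Der (.tm Γ f (.pi A (B.shift 1))) → Der (.tm Γ a A) →
      Der (.eq Γ (.truncRec B h f (.tr a)) (.app f a) B)
  | truncCongr {Γ A A' i} : Der (.eq Γ A A' (.univ i)) →
      Der (.eq Γ (.trunc A) (.trunc A') (.univ i))
  | trCongr {Γ A a a'} : Der (.eq Γ a a' A) → Der (.eq Γ (.tr a) (.tr a') (.trunc A))
  | squashCongr {Γ A x x' y y'} : Der (.eq Γ x x' (.trunc A)) → Der (.eq Γ y y' (.trunc A)) →
      Der (.eq Γ (.squash x y) (.squash x' y') (.id (.trunc A) x y))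
  | truncRecCongr {Γ A B B' h h' f f' e e' i} : Der (.eq Γ B B' (.univ i)) →
      Der (.eq Γ h h' (.pi B (.pi (B.shift 1) (.id (B.shift 2) (.var 1) (.var 0))))) →
      Der (.eq Γ f f' (.pi A (B.shift 1))) → Der (.eq Γ e e' (.trunc A)) →
      Der (.eq Γ (.truncRec B h f e) (.truncRec B' h' f' e') B)
  -- axioms
  | funext {Γ i} : Der (.ctx Γ) → Der (.tm Γ (.funext i) (funextType i 0))
  | ua {Γ i} : Der (.ctx Γ) → Der (.tm Γ (.ua i) (uaType i 0))

/-- A closed type is inhabited, that is, its elements can be constructed in the theory. -/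
def IsInhabited (A : Exp) : Prop := ∃ t : Tm, Der (.tm [] t (A 0))

/-! ## Isolated points and removal of points -/

def neg (A : Exp) : Exp := arr A zero

def dec (A : Exp) : Exp := sum A (neg A)

def isIsolated (A a : Exp) : Exp := pi A fun b => dec (eq A a b)

def isolated (A : Exp) : Exp := sg A fun a => isIsolated A a

/-- `A ∖ a`. -/
def remove (A a : Exp) : Exp := sg A fun b => neg (eq A a b)

/-! ## Containers and cartesian morphisms -/

/-- The type `Σ (S : Type), S → Type` of containers. -/
def cont (i : ℕ) : Exp := sg (univ i) fun S => arr S (univ i)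

/-- A container, given by its expressions for shapes and positions. -/
structure Con where
  sh : Exp
  ps : Exp → Exp

/-- The components of an element of `cont i`. -/
def Con.of (F : Exp) : Con := ⟨fst F, fun s => snd F ⬝ₑ s⟩

/-- The type `F ⊸ G` of cartesian morphisms. -/
def cart (F G : Con) : Exp :=
  sg (arr F.sh G.sh) fun f => pi F.sh fun s => equiv (G.ps (f ⬝ₑ s)) (F.ps s)

/-- A cartesian morphism `F ⊸ G`, given by expressions for the map `sh` on shapes, the maps
`ps s` from `G`-positions over `sh s` to `F`-positions over `s`, and proofs `pe s` that the
latter are equivalences. -/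
structure Mor where
  sh : Exp → Exp
  ps : Exp → Exp → Exp
  pe : Exp → Exp

/-- The components of an element of `cart F G`. -/
def Mor.of (f : Exp) : Mor :=
  ⟨fun s => fst f ⬝ₑ s, fun s q => fst (snd f ⬝ₑ s) ⬝ₑ q, fun s => snd (snd f ⬝ₑ s)⟩

/-- The map on positions over `s`, as a function. -/
def Mor.psFun (G : Con) (f : Mor) (s : Exp) : Exp := lam (G.ps (f.sh s)) fun q => f.ps s q

/-- The element of `cart F G` with the given components. -/
def Mor.toExp (F G : Con) (f : Mor) : Exp :=
  pair (lam F.sh f.sh) (lam F.sh fun s => pair (f.psFun G s) (f.pe s))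

/-- The type of paths `f = g` in `F ⊸ G`. -/
def eqMor (F G : Con) (f g : Mor) : Exp := eq (cart F G) (f.toExp F G) (g.toExp F G)

/-- `Π (F : Cont), B F`. -/
def piCont (i : ℕ) (B : Con → Exp) : Exp := pi (cont i) fun F => B (Con.of F)

/-- `Π (f : F ⊸ G), B f`. -/
def piCart (F G : Con) (B : Mor → Exp) : Exp := pi (cart F G) fun f => B (Mor.of f)

/-- `F × G`. -/
def Con.prod (F G : Con) : Con :=
  ⟨HoTT.prod F.sh G.sh, fun x => sum (F.ps (fst x)) (G.ps (snd x))⟩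

/-- The identity container. -/
def idCon : Con := ⟨one, fun _ => one⟩

/-- `F × Id`. -/
def may (F : Con) : Con := F.prod idCon

/-- The derivative `∂ F`. -/
def der (F : Con) : Con :=
  ⟨sg F.sh fun s => isolated (F.ps s), fun x => remove (F.ps (fst x)) (fst (snd x))⟩

/-! ## Functions between types of positions -/

/-- `f + g : A + B → A' + B'`. -/
def sumMap (A B A' B' f g : Exp) : Exp :=
  lam (sum A B) fun x =>
    sumInd (fun _ => sum A' B') (fun a => inl (f ⬝ₑ a)) (fun b => inr (g ⬝ₑ b)) x

/-- The inverse `B → A` of `f : A → B`, given `e : isEquiv A B f`. -/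
def invMap (B e : Exp) : Exp := lam B fun b => inv e b

/-- `A ∖ f⁻¹(b) → B ∖ b`, `(a, _) ↦ (f a, _)`, where `neqE` shows that `b ≠ f a`. -/
def removeMap (neqE A B f e b : Exp) : Exp :=
  lam (remove A (inv e b)) fun y =>
    pair (f ⬝ₑ fst y) (neqE ⬝ₑ A ⬝ₑ B ⬝ₑ f ⬝ₑ e ⬝ₑ b ⬝ₑ fst y ⬝ₑ snd y)

/-- The point `nothing : A + 1`. -/
def nothing : Exp := inr star

/-- `(A + 1) ∖ nothing → A`, `(inl a, _) ↦ a`. -/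
def minusMap (A : Exp) : Exp :=
  let eqN : Exp → Exp := fun z => eq (sum A one) nothing z
  lam (remove (sum A one) nothing) fun x =>
    sumInd (fun z => arr (neg (eqN z)) A)
      (fun a => lam (neg (eqN (inl a))) fun _ => a)
      (fun b => lam (neg (eqN (inr b))) fun h =>
        zeroInd (fun _ => A) (h ⬝ₑ oneInd (fun y => eqN (inr y)) (refl nothing) b))
      (fst x) ⬝ₑ snd x

/-- `(A ∖ a) + 1 → A`, `inl (b, _) ↦ b`, `nothing ↦ a`. -/
def replaceMap (A a : Exp) : Exp :=
  lam (sum (remove A a) one) fun x => sumInd (fun _ => A) (fun y => fst y) (fun _ => a) x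

/-! ## Proofs of propositions that occur inside the structure maps

The structure maps of the adjunction contain proofs that certain functions are equivalences,
that certain points are isolated and that certain points are distinct.  All these are
propositions, so it does not matter which proofs are chosen; the types of the proofs are
the following. -/

/-- Equivalences compose. -/
def compEType (i : ℕ) : Exp :=
  pi (univ i) fun A => pi (univ i) fun B => pi (univ i) fun C =>
  pi (arr A B) fun f => pi (arr B C) fun g =>
    arr (isEquiv A B f) (arr (isEquiv B C g) (isEquiv A C (lam A fun a => g ⬝ₑ (f ⬝ₑ a))))

/-- Equivalences are closed under `+`. -/
def sumEType (i : ℕ) : Exp :=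
  pi (univ i) fun A => pi (univ i) fun B => pi (univ i) fun A' => pi (univ i) fun B' =>
  pi (arr A A') fun f => pi (arr B B') fun g =>
    arr (isEquiv A A' f) (arr (isEquiv B B' g)
      (isEquiv (sum A B) (sum A' B') (sumMap A B A' B' f g)))

/-- Inverses of equivalences are equivalences. -/
def invEType (i : ℕ) : Exp :=
  pi (univ i) fun A => pi (univ i) fun B => pi (arr A B) fun f =>
  pi (isEquiv A B f) fun e => isEquiv B A (invMap B e)

/-- Equivalences respect isolated points. -/
def isoEType (i : ℕ) : Exp :=
  pi (univ i) fun A => pi (univ i) fun B => pi (arr A B) fun f =>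
  pi (isEquiv A B f) fun e => pi B fun b =>
    arr (isIsolated B b) (isIsolated A (inv e b))

/-- Equivalences respect distinctness of points. -/
def neqEType (i : ℕ) : Exp :=
  pi (univ i) fun A => pi (univ i) fun B => pi (arr A B) fun f =>
  pi (isEquiv A B f) fun e => pi B fun b => pi A fun a =>
    arr (neg (eq A (inv e b) a)) (neg (eq B b (f ⬝ₑ a)))

/-- Equivalences restrict to equivalences between the complements of corresponding points. -/
def removeEType (i : ℕ) (neqE : Exp) : Exp :=
  pi (univ i) fun A => pi (univ i) fun B => pi (arr A B) fun f =>
  pi (isEquiv A B f) fun e => pi B fun b =>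
    isEquiv (remove A (inv e b)) (remove B b) (removeMap neqE A B f e b)

/-- `nothing` is isolated. -/
def nothingEType (i : ℕ) : Exp :=
  pi (univ i) fun A => isIsolated (sum A one) nothing

/-- `(A + 1) ∖ nothing → A` is an equivalence. -/
def minusEType (i : ℕ) : Exp :=
  pi (univ i) fun A => isEquiv (remove (sum A one) nothing) A (minusMap A)

/-- `(A ∖ a) + 1 → A` is an equivalence if `a` is isolated. -/
def replaceEType (i : ℕ) : Exp :=
  pi (univ i) fun A => pi A fun a =>
    arr (isIsolated A a) (isEquiv (sum (remove A a) one) A (replaceMap A a))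

/-- A choice of proofs of these propositions. -/
structure Proofs where
  compE : Exp
  sumE : Exp
  invE : Exp
  isoE : Exp
  neqE : Exp
  removeE : Exp
  nothingE : Exp
  minusE : Exp
  replaceE : Exp

/-- `Σ (w : such a choice), B w`. -/
def sgProofs (i : ℕ) (B : Proofs → Exp) : Exp :=
  sg (compEType i) fun compE => sg (sumEType i) fun sumE => sg (invEType i) fun invE =>
  sg (isoEType i) fun isoE => sg (neqEType i) fun neqE => sg (removeEType i neqE) fun removeE =>
  sg (nothingEType i) fun nothingE => sg (minusEType i) fun minusE =>
  sg (replaceEType i) fun replaceE =>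
    B ⟨compE, sumE, invE, isoE, neqE, removeE, nothingE, minusE, replaceE⟩

/-! ## The structure maps -/

namespace Proofs

variable (w : Proofs)

/-- `id : F ⊸ F`. -/
def idMor (F : Con) : Mor := ⟨fun s => s, fun _ q => q, fun s => idIsEquiv (F.ps s)⟩

/-- `g ∘ f : F ⊸ H` for `f : F ⊸ G` and `g : G ⊸ H`. -/
def comp (F G H : Con) (g f : Mor) : Mor where
  sh s := g.sh (f.sh s)
  ps s q := f.ps s (g.ps (f.sh s) q)
  pe s := w.compE ⬝ₑ H.ps (g.sh (f.sh s)) ⬝ₑ G.ps (f.sh s) ⬝ₑ F.ps s ⬝ₑ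
    g.psFun H (f.sh s) ⬝ₑ f.psFun G s ⬝ₑ g.pe (f.sh s) ⬝ₑ f.pe s

/-- `f × g : F × G ⊸ F' × G'` for `f : F ⊸ F'` and `g : G ⊸ G'`. -/
def prodMap (F G F' G' : Con) (f g : Mor) : Mor where
  sh x := pair (f.sh (fst x)) (g.sh (snd x))
  ps x q := sumInd (fun _ => (F.prod G).ps x)
    (fun a => inl (f.ps (fst x) a)) (fun b => inr (g.ps (snd x) b)) q
  pe x := w.sumE ⬝ₑ F'.ps (f.sh (fst x)) ⬝ₑ G'.ps (g.sh (snd x)) ⬝ₑ F.ps (fst x) ⬝ₑ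
    G.ps (snd x) ⬝ₑ f.psFun F' (fst x) ⬝ₑ g.psFun G' (snd x) ⬝ₑ f.pe (fst x) ⬝ₑ g.pe (snd x)

/-- `f × Id : F × Id ⊸ G × Id` for `f : F ⊸ G`. -/
def mayMap (F G : Con) (f : Mor) : Mor := w.prodMap F idCon G idCon f (idMor idCon)

/-- `∂ f : ∂ F ⊸ ∂ G` for `f : F ⊸ G`. -/
def derMap (F G : Con) (f : Mor) : Mor where
  sh x := pair (f.sh (fst x)) (pair (inv (f.pe (fst x)) (fst (snd x)))
    (w.isoE ⬝ₑ G.ps (f.sh (fst x)) ⬝ₑ F.ps (fst x) ⬝ₑ f.psFun G (fst x) ⬝ₑ f.pe (fst x) ⬝ₑ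
      fst (snd x) ⬝ₑ snd (snd x)))
  ps x y := pair (f.ps (fst x) (fst y))
    (w.neqE ⬝ₑ G.ps (f.sh (fst x)) ⬝ₑ F.ps (fst x) ⬝ₑ f.psFun G (fst x) ⬝ₑ f.pe (fst x) ⬝ₑ
      fst (snd x) ⬝ₑ fst y ⬝ₑ snd y)
  pe x := w.removeE ⬝ₑ G.ps (f.sh (fst x)) ⬝ₑ F.ps (fst x) ⬝ₑ f.psFun G (fst x) ⬝ₑ
    f.pe (fst x) ⬝ₑ fst (snd x)

/-- The unit `η : F ⊸ ∂ (F × Id)`. -/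
def unit (F : Con) : Mor where
  sh s := pair (pair s star) (pair nothing (w.nothingE ⬝ₑ F.ps s))
  ps s q := minusMap (F.ps s) ⬝ₑ q
  pe s := w.minusE ⬝ₑ F.ps s

/-- The counit `ε : ∂ G × Id ⊸ G`; on positions, the inverse of `replaceMap`. -/
def counit (G : Con) : Mor :=
  let A : Exp → Exp := fun x => G.ps (fst (fst x))
  let a : Exp → Exp := fun x => fst (snd (fst x))
  let e : Exp → Exp := fun x => w.replaceE ⬝ₑ A x ⬝ₑ a x ⬝ₑ snd (snd (fst x))
  { sh := fun x => fst (fst x)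
    ps := fun x q => inv (e x) q
    pe := fun x => w.invE ⬝ₑ sum (remove (A x) (a x)) one ⬝ₑ A x ⬝ₑ replaceMap (A x) (a x) ⬝ₑ e x }

/-- `f♯ = ε ∘ (f × Id) : F × Id ⊸ G` for `f : F ⊸ ∂ G`. -/
def sharp (F G : Con) (f : Mor) : Mor :=
  w.comp (may F) (may (der G)) G (w.counit G) (w.mayMap F (der G) f)

/-! ## Types of fillers -/

/-- `id ∘ f = f` and `f ∘ id = f`. -/
def unitLaws (i : ℕ) : Exp :=
  piCont i fun F => piCont i fun G => piCart F G fun f =>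
    HoTT.prod (eqMor F G (w.comp F G G (idMor G) f) f) (eqMor F G (w.comp F F G f (idMor F)) f)

/-- `h ∘ (g ∘ f) = (h ∘ g) ∘ f`. -/
def assocLaw (i : ℕ) : Exp :=
  piCont i fun F => piCont i fun G => piCont i fun H => piCont i fun K =>
  piCart F G fun f => piCart G H fun g => piCart H K fun h =>
    eqMor F K (w.comp F H K h (w.comp F G H g f)) (w.comp F G K (w.comp G H K h g) f)

/-- `∂ id = id`. -/
def derId (i : ℕ) : Exp :=
  piCont i fun F => eqMor (der F) (der F) (w.derMap F F (idMor F)) (idMor (der F))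

/-- `∂ (g ∘ f) = ∂ g ∘ ∂ f`. -/
def derComp (i : ℕ) : Exp :=
  piCont i fun F => piCont i fun G => piCont i fun H => piCart F G fun f => piCart G H fun g =>
    eqMor (der F) (der H) (w.derMap F H (w.comp F G H g f))
      (w.comp (der F) (der G) (der H) (w.derMap G H g) (w.derMap F G f))

/-- `id × Id = id`. -/
def mayId (i : ℕ) : Exp :=
  piCont i fun F => eqMor (may F) (may F) (w.mayMap F F (idMor F)) (idMor (may F))

/-- `(g ∘ f) × Id = (g × Id) ∘ (f × Id)`. -/
def mayComp (i : ℕ) : Exp :=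
  piCont i fun F => piCont i fun G => piCont i fun H => piCart F G fun f => piCart G H fun g =>
    eqMor (may F) (may H) (w.mayMap F H (w.comp F G H g f))
      (w.comp (may F) (may G) (may H) (w.mayMap G H g) (w.mayMap F G f))

/-- `∂ (f × Id) ∘ η = η ∘ f`. -/
def unitNat (i : ℕ) : Exp :=
  piCont i fun F => piCont i fun G => piCart F G fun f =>
    eqMor F (der (may G))
      (w.comp F (der (may F)) (der (may G)) (w.derMap (may F) (may G) (w.mayMap F G f)) (w.unit F))
      (w.comp F G (der (may G)) (w.unit G) f)

/-- `f ∘ ε = ε ∘ (∂ f × Id)`. -/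
def counitNat (i : ℕ) : Exp :=
  piCont i fun F => piCont i fun G => piCart F G fun f =>
    eqMor (may (der F)) G
      (w.comp (may (der F)) F G f (w.counit F))
      (w.comp (may (der F)) (may (der G)) G (w.counit G)
        (w.mayMap (der F) (der G) (w.derMap F G f)))

/-- `ε ∘ (η × Id) = id` on `F × Id`. -/
def zigzagMay (i : ℕ) : Exp :=
  piCont i fun F => eqMor (may F) (may F)
    (w.comp (may F) (may (der (may F))) (may F) (w.counit (may F))
      (w.mayMap F (der (may F)) (w.unit F)))
    (idMor (may F))

/-- `∂ ε ∘ η = id` on `∂ G`. -/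
def zigzagDer (i : ℕ) : Exp :=
  piCont i fun G => eqMor (der G) (der G)
    (w.comp (der G) (der (may (der G))) (der G) (w.derMap (may (der G)) G (w.counit G))
      (w.unit (der G)))
    (idMor (der G))

/-- `f ↦ f♯` is an equivalence `(F ⊸ ∂ G) ≃ (F × Id ⊸ G)`. -/
def sharpIsEquiv (i : ℕ) : Exp :=
  piCont i fun F => piCont i fun G =>
    isEquiv (cart F (der G)) (cart (may F) G)
      (lam (cart F (der G)) fun f => (w.sharp F G (Mor.of f)).toExp (may F) G)

/-- `(f ∘ h)♯ = f♯ ∘ (h × Id)`. -/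
def sharpNatLeft (i : ℕ) : Exp :=
  piCont i fun F' => piCont i fun F => piCont i fun G =>
  piCart F' F fun h => piCart F (der G) fun f =>
    eqMor (may F') G (w.sharp F' G (w.comp F' F (der G) f h))
      (w.comp (may F') (may F) G (w.sharp F G f) (w.mayMap F' F h))

/-- `(∂ g ∘ f)♯ = g ∘ f♯`. -/
def sharpNatRight (i : ℕ) : Exp :=
  piCont i fun F => piCont i fun G => piCont i fun G' =>
  piCart F (der G) fun f => piCart G G' fun g =>
    eqMor (may F) G' (w.sharp F G' (w.comp F (der G) (der G') (w.derMap G G' g) f))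
      (w.comp (may F) G G' g (w.sharp F G f))

end Proofs

/-- The type of all the data of the wild adjunction `(-) × Id ⊣ ∂` on the wild category of
containers in the universe `univ i`, together with the natural equivalences of hom-types. -/
def derivativeAdjunction (i : ℕ) : Exp :=
  sgProofs i fun w =>
    prod (w.unitLaws i) <| prod (w.assocLaw i) <|
    prod (w.derId i) <| prod (w.derComp i) <|
    prod (w.mayId i) <| prod (w.mayComp i) <|
    prod (w.unitNat i) <| prod (w.counitNat i) <|
    prod (w.zigzagMay i) <| prod (w.zigzagDer i) <|
    prod (w.sharpIsEquiv i) <| prod (w.sharpNatLeft i) (w.sharpNatRight i)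

end HoTT

/-! Mathematical content. Over a fixed map of shapes, a morphism `F × Id ⊸ G` is a family of
equivalences `Q ≃ P + 1`, whereas a morphism `F ⊸ ∂ G` is a family of isolated points `q` of `Q`
together with equivalences `Q ∖ q ≃ P`. These data are equivalent. An equivalence `A ≃ B + 1`
determines the preimage of `nothing`, which is isolated, and it restricts to the complements of the
two points; conversely `A ≃ (A ∖ a) + 1` when `a` is isolated (`replaceE`). The first construction
is characterised by a uniqueness property (`splitUnique`), which yields the bijection on hom-types.

No truncation of shapes or positions is needed, because all the proofs carried along are
propositions: being an equivalence, being distinct from a point, and being isolated. The last one is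
a local form of Hedberg's theorem: paths out of an isolated point are unique (`isolatedPaths`). A
path between morphisms is therefore built from a path between the maps on shapes, a path between the
isolated points and a homotopy between the maps on positions (`MorPath`, `MorPathSh`, `MorPathDer`).
With these criteria the laws become case distinctions on `P + 1`, combined with uniqueness of
preimages under an equivalence (`invEq`). Statements about an equivalence are reduced to the
identity by equivalence induction, which comes from univalence.

Formal content. Inhabitation means existence of a derivation in `Der`, and such derivations are
obtained by reflection. A bidirectional, normalising type checker (`run`, `hasType`) is defined and
proved sound (`run_sound`, `der_of_hasType`). Completeness, confluence and termination of reduction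
play no role: recursion depth is bounded, and each success of the checker yields a `Red`, that is, a
derivable equality together with derivations of both sides. Explicit elements are written as `Exp`
and the checker is evaluated on them. Each lemma is checked with the lemmas it uses as hypotheses,
and the results are composed by `Realized.mp`; the laws are checked for arbitrary proofs of the side
propositions. Everything is checked at universe level 0 and transferred to level `i` by `Der.raise`.
-/

namespace HoTT

/-! ## The substitution calculus -/

namespace Tm

theorem up_var_comp (ρ : ℕ → ℕ) : up (fun n => var (ρ n)) = fun n => var (upr ρ n) := by
  funext n
  cases n <;> rfl

theorem rename_eq_subst (t : Tm) (ρ : ℕ → ℕ) : t.rename ρ = t.subst fun n => var (ρ n) := by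
  induction t generalizing ρ <;> simp_all [rename, subst, up_var_comp]

theorem up_var : up var = var := by
  funext n
  cases n <;> rfl

theorem subst_var (t : Tm) : t.subst var = t := by
  induction t <;> simp_all [subst, up_var]

theorem up_comp_upr (σ : ℕ → Tm) (ρ : ℕ → ℕ) :
    (fun n => up σ (upr ρ n)) = up fun n => σ (ρ n) := by
  funext n
  cases n <;> rfl

theorem rename_subst (t : Tm) (ρ : ℕ → ℕ) (σ : ℕ → Tm) :
    (t.rename ρ).subst σ = t.subst fun n => σ (ρ n) := by
  induction t generalizing ρ σ <;> simp_all [rename, subst, up_comp_upr]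

theorem rename_rename (t : Tm) (ρ ρ' : ℕ → ℕ) :
    (t.rename ρ).rename ρ' = t.rename fun n => ρ' (ρ n) := by
  rw [rename_eq_subst (t.rename ρ), rename_subst, rename_eq_subst]

theorem up_rename (σ : ℕ → Tm) (ρ : ℕ → ℕ) :
    (fun n => (up σ n).rename (upr ρ)) = up fun n => (σ n).rename ρ := by
  funext n
  cases n
  · rfl
  · simp only [up, scons, shift, rename_rename]
    rfl

theorem subst_rename (t : Tm) (σ : ℕ → Tm) (ρ : ℕ → ℕ) :
    (t.subst σ).rename ρ = t.subst fun n => (σ n).rename ρ := by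
  induction t generalizing ρ σ <;> simp_all [rename, subst, up_rename]

theorem up_subst (σ τ : ℕ → Tm) :
    (fun n => (up σ n).subst (up τ)) = up fun n => (σ n).subst τ := by
  funext n
  cases n
  · rfl
  · simp only [up, scons, shift, rename_subst, subst_rename]

/-- The composition laws build on each other: `up` weakens the substituted terms, so passing under a
binder here requires both mixed laws, `rename_subst` and `subst_rename`. -/
theorem subst_subst (t : Tm) (σ τ : ℕ → Tm) :
    (t.subst σ).subst τ = t.subst fun n => (σ n).subst τ := by
  induction t generalizing σ τ <;> simp_all [subst, up_subst]

theorem shift_subst (t : Tm) (k : ℕ) (σ : ℕ → Tm) :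
    (t.shift k).subst σ = t.subst fun n => σ (n + k) :=
  rename_subst _ _ _

theorem shift_one_inst (t a : Tm) : (t.shift 1).inst a = t := by
  rw [inst, shift_subst]
  exact subst_var t

theorem scons_comp (a : Tm) (σ τ : ℕ → Tm) :
    (fun n => (scons a σ n).subst τ) = scons (a.subst τ) fun n => (σ n).subst τ := by
  funext n
  cases n <;> rfl

theorem subst_up_inst (t a : Tm) (σ : ℕ → Tm) : (t.subst (up σ)).inst a = t.subst (scons a σ) := by
  rw [inst, subst_subst]
  congr 1
  funext n
  cases n
  · rfl
  · exact shift_one_inst _ _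

/-- Weakening below the innermost variable and instantiating with the new variable cancel. This is
what applying a weakened function to a fresh variable requires in `Realized.of_pi`. -/
theorem inst_var_zero (t : Tm) : (t.subst (up fun n => var (n + 1))).inst (var 0) = t := by
  rw [subst_up_inst]
  conv_rhs => rw [← subst_var t]
  congr 1
  funext n
  cases n <;> rfl

/-- The outer variable is instantiated first, as in the β-reduction of a twice abstracted term. -/
theorem inst₂_eq (t a b : Tm) : t.inst₂ a b = (t.subst (up (scons a var))).inst b := by
  rw [subst_up_inst]
  rfl

end Tm

open Tm

/-! ## Structural properties of derivations -/

/-- `σ` is a substitution from `Γ` to `Δ`. -/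
def Sb (Γ : Ctx) (σ : ℕ → Tm) (Δ : Ctx) : Prop :=
  ∀ (n : ℕ) (B : Tm), Δ[n]? = some B → Der (.tm Γ (σ n) ((B.shift (n + 1)).subst σ))

/-- `A` is a type in context `Γ`. -/
def IsTy (Γ : Ctx) (A : Tm) : Prop := ∃ i, Der (.tm Γ A (.univ i))

/-- `A` and `B` are equal types in context `Γ`. -/
def EqTy (Γ : Ctx) (A B : Tm) : Prop :=
  ∃ i, Der (.tm Γ A (.univ i)) ∧ Der (.tm Γ B (.univ i)) ∧ Der (.eq Γ A B (.univ i))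

theorem Der.cumul_le {Γ A i j} (h : Der (.tm Γ A (.univ i))) (hij : i ≤ j) :
    Der (.tm Γ A (.univ j)) := by
  induction hij with
  | refl => exact h
  | step _ ih => exact ih.cumul

theorem Der.cumulEq_le {Γ A B i j} (h : Der (.eq Γ A B (.univ i))) (hij : i ≤ j) :
    Der (.eq Γ A B (.univ j)) := by
  induction hij with
  | refl => exact h
  | step _ ih => exact ih.cumulEq

theorem EqTy.left {Γ A B} (h : EqTy Γ A B) : IsTy Γ A := by
  obtain ⟨i, h, _⟩ := h
  exact ⟨i, h⟩

theorem EqTy.right {Γ A B} (h : EqTy Γ A B) : IsTy Γ B := by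
  obtain ⟨i, _, h, _⟩ := h
  exact ⟨i, h⟩

theorem IsTy.eqRfl {Γ A} (h : IsTy Γ A) : EqTy Γ A A := by
  obtain ⟨i, h⟩ := h
  exact ⟨i, h, h, h.rfl⟩

theorem EqTy.symm {Γ A B} (h : EqTy Γ A B) : EqTy Γ B A := by
  obtain ⟨i, h₁, h₂, h⟩ := h
  exact ⟨i, h₂, h₁, h.symm⟩

theorem EqTy.trans {Γ A B C} (h : EqTy Γ A B) (h' : EqTy Γ B C) : EqTy Γ A C := by
  obtain ⟨i, h₁, _, h⟩ := h
  obtain ⟨j, _, h₂, h'⟩ := h'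
  exact ⟨max i j, h₁.cumul_le (le_max_left _ _), h₂.cumul_le (le_max_right _ _),
    (h.cumulEq_le (le_max_left _ _)).trans (h'.cumulEq_le (le_max_right _ _))⟩

theorem Der.conv' {Γ t A B} (h : Der (.tm Γ t A)) (e : EqTy Γ A B) : Der (.tm Γ t B) := by
  obtain ⟨i, _, _, e⟩ := e
  exact h.conv e

theorem Der.convEq' {Γ t u A B} (h : Der (.eq Γ t u A)) (e : EqTy Γ A B) : Der (.eq Γ t u B) := by
  obtain ⟨i, _, _, e⟩ := e
  exact h.convEq e

theorem IsTy.ctx_cons {Γ A} (h : IsTy Γ A) : Der (.ctx (A :: Γ)) := by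
  obtain ⟨i, h⟩ := h
  exact h.cons

theorem Sb.id {Γ} (h : Der (.ctx Γ)) : Sb Γ var Γ := by
  intro n B hB
  rw [subst_var]
  exact .var h hB

theorem Sb.scons {Γ Δ σ a A} (h : Sb Γ σ Δ) (ha : Der (.tm Γ a (A.subst σ))) :
    Sb Γ (scons a σ) (A :: Δ) := by
  intro n B hB
  rw [shift_subst]
  cases n with
  | zero =>
    obtain rfl : A = B := by simpa using hB
    exact ha
  | succ n =>
    have := h n B (by simpa using hB)
    rw [shift_subst] at this
    exact this

theorem Sb.wk {Γ A} (h : Der (.ctx (A :: Γ))) : Sb (A :: Γ) (fun n => var (n + 1)) Γ := by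
  intro n B hB
  have := Der.var (n := n + 1) h (by simpa using hB)
  rw [shift, rename_eq_subst] at this
  rw [shift_subst]
  exact this

theorem Sb.tm {Γ Δ σ t A} (hΓ : Der (.ctx Γ)) (hσ : Sb Γ σ Δ) (h : Der (.tm Δ t A)) :
    Der (.tm Γ (t.subst σ) (A.subst σ)) := .substTm hΓ hσ h

theorem Sb.eq {Γ Δ σ t u A} (hΓ : Der (.ctx Γ)) (hσ : Sb Γ σ Δ) (h : Der (.eq Δ t u A)) :
    Der (.eq Γ (t.subst σ) (u.subst σ) (A.subst σ)) := .substEq hΓ hσ h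

theorem Sb.isTy {Γ Δ σ A} (hΓ : Der (.ctx Γ)) (hσ : Sb Γ σ Δ) (h : IsTy Δ A) :
    IsTy Γ (A.subst σ) := by
  obtain ⟨i, h⟩ := h
  exact ⟨i, hσ.tm hΓ h⟩

theorem Der.wk {Γ A t T} (h : Der (.ctx (A :: Γ))) (ht : Der (.tm Γ t T)) :
    Der (.tm (A :: Γ) (t.shift 1) (T.shift 1)) := by
  have := (Sb.wk h).tm h ht
  rwa [← rename_eq_subst, ← rename_eq_subst] at this

theorem Der.wkEq {Γ A t u T} (h : Der (.ctx (A :: Γ))) (ht : Der (.eq Γ t u T)) :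
    Der (.eq (A :: Γ) (t.shift 1) (u.shift 1) (T.shift 1)) := by
  have := (Sb.wk h).eq h ht
  rwa [← rename_eq_subst, ← rename_eq_subst, ← rename_eq_subst] at this

theorem IsTy.wk {Γ A T} (h : Der (.ctx (A :: Γ))) (ht : IsTy Γ T) : IsTy (A :: Γ) (T.shift 1) := by
  obtain ⟨i, ht⟩ := ht
  exact ⟨i, Der.wk h ht⟩

theorem Sb.comp_wk {Γ Δ σ A} (hA : Der (.ctx (A :: Γ))) (hσ : Sb Γ σ Δ) :
    Sb (A :: Γ) (fun n => (σ n).shift 1) Δ := by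
  intro n B hB
  have := Der.wk hA (hσ n B hB)
  rwa [shift, shift, subst_rename] at this

theorem Sb.up {Γ Δ σ A} (hσ : Sb Γ σ Δ) (hA : IsTy Γ (A.subst σ)) :
    Sb (A.subst σ :: Γ) (up σ) (A :: Δ) := by
  refine Sb.scons (hσ.comp_wk hA.ctx_cons) ?_
  have := Der.var (n := 0) (A := A.subst σ) hA.ctx_cons (by simp)
  rwa [shift, subst_rename] at this

theorem Sb.inst {Γ a A} (hΓ : Der (.ctx Γ)) (ha : Der (.tm Γ a A)) :
    Sb Γ (Tm.scons a Tm.var) (A :: Γ) := by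
  refine Sb.scons (Sb.id hΓ) ?_
  rwa [subst_var]

theorem Der.inst {Γ a A t T} (hΓ : Der (.ctx Γ)) (h : Der (.tm (A :: Γ) t T))
    (ha : Der (.tm Γ a A)) : Der (.tm Γ (t.inst a) (T.inst a)) := (Sb.inst hΓ ha).tm hΓ h

theorem Der.instEq {Γ a A t u T} (hΓ : Der (.ctx Γ)) (h : Der (.eq (A :: Γ) t u T))
    (ha : Der (.tm Γ a A)) : Der (.eq Γ (t.inst a) (u.inst a) (T.inst a)) :=
  (Sb.inst hΓ ha).eq hΓ h

theorem IsTy.inst {Γ a A T} (hΓ : Der (.ctx Γ)) (h : IsTy (A :: Γ) T) (ha : Der (.tm Γ a A)) :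
    IsTy Γ (T.inst a) := (Sb.inst hΓ ha).isTy hΓ h

theorem EqTy.inst {Γ a A T T'} (hΓ : Der (.ctx Γ)) (h : EqTy (A :: Γ) T T')
    (ha : Der (.tm Γ a A)) : EqTy Γ (T.inst a) (T'.inst a) := by
  obtain ⟨i, h₁, h₂, h⟩ := h
  exact ⟨i, Der.inst hΓ h₁ ha, Der.inst hΓ h₂ ha, Der.instEq hΓ h ha⟩

/-- The identity substitution between contexts with equal first types. -/
theorem Sb.ctxConv {Γ A A'} (h : EqTy Γ A A') : Sb (A' :: Γ) var (A :: Γ) := by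
  intro n B hB
  rw [subst_var]
  cases n with
  | zero =>
    obtain rfl : A = B := by simpa using hB
    obtain ⟨i, _, h₂, h⟩ := h
    exact (Der.var (n := 0) (A := A') h₂.cons (by simp)).conv (Der.wkEq h₂.cons h.symm)
  | succ n => exact .var h.right.ctx_cons (by simpa using hB)

theorem Der.ctxConv {Γ A A' t T} (h : EqTy Γ A A') (ht : Der (.tm (A :: Γ) t T)) :
    Der (.tm (A' :: Γ) t T) := by
  have := (Sb.ctxConv h).tm h.right.ctx_cons ht
  rwa [subst_var, subst_var] at this

theorem Der.ctxConvEq {Γ A A' t u T} (h : EqTy Γ A A') (ht : Der (.eq (A :: Γ) t u T)) :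
    Der (.eq (A' :: Γ) t u T) := by
  have := (Sb.ctxConv h).eq h.right.ctx_cons ht
  rwa [subst_var, subst_var, subst_var] at this

theorem EqTy.ctxConv {Γ A A' T U} (h : EqTy Γ A A') (ht : EqTy (A :: Γ) T U) :
    EqTy (A' :: Γ) T U := by
  obtain ⟨i, h₁, h₂, h₃⟩ := ht
  exact ⟨i, h₁.ctxConv h, h₂.ctxConv h, h₃.ctxConvEq h⟩

/-- Equal terms may be substituted. -/
theorem Der.inst_congr {Γ a a' A t T} (hA : IsTy Γ A)
    (ht : Der (.tm (A :: Γ) t T)) (ha : Der (.tm Γ a A)) (ha' : Der (.tm Γ a' A))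
    (hT : EqTy Γ (T.inst a') (T.inst a)) (h : Der (.eq Γ a a' A)) :
    Der (.eq Γ (t.inst a) (t.inst a') (T.inst a)) := by
  obtain ⟨i, hA⟩ := hA
  -- Substitution of equal terms is not a rule. Both sides are β-expanded and compared by congruence
  -- of application.
  have h₁ := Der.appCongr (Der.lam hA ht).rfl h
  exact ((Der.piBeta ht ha).symm.trans h₁).trans ((Der.piBeta ht ha').convEq' hT)

theorem IsTy.inst_congr {Γ a a' A T} (hΓ : Der (.ctx Γ)) (hA : IsTy Γ A) (hT : IsTy (A :: Γ) T)
    (ha : Der (.tm Γ a A)) (ha' : Der (.tm Γ a' A)) (h : Der (.eq Γ a a' A)) :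
    EqTy Γ (T.inst a) (T.inst a') := by
  obtain ⟨i, hT⟩ := hT
  have hU : EqTy Γ ((Tm.univ i).inst a') ((Tm.univ i).inst a) := IsTy.eqRfl ⟨_, .univ hΓ⟩
  exact ⟨i, Der.inst hΓ hT ha, Der.inst hΓ hT ha', hT.inst_congr hA ha ha' hU h⟩

theorem IsTy.subst_congr {Γ Δ σ a a' A T} (hΓ : Der (.ctx Γ)) (hσ : Sb Γ σ Δ)
    (hA : IsTy Δ A) (hT : IsTy (A :: Δ) T) (ha : Der (.tm Γ a (A.subst σ)))
    (ha' : Der (.tm Γ a' (A.subst σ))) (h : Der (.eq Γ a a' (A.subst σ))) :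
    EqTy Γ (T.subst (Tm.scons a σ)) (T.subst (Tm.scons a' σ)) := by
  have hA' := hσ.isTy hΓ hA
  have := IsTy.inst_congr hΓ hA' ((hσ.up hA').isTy hA'.ctx_cons hT) ha ha' h
  rwa [subst_up_inst, subst_up_inst] at this

/-! ## Generation: the components of a well-formed type are well-formed -/

/-- What `t` being well-typed in context `Γ` says about its components. -/
def Gen (Γ : Ctx) : Tm → Prop
  | .var n => n < Γ.length
  | .pi A B => IsTy Γ A ∧ IsTy (A :: Γ) B
  | .sg A B => IsTy Γ A ∧ IsTy (A :: Γ) B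
  | .sum A B => IsTy Γ A ∧ IsTy Γ B
  | .id A a b => IsTy Γ A ∧ Der (.tm Γ a A) ∧ Der (.tm Γ b A)
  | _ => True

/-- Induction on derivations suffices because conversion and cumulativity leave the term unchanged,
and a substitution instance of a type former is again one. Only type formers and variables receive
information in `Gen`; nothing is claimed for introduction forms, where inversion would hold only up
to conversion of types. -/
theorem gen_of_der {J : Judgement} (h : Der J) : ∀ Γ t A, J = .tm Γ t A → Gen Γ t := by
  induction h with
  | @substTm Γ Δ σ t A hΓ hσ ht _ ih₁ ih₂ =>
    rintro _ _ _ ⟨⟩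
    have hσ : Sb Γ σ Δ := hσ
    have ih := ih₂ _ _ _ rfl
    cases t with
    -- The instance of a variable is `σ n`, whose derivation is a premise of the rule. The bound
    -- recorded in `Gen` ensures that the premise for `n` exists.
    | var n => exact ih₁ n _ (List.getElem?_eq_getElem ih) _ _ _ rfl
    | pi A B => exact ⟨hσ.isTy hΓ ih.1, (hσ.up (hσ.isTy hΓ ih.1)).isTy (hσ.isTy hΓ ih.1).ctx_cons ih.2⟩
    | sg A B => exact ⟨hσ.isTy hΓ ih.1, (hσ.up (hσ.isTy hΓ ih.1)).isTy (hσ.isTy hΓ ih.1).ctx_cons ih.2⟩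
    | sum A B => exact ⟨hσ.isTy hΓ ih.1, hσ.isTy hΓ ih.2⟩
    | id A a b => exact ⟨hσ.isTy hΓ ih.1, hσ.tm hΓ ih.2.1, hσ.tm hΓ ih.2.2⟩
    | _ => trivial
  | var _ hn => rintro _ _ _ ⟨⟩; exact (List.getElem?_eq_some_iff.1 hn).1
  | conv _ _ ih => rintro _ _ _ ⟨⟩; exact ih _ _ _ rfl
  | cumul _ ih => rintro _ _ _ ⟨⟩; exact ih _ _ _ rfl
  | pi hA hB => rintro _ _ _ ⟨⟩; exact ⟨⟨_, hA⟩, ⟨_, hB⟩⟩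
  | sg hA hB => rintro _ _ _ ⟨⟩; exact ⟨⟨_, hA⟩, ⟨_, hB⟩⟩
  | sum hA hB => rintro _ _ _ ⟨⟩; exact ⟨⟨_, hA⟩, ⟨_, hB⟩⟩
  | id hA ha hb => rintro _ _ _ ⟨⟩; exact ⟨⟨_, hA⟩, ha, hb⟩
  | _ => rintro _ _ _ ⟨⟩ <;> trivial

/-! ## Operations on terms for fast evaluation

These functions are written with recursors whose minor premises are closed terms. -/

/-- The branches are arguments of the recursor, so weak head reduction evaluates only the one that
is selected. -/
noncomputable def bcase {α : Type} (c : Bool) (x y : α) : α := Bool.rec (motive := fun _ => α) y x c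

noncomputable def andb (c d : Bool) : Bool := Bool.rec (motive := fun _ => Bool) false d c

noncomputable def obind {α β : Type} (x : Option α) (f : α → Option β) : Option β :=
  Option.rec (motive := fun _ => Option β) none f x

/-- The value of `f` at the content of `x`, or a default value. -/
noncomputable def ocase {α β : Type} (x : Option α) (d : β) (f : α → β) : β :=
  Option.rec (motive := fun _ => β) d f x

namespace Tm

/-- The index of the constructor. -/
noncomputable def tag (t : Tm) : ℕ :=
  Tm.rec (motive := fun _ => ℕ)
    (fun _ => 0) (fun _ => 1) (fun _ _ _ _ => 2) (fun _ _ _ _ => 3) (fun _ _ _ _ => 4)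
    (fun _ _ _ _ => 5) (fun _ _ _ _ => 6) (fun _ _ => 7) (fun _ _ => 8) (fun _ _ _ _ => 9)
    (fun _ _ => 10) (fun _ _ => 11) (fun _ _ _ _ _ _ _ _ => 12) 13 (fun _ _ _ _ => 14) 15 16
    (fun _ _ _ _ _ _ => 17) 18 19 (fun _ _ => 20) (fun _ _ _ _ _ _ _ _ => 21)
    (fun _ _ _ _ _ _ => 22) (fun _ _ => 23) (fun _ _ _ _ _ _ => 24) (fun _ _ => 25)
    (fun _ _ => 26) (fun _ _ _ _ => 27) (fun _ _ _ _ _ _ _ _ => 28) (fun _ => 29) (fun _ => 30) t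

/-- The first argument of the constructor, if it is a term. -/
noncomputable def fst! (t : Tm) : Tm :=
  Tm.rec (motive := fun _ => Tm)
    (fun _ => star) (fun _ => star) (fun a _ _ _ => a) (fun a _ _ _ => a) (fun a _ _ _ => a)
    (fun a _ _ _ => a) (fun a _ _ _ => a) (fun a _ => a) (fun a _ => a) (fun a _ _ _ => a)
    (fun a _ => a) (fun a _ => a) (fun a _ _ _ _ _ _ _ => a) star (fun a _ _ _ => a) star star
    (fun a _ _ _ _ _ => a) star star (fun a _ => a) (fun a _ _ _ _ _ _ _ => a)
    (fun a _ _ _ _ _ => a) (fun a _ => a) (fun a _ _ _ _ _ => a) (fun a _ => a) (fun a _ => a)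
    (fun a _ _ _ => a) (fun a _ _ _ _ _ _ _ => a) (fun _ => star) (fun _ => star) t

/-- The second argument of the constructor. -/
noncomputable def snd! (t : Tm) : Tm :=
  Tm.rec (motive := fun _ => Tm)
    (fun _ => star) (fun _ => star) (fun _ b _ _ => b) (fun _ b _ _ => b) (fun _ b _ _ => b)
    (fun _ b _ _ => b) (fun _ b _ _ => b) (fun _ _ => star) (fun _ _ => star) (fun _ b _ _ => b)
    (fun _ _ => star) (fun _ _ => star) (fun _ b _ _ _ _ _ _ => b) star (fun _ b _ _ => b) star
    star (fun _ b _ _ _ _ => b) star star (fun _ _ => star) (fun _ b _ _ _ _ _ _ => b)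
    (fun _ b _ _ _ _ => b) (fun _ _ => star) (fun _ b _ _ _ _ => b) (fun _ _ => star)
    (fun _ _ => star) (fun _ b _ _ => b) (fun _ b _ _ _ _ _ _ => b) (fun _ => star)
    (fun _ => star) t

/-- The third argument of the constructor. -/
noncomputable def thd! (t : Tm) : Tm :=
  Tm.rec (motive := fun _ => Tm)
    (fun _ => star) (fun _ => star) (fun _ _ _ _ => star) (fun _ _ _ _ => star)
    (fun _ _ _ _ => star) (fun _ _ _ _ => star) (fun _ _ _ _ => star) (fun _ _ => star)
    (fun _ _ => star) (fun _ _ _ _ => star) (fun _ _ => star) (fun _ _ => star)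
    (fun _ _ c _ _ _ _ _ => c) star (fun _ _ _ _ => star) star star (fun _ _ c _ _ _ => c) star
    star (fun _ _ => star) (fun _ _ c _ _ _ _ _ => c) (fun _ _ c _ _ _ => c) (fun _ _ => star)
    (fun _ _ c _ _ _ => c) (fun _ _ => star) (fun _ _ => star) (fun _ _ _ _ => star)
    (fun _ _ c _ _ _ _ _ => c) (fun _ => star) (fun _ => star) t

/-- The fourth argument of the constructor. -/
noncomputable def fth! (t : Tm) : Tm :=
  Tm.rec (motive := fun _ => Tm)
    (fun _ => star) (fun _ => star) (fun _ _ _ _ => star) (fun _ _ _ _ => star)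
    (fun _ _ _ _ => star) (fun _ _ _ _ => star) (fun _ _ _ _ => star) (fun _ _ => star)
    (fun _ _ => star) (fun _ _ _ _ => star) (fun _ _ => star) (fun _ _ => star)
    (fun _ _ _ d _ _ _ _ => d) star (fun _ _ _ _ => star) star star (fun _ _ _ _ _ _ => star) star
    star (fun _ _ => star) (fun _ _ _ d _ _ _ _ => d) (fun _ _ _ _ _ _ => star) (fun _ _ => star)
    (fun _ _ _ _ _ _ => star) (fun _ _ => star) (fun _ _ => star) (fun _ _ _ _ => star)
    (fun _ _ _ d _ _ _ _ => d) (fun _ => star) (fun _ => star) t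

/-- The argument of the constructor, if it is a number. -/
noncomputable def num! (t : Tm) : ℕ :=
  Tm.rec (motive := fun _ => ℕ)
    (fun n => n) (fun n => n) (fun _ _ _ _ => 0) (fun _ _ _ _ => 0) (fun _ _ _ _ => 0)
    (fun _ _ _ _ => 0) (fun _ _ _ _ => 0) (fun _ _ => 0) (fun _ _ => 0) (fun _ _ _ _ => 0)
    (fun _ _ => 0) (fun _ _ => 0) (fun _ _ _ _ _ _ _ _ => 0) 0 (fun _ _ _ _ => 0) 0 0
    (fun _ _ _ _ _ _ => 0) 0 0 (fun _ _ => 0) (fun _ _ _ _ _ _ _ _ => 0) (fun _ _ _ _ _ _ => 0)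
    (fun _ _ => 0) (fun _ _ _ _ _ _ => 0) (fun _ _ => 0) (fun _ _ => 0) (fun _ _ _ _ => 0)
    (fun _ _ _ _ _ _ _ _ => 0) (fun n => n) (fun n => n) t

noncomputable def isTag (t : Tm) (k : ℕ) : Bool := Nat.beq t.tag k

/-- Boolean equality, on the fragment without natural numbers and truncations. -/
noncomputable def beq (t : Tm) : Tm → Bool :=
  Tm.rec (motive := fun _ => Tm → Bool)
    (fun n u => andb (u.isTag 0) (Nat.beq n u.num!))
    (fun n u => andb (u.isTag 1) (Nat.beq n u.num!))
    (fun _ _ a b u => andb (u.isTag 2) (andb (a u.fst!) (b u.snd!)))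
    (fun _ _ a b u => andb (u.isTag 3) (andb (a u.fst!) (b u.snd!)))
    (fun _ _ a b u => andb (u.isTag 4) (andb (a u.fst!) (b u.snd!)))
    (fun _ _ a b u => andb (u.isTag 5) (andb (a u.fst!) (b u.snd!)))
    (fun _ _ a b u => andb (u.isTag 6) (andb (a u.fst!) (b u.snd!)))
    (fun _ a u => andb (u.isTag 7) (a u.fst!))
    (fun _ a u => andb (u.isTag 8) (a u.fst!))
    (fun _ _ a b u => andb (u.isTag 9) (andb (a u.fst!) (b u.snd!)))
    (fun _ a u => andb (u.isTag 10) (a u.fst!))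
    (fun _ a u => andb (u.isTag 11) (a u.fst!))
    (fun _ _ _ _ a b c d u => andb (u.isTag 12)
      (andb (a u.fst!) (andb (b u.snd!) (andb (c u.thd!) (d u.fth!)))))
    (fun u => u.isTag 13)
    (fun _ _ a b u => andb (u.isTag 14) (andb (a u.fst!) (b u.snd!)))
    (fun u => u.isTag 15)
    (fun u => u.isTag 16)
    (fun _ _ _ a b c u => andb (u.isTag 17) (andb (a u.fst!) (andb (b u.snd!) (c u.thd!))))
    (fun _ => false) (fun _ => false) (fun _ _ _ => false) (fun _ _ _ _ _ _ _ _ _ => false)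
    (fun _ _ _ a b c u => andb (u.isTag 22) (andb (a u.fst!) (andb (b u.snd!) (c u.thd!))))
    (fun _ a u => andb (u.isTag 23) (a u.fst!))
    (fun _ _ _ a b c u => andb (u.isTag 24) (andb (a u.fst!) (andb (b u.snd!) (c u.thd!))))
    (fun _ _ _ => false) (fun _ _ _ => false) (fun _ _ _ _ _ => false)
    (fun _ _ _ _ _ _ _ _ _ => false)
    (fun n u => andb (u.isTag 29) (Nat.beq n u.num!))
    (fun n u => andb (u.isTag 30) (Nat.beq n u.num!)) t

/-- Whether an elimination of `t` is not a `β`-redex. -/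
noncomputable def isNeutral (t : Tm) : Bool :=
  Tm.rec (motive := fun _ => Bool)
    (fun _ => true) (fun _ => true) (fun _ _ _ _ => true) (fun _ _ _ _ => false)
    (fun _ _ _ _ => true) (fun _ _ _ _ => true) (fun _ _ _ _ => false) (fun _ _ => true)
    (fun _ _ => true) (fun _ _ _ _ => true) (fun _ _ => false) (fun _ _ => false)
    (fun _ _ _ _ _ _ _ _ => true) true (fun _ _ _ _ => true) true false (fun _ _ _ _ _ _ => true)
    true false (fun _ _ => false) (fun _ _ _ _ _ _ _ _ => true) (fun _ _ _ _ _ _ => true)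
    (fun _ _ => false) (fun _ _ _ _ _ _ => true) (fun _ _ => true) (fun _ _ => false)
    (fun _ _ _ _ => true) (fun _ _ _ _ _ _ _ _ => true) (fun _ => true) (fun _ => true) t

/-- Weakening by `k` variables, under `c` binders. -/
noncomputable def lift (t : Tm) : ℕ → ℕ → Tm :=
  Tm.rec (motive := fun _ => ℕ → ℕ → Tm)
    (fun n k c => bcase (Nat.ble c n) (var (Nat.add n k)) (var n))
    (fun i _ _ => univ i)
    (fun _ _ a b k c => pi (a k c) (b k (Nat.add c 1)))
    (fun _ _ a b k c => lam (a k c) (b k (Nat.add c 1)))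
    (fun _ _ a b k c => app (a k c) (b k c))
    (fun _ _ a b k c => sg (a k c) (b k (Nat.add c 1)))
    (fun _ _ a b k c => pair (a k c) (b k c))
    (fun _ a k c => fst (a k c))
    (fun _ a k c => snd (a k c))
    (fun _ _ a b k c => sum (a k c) (b k c))
    (fun _ a k c => inl (a k c))
    (fun _ a k c => inr (a k c))
    (fun _ _ _ _ a b d e k c =>
      sumInd (a k (Nat.add c 1)) (b k (Nat.add c 1)) (d k (Nat.add c 1)) (e k c))
    (fun _ _ => zero)
    (fun _ _ a b k c => zeroInd (a k (Nat.add c 1)) (b k c))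
    (fun _ _ => one)
    (fun _ _ => star)
    (fun _ _ _ a b d k c => oneInd (a k (Nat.add c 1)) (b k c) (d k c))
    (fun _ _ => nat)
    (fun _ _ => natZero)
    (fun _ a k c => natSucc (a k c))
    (fun _ _ _ _ a b d e k c =>
      natInd (a k (Nat.add c 1)) (b k c) (d k (Nat.add c 2)) (e k c))
    (fun _ _ _ a b d k c => id (a k c) (b k c) (d k c))
    (fun _ a k c => refl (a k c))
    (fun _ _ _ a b d k c => idInd (a k (Nat.add c 2)) (b k c) (d k c))
    (fun _ a k c => trunc (a k c))
    (fun _ a k c => tr (a k c))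
    (fun _ _ a b k c => squash (a k c) (b k c))
    (fun _ _ _ _ a b d e k c => truncRec (a k c) (b k c) (d k c) (e k c))
    (fun i _ _ => funext i)
    (fun i _ _ => ua i) t

/-- The term for variable `n` in the substitution by the terms in `env`, followed by the weakening
by `k` variables. -/
noncomputable def pick (env : List Tm) : ℕ → ℕ → Tm :=
  List.rec (motive := fun _ => ℕ → ℕ → Tm) (fun n k => var (Nat.add n k))
    (fun u _ ih n k => bcase (Nat.beq n 0) u (ih (Nat.sub n 1) k)) env

/-- Substitution under `c` binders. -/
noncomputable def sub (t : Tm) : List Tm → ℕ → ℕ → Tm :=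
  Tm.rec (motive := fun _ => List Tm → ℕ → ℕ → Tm)
    (fun n s k c => bcase (Nat.ble c n)
      (bcase (Nat.beq c 0) (pick s n k) ((pick s (Nat.sub n c) k).lift c 0)) (var n))
    (fun i _ _ _ => univ i)
    (fun _ _ a b s k c => pi (a s k c) (b s k (Nat.add c 1)))
    (fun _ _ a b s k c => lam (a s k c) (b s k (Nat.add c 1)))
    (fun _ _ a b s k c => app (a s k c) (b s k c))
    (fun _ _ a b s k c => sg (a s k c) (b s k (Nat.add c 1)))
    (fun _ _ a b s k c => pair (a s k c) (b s k c))
    (fun _ a s k c => fst (a s k c))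
    (fun _ a s k c => snd (a s k c))
    (fun _ _ a b s k c => sum (a s k c) (b s k c))
    (fun _ a s k c => inl (a s k c))
    (fun _ a s k c => inr (a s k c))
    (fun _ _ _ _ a b d e s k c =>
      sumInd (a s k (Nat.add c 1)) (b s k (Nat.add c 1)) (d s k (Nat.add c 1)) (e s k c))
    (fun _ _ _ => zero)
    (fun _ _ a b s k c => zeroInd (a s k (Nat.add c 1)) (b s k c))
    (fun _ _ _ => one)
    (fun _ _ _ => star)
    (fun _ _ _ a b d s k c => oneInd (a s k (Nat.add c 1)) (b s k c) (d s k c))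
    (fun _ _ _ => nat)
    (fun _ _ _ => natZero)
    (fun _ a s k c => natSucc (a s k c))
    (fun _ _ _ _ a b d e s k c =>
      natInd (a s k (Nat.add c 1)) (b s k c) (d s k (Nat.add c 2)) (e s k c))
    (fun _ _ _ a b d s k c => id (a s k c) (b s k c) (d s k c))
    (fun _ a s k c => refl (a s k c))
    (fun _ _ _ a b d s k c => idInd (a s k (Nat.add c 2)) (b s k c) (d s k c))
    (fun _ a s k c => trunc (a s k c))
    (fun _ a s k c => tr (a s k c))
    (fun _ _ a b s k c => squash (a s k c) (b s k c))
    (fun _ _ _ _ a b d e s k c => truncRec (a s k c) (b s k c) (d s k c) (e s k c))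
    (fun i _ _ _ => funext i)
    (fun i _ _ _ => ua i) t

noncomputable def wk (t : Tm) : Tm := t.lift 1 0

noncomputable def at₁ (B a : Tm) : Tm := B.sub [a] 0 0

noncomputable def at₂ (B a b : Tm) : Tm := B.sub [b, a] 0 0

/-- `B[a/z]` for `B` over `Γ, z` and `a` over `Γ, x`. -/
noncomputable def atUnder (B a : Tm) : Tm := B.sub [a] 1 0

/-- Undo a weakening. -/
noncomputable def unwk (t : Tm) : Tm := t.sub [star] 0 0

/-- Whether variable `c` does not occur. -/
noncomputable def noVar (t : Tm) : ℕ → Bool :=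
  Tm.rec (motive := fun _ => ℕ → Bool)
    (fun n c => bcase (Nat.beq n c) false true) (fun _ _ => true)
    (fun _ _ a b c => andb (a c) (b (Nat.add c 1))) (fun _ _ a b c => andb (a c) (b (Nat.add c 1)))
    (fun _ _ a b c => andb (a c) (b c)) (fun _ _ a b c => andb (a c) (b (Nat.add c 1)))
    (fun _ _ a b c => andb (a c) (b c)) (fun _ a c => a c) (fun _ a c => a c)
    (fun _ _ a b c => andb (a c) (b c)) (fun _ a c => a c) (fun _ a c => a c)
    (fun _ _ _ _ a b d e c => andb (e c)
      (andb (a (Nat.add c 1)) (andb (b (Nat.add c 1)) (d (Nat.add c 1)))))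
    (fun _ => true) (fun _ _ a b c => andb (b c) (a (Nat.add c 1))) (fun _ => true) (fun _ => true)
    (fun _ _ _ a b d c => andb (d c) (andb (b c) (a (Nat.add c 1)))) (fun _ => true) (fun _ => true)
    (fun _ a c => a c)
    (fun _ _ _ _ a b d e c => andb (e c)
      (andb (a (Nat.add c 1)) (andb (b c) (d (Nat.add c 2)))))
    (fun _ _ _ a b d c => andb (a c) (andb (b c) (d c))) (fun _ a c => a c)
    (fun _ _ _ a b d c => andb (d c) (andb (b c) (a (Nat.add c 2)))) (fun _ a c => a c)
    (fun _ a c => a c) (fun _ _ a b c => andb (a c) (b c))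
    (fun _ _ _ _ a b d e c => andb (andb (a c) (b c)) (andb (d c) (e c)))
    (fun _ _ => true) (fun _ _ => true) t

/-- Whether `b` is the application of a weakened function to the innermost variable. -/
noncomputable def isEtaBody (b : Tm) : Bool :=
  andb (b.isTag 4) (andb (b.snd!.beq (.var 0))
    (andb (b.fst!.noVar 0) (b.fst!.unwk.wk.beq b.fst!)))

/-- Whether `(a, b)` consists of the projections of a pair. -/
noncomputable def isEtaPair (a b : Tm) : Bool :=
  andb (a.isTag 7) (andb (b.isTag 8) (a.fst!.beq b.fst!))

/-- Whether the term is not the application of a `λ`. -/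
noncomputable def isNotAnn (t : Tm) : Bool :=
  bcase (t.isTag 4) (bcase (t.fst!.isTag 3) false true) true

/-- Whether a substitution by normal forms does not create redexes. -/
noncomputable def staysNormal (t : Tm) : List Tm → ℕ → ℕ → Bool :=
  Tm.rec (motive := fun _ => List Tm → ℕ → ℕ → Bool)
    (fun n s k c => bcase (Nat.ble c n) (pick s (Nat.sub n c) k).isNotAnn true)
    (fun _ _ _ _ => true) (fun _ _ a b s k c => andb (a s k c) (b s k (Nat.add c 1)))
    (fun _ _ a b s k c => andb (a s k c) (b s k (Nat.add c 1)))
    (fun f _ a b s k c => andb (f.sub s k c).isNeutral (andb (a s k c) (b s k c)))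
    (fun _ _ a b s k c => andb (a s k c) (b s k (Nat.add c 1)))
    (fun u v a b s k c => andb (bcase (isEtaPair (u.sub s k c) (v.sub s k c)) false true)
      (andb (a s k c) (b s k c)))
    (fun p a s k c => andb (p.sub s k c).isNeutral (a s k c))
    (fun p a s k c => andb (p.sub s k c).isNeutral (a s k c))
    (fun _ _ a b s k c => andb (a s k c) (b s k c)) (fun _ a s k c => a s k c)
    (fun _ a s k c => a s k c)
    (fun _ _ _ p a b d e s k c => andb (p.sub s k c).isNeutral (andb (e s k c)
      (andb (a s k (Nat.add c 1)) (andb (b s k (Nat.add c 1)) (d s k (Nat.add c 1))))))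
    (fun _ _ _ => true) (fun _ _ a b s k c => andb (b s k c) (a s k (Nat.add c 1)))
    (fun _ _ _ => true) (fun _ _ _ => true)
    (fun _ _ p a b d s k c => andb (p.sub s k c).isNeutral (andb (d s k c)
      (andb (b s k c) (a s k (Nat.add c 1)))))
    (fun _ _ _ => true) (fun _ _ _ => true) (fun _ a s k c => a s k c)
    (fun _ _ _ _ _ _ _ _ _ _ _ => false)
    (fun _ _ _ a b d s k c => andb (a s k c) (andb (b s k c) (d s k c)))
    (fun _ a s k c => a s k c)
    (fun _ _ p a b d s k c => andb (p.sub s k c).isNeutral (andb (d s k c)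
      (andb (b s k c) (a s k (Nat.add c 2)))))
    (fun _ a s k c => a s k c) (fun _ a s k c => a s k c)
    (fun _ _ a b s k c => andb (a s k c) (b s k c))
    (fun _ _ _ _ a b d e s k c => andb (andb (a s k c) (b s k c)) (andb (d s k c) (e s k c)))
    (fun _ _ _ _ => true) (fun _ _ _ _ => true) t

/-- Substituting the term into a normal form does not create redexes. -/
noncomputable def isPlain (t : Tm) : Bool :=
  andb t.isNeutral (bcase (t.isTag 4) t.fst!.isNeutral
    (bcase (t.isTag 7) false (bcase (t.isTag 8) false true)))

/-- Whether inference does not find the right type of the term. -/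
noncomputable def needsAnn (t : Tm) : Bool :=
  Tm.rec (motive := fun _ => Bool)
    (fun _ => false) (fun _ => false) (fun _ _ _ _ => false)
    (fun _ t _ b => bcase (t.isTag 6) true b)
    (fun _ _ _ _ => false) (fun _ _ _ _ => false) (fun _ _ a b => bcase a true b)
    (fun _ _ => false) (fun _ _ => false) (fun _ _ _ _ => false) (fun _ _ => true)
    (fun _ _ => true) (fun _ _ _ _ _ _ _ _ => false) false (fun _ _ _ _ => false) false false
    (fun _ _ _ _ _ _ => false) false false (fun _ _ => false) (fun _ _ _ _ _ _ _ _ => false)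
    (fun _ _ _ _ _ _ => false) (fun _ _ => true) (fun _ _ _ _ _ _ => false) (fun _ _ => false)
    (fun _ _ => false) (fun _ _ _ _ => false) (fun _ _ _ _ _ _ _ _ => false) (fun _ => false)
    (fun _ => false) t

/-- Annotate a term whose type cannot be inferred by its type. -/
noncomputable def ann (a A : Tm) : Tm := bcase a.needsAnn (app (lam A (var 0)) a) a

end Tm

noncomputable def look (Γ : Ctx) : ℕ → Option Tm :=
  List.rec (motive := fun _ => ℕ → Option Tm) (fun _ => none)
    (fun A _ ih n => bcase (Nat.beq n 0) (some A) (ih (Nat.sub n 1))) Γ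

noncomputable def allPlain (env : List Tm) : Bool :=
  List.rec (motive := fun _ => Bool) true (fun u _ ih => andb u.isPlain ih) env

/-! ## A type checker -/

/-- Functions that infer the normal form and the type of a term. -/
abbrev Inf : Type := Ctx → Tm → Option (Tm × Tm)

/-- Functions that find the normal form of a term of given type. -/
abbrev Chk : Type := Ctx → Tm → Tm → Option Tm

/-- A type with a substitution by the terms in `env`, followed by the weakening by `k` variables. -/
structure Clo : Type where
  ty : Tm
  env : List Tm
  k : ℕ

/-- Whether a substitution by normal forms in a normal form is recognised as a normal form. -/
noncomputable def isNf (t : Tm) (env : List Tm) (k : ℕ) : Bool :=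
  bcase (allPlain env) true (t.staysNormal env k 0)

/-- The normal form and the level of a type. -/
noncomputable def infTy (inf : Inf) (Γ : Ctx) (A : Tm) : Option (Tm × ℕ) :=
  obind (inf Γ A) fun r => bcase (r.2.isTag 1) (some (r.1, r.2.num!)) none

/-- The flag says that the type is already recognised as normal and only saves work: soundness does
not depend on its being right. -/
noncomputable def nfTy (nf : Bool) (inf : Inf) (Γ : Ctx) (A : Tm) : Option Tm :=
  bcase nf (some A) (obind (infTy inf Γ A) fun r => some r.1)

noncomputable def nfTm (nf : Bool) (chk : Chk) (Γ : Ctx) (t T : Tm) : Option Tm :=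
  bcase nf (some t) (chk Γ t T)

noncomputable def isIdSub (env : List Tm) (k : ℕ) : Bool :=
  List.rec (motive := fun _ => Bool) (Nat.beq k 0) (fun _ _ _ => false) env

/-- Carry out the substitution. -/
noncomputable def force (inf : Inf) (Γ : Ctx) (F : Clo) : Option Tm :=
  bcase (isIdSub F.env F.k) (some F.ty)
    (nfTy (isNf F.ty F.env F.k) inf Γ (F.ty.sub F.env F.k 0))

/-- Cumulativity is used only between universes themselves, not below type formers; all other types
are compared syntactically as normal forms. -/
noncomputable def subTy (T T' : Tm) : Bool :=
  bcase (T'.isTag 1) (andb (T.isTag 1) (Nat.ble T.num! T'.num!)) (T.beq T')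

/-- The normal form of `λ (x : A), b` of type `Π (x : A), B`. -/
noncomputable def etaLam (chk : Chk) (Γ : Ctx) (A b B : Tm) : Option Tm :=
  bcase b.isEtaBody (chk Γ b.fst!.unwk (.pi A B)) (some (.lam A b))

/-- The normal form of `(a, b)` of type `P`. -/
noncomputable def etaPair (chk : Chk) (Γ : Ctx) (a b P : Tm) : Option Tm :=
  bcase (isEtaPair a b) (chk Γ a.fst! P) (some (.pair a b))

noncomputable def maxLevel (i j : ℕ) : ℕ := bcase (Nat.ble i j) j i

noncomputable def infVar (n : ℕ) (_ : Inf) (_ : Chk) (Γ : Ctx) : Option (Tm × Tm) :=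
  obind (look Γ n) fun A => some (.var n, A.lift (Nat.add n 1) 0)

noncomputable def infUniv (i : ℕ) (_ : Inf) (_ : Chk) (_ : Ctx) : Option (Tm × Tm) :=
  some (.univ i, .univ (Nat.add i 1))

noncomputable def infPi (A B : Tm) (inf : Inf) (_ : Chk) (Γ : Ctx) : Option (Tm × Tm) :=
  obind (infTy inf Γ A) fun r => obind (infTy inf (r.1 :: Γ) B) fun s =>
    some (.pi r.1 s.1, .univ (maxLevel r.2 s.2))

noncomputable def infSg (A B : Tm) (inf : Inf) (_ : Chk) (Γ : Ctx) : Option (Tm × Tm) :=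
  obind (infTy inf Γ A) fun r => obind (infTy inf (r.1 :: Γ) B) fun s =>
    some (.sg r.1 s.1, .univ (maxLevel r.2 s.2))

noncomputable def infSum (A B : Tm) (inf : Inf) (_ : Chk) (Γ : Ctx) : Option (Tm × Tm) :=
  obind (infTy inf Γ A) fun r => obind (infTy inf Γ B) fun s =>
    some (.sum r.1 s.1, .univ (maxLevel r.2 s.2))

noncomputable def infLam (A b : Tm) (inf : Inf) (chk : Chk) (Γ : Ctx) : Option (Tm × Tm) :=
  obind (infTy inf Γ A) fun r => obind (inf (r.1 :: Γ) b) fun s =>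
  obind (etaLam chk Γ r.1 s.1 s.2) fun t => some (t, .pi r.1 s.2)

/-- Infer the type of `(λ (x : A), b) a`, where `λ (x : A), x` serves as a type annotation. -/
noncomputable def infBeta (A b a : Tm) (inf : Inf) (chk : Chk) (Γ : Ctx) : Option (Tm × Tm) :=
  obind (infTy inf Γ A) fun r => obind (chk Γ a r.1) fun a' =>
    bcase (b.beq (.var 0)) (some (a', r.1))
      (obind (inf (r.1 :: Γ) b) fun s => obind (nfTy (isNf s.2 [a'.ann r.1] 0) inf Γ (s.2.at₁
        (a'.ann r.1))) fun T =>
        obind (nfTm (isNf s.1 [a'.ann r.1] 0) chk Γ (s.1.at₁ (a'.ann r.1)) T) fun t => some (t, T))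

/-- Force the type of `f`, unless its constructor has index `i` and that of `f` is not `j`. -/
noncomputable def expose (i j : ℕ) (inf : Inf) (Γ : Ctx) (f : Tm) (F : Clo) : Option Clo :=
  bcase (andb (F.ty.isTag i) (bcase (f.isTag j) false true)) (some F)
    (obind (force inf Γ F) fun T => bcase (T.isTag i) (some ⟨T, [], 0⟩) none)

/-- The normal form and type of `f a'`, for a normal form `f` of type `F` and `a'` of type `D`. -/
noncomputable def spApp (f a' D : Tm) (F : Clo) (inf : Inf) (chk : Chk) (Γ : Ctx) :
    Option (Tm × Clo) :=
  bcase (f.isTag 3)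
    (bcase (f.fst!.beq F.ty.fst!)
      (obind (chk (F.ty.fst! :: Γ) f.snd! F.ty.snd!) fun b =>
       obind (force inf Γ ⟨F.ty.snd!, [a'.ann D], 0⟩) fun T =>
       obind (nfTm (isNf b [a'.ann D] 0) chk Γ (b.at₁ (a'.ann D)) T) fun t => some (t, ⟨T, [], 0⟩))
      none)
    (some (.app f a', ⟨F.ty.snd!, a'.ann D :: F.env, F.k⟩))

/-- The end of a spine: the inferred type is an explicit term, hence a closure with the identity
substitution. -/
noncomputable def spInf (t : Tm) (inf : Inf) (_ : Chk) (Γ : Ctx) : Option (Tm × Clo) :=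
  obind (inf Γ t) fun r => some (r.1, ⟨r.2, [], 0⟩)

/-- The normal forms of the components of a normal form `p` of type `Σ (x : A), B`, and the type
of the second one. -/
noncomputable def chkComps (p A B : Tm) (inf : Inf) (chk : Chk) (Γ : Ctx) :
    Option (Tm × Tm × Tm) :=
  obind (chk Γ p.fst! A) fun a => obind (nfTy (isNf B [a.ann A] 0) inf Γ (B.at₁ (a.ann A))) fun T =>
  obind (chk Γ p.snd! T) fun b => some (a, b, T)

noncomputable def spFst (p : Tm) (F : Clo) (inf : Inf) (chk : Chk) (Γ : Ctx) : Option (Tm × Clo) :=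
  bcase (p.isTag 6)
    (obind (chkComps p F.ty.fst! F.ty.snd! inf chk Γ) fun c => some (c.1, ⟨F.ty.fst!, [], 0⟩))
    (some (.fst p, ⟨F.ty.fst!, F.env, F.k⟩))

noncomputable def spSnd (p : Tm) (F : Clo) (inf : Inf) (chk : Chk) (Γ : Ctx) : Option (Tm × Clo) :=
  bcase (p.isTag 6)
    (obind (chkComps p F.ty.fst! F.ty.snd! inf chk Γ) fun c => some (c.2.1, ⟨c.2.2, [], 0⟩))
    (some (.snd p, ⟨F.ty.snd!, .fst p :: F.env, F.k⟩))

/-- Infer the normal form and type of an iterated elimination of functions and pairs. -/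
noncomputable def spine (t : Tm) : Inf → Chk → Ctx → Option (Tm × Clo) :=
  Tm.rec (motive := fun _ => Inf → Chk → Ctx → Option (Tm × Clo))
    (fun n _ _ Γ => obind (look Γ n) fun A => some (.var n, ⟨A, [], Nat.add n 1⟩))
    (fun n => spInf (.univ n)) (fun a b _ _ => spInf (.pi a b)) (fun a b _ _ => spInf (.lam a b))
    (fun f a ih _ inf chk Γ => bcase (f.isTag 3) (spInf (.app f a) inf chk Γ)
      (obind (ih inf chk Γ) fun r => obind (expose 2 3 inf Γ r.1 r.2) fun F =>
       obind (force inf Γ ⟨F.ty.fst!, F.env, F.k⟩) fun D => obind (chk Γ a D) fun a' =>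
         spApp r.1 a' D F inf chk Γ))
    (fun a b _ _ => spInf (.sg a b)) (fun a b _ _ => spInf (.pair a b))
    (fun p ih inf chk Γ => bcase (p.isTag 6) (spInf (.fst p) inf chk Γ)
      (obind (ih inf chk Γ) fun r => obind (expose 5 6 inf Γ r.1 r.2) fun F =>
       spFst r.1 F inf chk Γ))
    (fun p ih inf chk Γ => bcase (p.isTag 6) (spInf (.snd p) inf chk Γ)
      (obind (ih inf chk Γ) fun r => obind (expose 5 6 inf Γ r.1 r.2) fun F =>
       spSnd r.1 F inf chk Γ))
    (fun a b _ _ => spInf (.sum a b)) (fun a _ => spInf (.inl a))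
    (fun a _ => spInf (.inr a)) (fun a b c d _ _ _ _ => spInf (.sumInd a b c d)) (spInf .zero)
    (fun a b _ _ => spInf (.zeroInd a b)) (spInf .one) (spInf .star)
    (fun a b c _ _ _ => spInf (.oneInd a b c)) (spInf .nat) (spInf .natZero)
    (fun a _ => spInf (.natSucc a)) (fun a b c d _ _ _ _ => spInf (.natInd a b c d))
    (fun a b c _ _ _ => spInf (.id a b c)) (fun a _ => spInf (.refl a))
    (fun a b c _ _ _ => spInf (.idInd a b c)) (fun a _ => spInf (.trunc a))
    (fun a _ => spInf (.tr a)) (fun a b _ _ => spInf (.squash a b))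
    (fun a b c d _ _ _ _ => spInf (.truncRec a b c d)) (fun n => spInf (.funext n))
    (fun n => spInf (.ua n)) t

noncomputable def infPair (a b : Tm) (inf : Inf) (chk : Chk) (Γ : Ctx) : Option (Tm × Tm) :=
  obind (inf Γ a) fun r => obind (inf Γ b) fun s =>
  obind (etaPair chk Γ r.1 s.1 (.sg r.2 s.2.wk)) fun t => some (t, .sg r.2 s.2.wk)

/-- Infer the normal form and type of `t` by means of `spine`. -/
noncomputable def infSpine (t : Tm) (inf : Inf) (chk : Chk) (Γ : Ctx) : Option (Tm × Tm) :=
  obind (spine t inf chk Γ) fun r => obind (force inf Γ r.2) fun T => some (r.1, T)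

noncomputable def infApp (f a : Tm) (inf : Inf) (chk : Chk) (Γ : Ctx) : Option (Tm × Tm) :=
  bcase (f.isTag 3) (infBeta f.fst! f.snd! a inf chk Γ) (infSpine (.app f a) inf chk Γ)

/-- For an explicit pair the type of the other component is irrelevant, but that component must have
some type for the pair to be well typed; so it is inferred and discarded. -/
noncomputable def infFst (p : Tm) (inf : Inf) (chk : Chk) (Γ : Ctx) : Option (Tm × Tm) :=
  bcase (p.isTag 6) (obind (inf Γ p.fst!) fun r => obind (inf Γ p.snd!) fun _ => some r)
    (infSpine (.fst p) inf chk Γ)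

noncomputable def infSnd (p : Tm) (inf : Inf) (chk : Chk) (Γ : Ctx) : Option (Tm × Tm) :=
  bcase (p.isTag 6) (obind (inf Γ p.fst!) fun _ => inf Γ p.snd!) (infSpine (.snd p) inf chk Γ)

/-- The other summand is not determined by the term and `zero` is chosen. Where this is not the
intended type, `ann` supplies an annotation. -/
noncomputable def infInl (a : Tm) (inf : Inf) (_ : Chk) (Γ : Ctx) : Option (Tm × Tm) :=
  obind (inf Γ a) fun r => some (.inl r.1, .sum r.2 .zero)

noncomputable def infInr (b : Tm) (inf : Inf) (_ : Chk) (Γ : Ctx) : Option (Tm × Tm) :=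
  obind (inf Γ b) fun r => some (.inr r.1, .sum .zero r.2)

/-- The normal form of an elimination of `e : A + B` of type `T`. -/
noncomputable def sumIndRed (A B C c d e T : Tm) (chk : Chk) (Γ : Ctx) : Option Tm :=
  bcase (e.isTag 10) (obind (chk Γ e.fst! A) fun a =>
    nfTm (isNf c [a.ann A] 0) chk Γ (c.at₁ (a.ann A)) T)
    (bcase (e.isTag 11) (obind (chk Γ e.fst! B) fun b =>
      nfTm (isNf d [b.ann B] 0) chk Γ (d.at₁ (b.ann B)) T)
      (some (.sumInd C c d e)))

noncomputable def infSumInd (C c d e : Tm) (inf : Inf) (chk : Chk) (Γ : Ctx) :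
    Option (Tm × Tm) :=
  obind (inf Γ e) fun r => bcase (r.2.isTag 9)
    (obind (infTy inf (r.2 :: Γ) C) fun s =>
     obind (nfTy (isNf s.1 [ann (.inl (.var 0)) r.2.wk] 1) inf (r.2.fst! :: Γ) (s.1.atUnder (ann
       (.inl (.var 0)) r.2.wk))) fun L =>
     obind (chk (r.2.fst! :: Γ) c L) fun c' =>
     obind (nfTy (isNf s.1 [ann (.inr (.var 0)) r.2.wk] 1) inf (r.2.snd! :: Γ) (s.1.atUnder (ann
       (.inr (.var 0)) r.2.wk))) fun R =>
     obind (chk (r.2.snd! :: Γ) d R) fun d' =>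
     obind (nfTy (isNf s.1 [r.1.ann r.2] 0) inf Γ (s.1.at₁ (r.1.ann r.2))) fun T =>
     obind (sumIndRed r.2.fst! r.2.snd! s.1 c' d' r.1 T chk Γ) fun t => some (t, T))
    none

noncomputable def infZeroInd (C e : Tm) (inf : Inf) (chk : Chk) (Γ : Ctx) : Option (Tm × Tm) :=
  obind (infTy inf (.zero :: Γ) C) fun r => obind (chk Γ e .zero) fun e' =>
  obind (nfTy (isNf r.1 [e'.ann .zero] 0) inf Γ (r.1.at₁ (e'.ann .zero))) fun T =>
    some (.zeroInd r.1 e', T)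

noncomputable def infOneInd (C c e : Tm) (inf : Inf) (chk : Chk) (Γ : Ctx) : Option (Tm × Tm) :=
  obind (infTy inf (.one :: Γ) C) fun r => obind (chk Γ e .one) fun e' =>
  obind (nfTy (isNf r.1 [.star] 0) inf Γ (r.1.at₁ .star)) fun S => obind (chk Γ c S) fun c' =>
  bcase (e'.isTag 16) (some (c', S))
    (obind (nfTy (isNf r.1 [e'.ann .one] 0) inf Γ (r.1.at₁ (e'.ann .one))) fun T =>
      some (.oneInd r.1 c' e', T))

noncomputable def infId (A a b : Tm) (inf : Inf) (chk : Chk) (Γ : Ctx) : Option (Tm × Tm) :=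
  obind (infTy inf Γ A) fun r => obind (chk Γ a r.1) fun a' => obind (chk Γ b r.1) fun b' =>
    some (.id r.1 a' b', .univ r.2)

noncomputable def infRefl (a : Tm) (inf : Inf) (_ : Chk) (Γ : Ctx) : Option (Tm × Tm) :=
  obind (inf Γ a) fun r => some (.refl r.1, .id r.2 r.1 r.1)

/-- The normal form of an elimination of `p : a = b`. -/
noncomputable def idIndRed (A a b C c p : Tm) (chk : Chk) (Γ : Ctx) : Option Tm :=
  bcase (p.isTag 23)
    -- The β-rule for paths applies only if the point of `refl` agrees with both endpoints; this is
    -- tested on normal forms.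
    (obind (chk Γ p.fst! A) fun a' => bcase (andb (a'.beq a) (a'.beq b)) (some c) none)
    (some (.idInd C c p))

noncomputable def infIdInd (C c p : Tm) (inf : Inf) (chk : Chk) (Γ : Ctx) : Option (Tm × Tm) :=
  obind (inf Γ p) fun r => bcase (r.2.isTag 22)
    (obind (infTy inf (.id r.2.fst!.wk r.2.snd!.wk (.var 0) :: r.2.fst! :: Γ) C) fun s =>
     obind (nfTy (isNf s.1 [ann (.refl r.2.snd!)
       (.id r.2.fst! r.2.snd! r.2.snd!), r.2.snd!.ann r.2.fst!] 0) inf Γ (s.1.at₂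
         (r.2.snd!.ann r.2.fst!)
       (ann (.refl r.2.snd!) (.id r.2.fst! r.2.snd! r.2.snd!)))) fun S =>
     obind (chk Γ c S) fun c' =>
     obind (nfTy (isNf s.1 [r.1.ann r.2, r.2.thd!.ann r.2.fst!] 0) inf Γ (s.1.at₂
       (r.2.thd!.ann r.2.fst!) (r.1.ann r.2))) fun T =>
     obind (idIndRed r.2.fst! r.2.snd! r.2.thd! s.1 c' r.1 chk Γ) fun t => some (t, T))
    none

noncomputable def infFunext (i : ℕ) (inf : Inf) (_ : Chk) (Γ : Ctx) : Option (Tm × Tm) :=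
  obind (infTy inf Γ (funextType i 0)) fun r => some (.funext i, r.1)

noncomputable def infUa (i : ℕ) (inf : Inf) (_ : Chk) (Γ : Ctx) : Option (Tm × Tm) :=
  obind (infTy inf Γ (uaType i 0)) fun r => some (.ua i, r.1)

/-- Natural numbers and truncations do not occur in the constructions below, so rejecting them is
harmless. -/
noncomputable def infNone (_ : Inf) (_ : Chk) (_ : Ctx) : Option (Tm × Tm) := none

noncomputable def infZero (_ : Inf) (_ : Chk) (_ : Ctx) : Option (Tm × Tm) :=
  some (.zero, .univ 0)

noncomputable def infOne (_ : Inf) (_ : Chk) (_ : Ctx) : Option (Tm × Tm) :=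
  some (.one, .univ 0)

noncomputable def infStar (_ : Inf) (_ : Chk) (_ : Ctx) : Option (Tm × Tm) :=
  some (.star, .one)

noncomputable def infStep (t : Tm) : Inf → Chk → Ctx → Option (Tm × Tm) :=
  Tm.rec (motive := fun _ => Inf → Chk → Ctx → Option (Tm × Tm))
    infVar infUniv (fun a b _ _ => infPi a b) (fun a b _ _ => infLam a b)
    (fun a b _ _ => infApp a b) (fun a b _ _ => infSg a b) (fun a b _ _ => infPair a b)
    (fun a _ => infFst a) (fun a _ => infSnd a) (fun a b _ _ => infSum a b) (fun a _ => infInl a)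
    (fun a _ => infInr a) (fun a b c d _ _ _ _ => infSumInd a b c d) infZero
    (fun a b _ _ => infZeroInd a b) infOne infStar (fun a b c _ _ _ => infOneInd a b c) infNone
    infNone (fun _ _ => infNone) (fun _ _ _ _ _ _ _ _ => infNone) (fun a b c _ _ _ => infId a b c)
    (fun a _ => infRefl a) (fun a b c _ _ _ => infIdInd a b c) (fun _ _ => infNone)
    (fun _ _ => infNone) (fun _ _ _ _ => infNone) (fun _ _ _ _ _ _ _ _ => infNone) infFunext infUa
    t

/-- The projections in `path`, innermost first, applied to `t`. -/
def applyPath : List Bool → Tm → Tm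
  | [], t => t
  | false :: path, t => applyPath path (.fst t)
  | true :: path, t => applyPath path (.snd t)

/-- Find the normal form of type `T` of an iterated projection of a nested pair. -/
noncomputable def chkPath (inf : Inf) (chk : Chk) (Γ : Ctx) (T : Tm) (path : List Bool) :
    Tm → Option Tm :=
  List.rec (motive := fun _ => Tm → Option Tm) (fun t => chk Γ t T)
    (fun b _ ih t => bcase (t.isTag 6)
      (bcase b (obind (inf Γ t.fst!) fun _ => ih t.snd!) (obind (inf Γ t.snd!) fun _ => ih t.fst!))
      none) path

/-- Write a term as an iterated projection and, if it is one of a pair, find its normal form. -/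
noncomputable def chkProj (t : Tm) : Inf → Chk → Ctx → Tm → List Bool → Option Tm :=
  Tm.rec (motive := fun _ => Inf → Chk → Ctx → Tm → List Bool → Option Tm)
    (fun _ _ _ _ _ _ => none) (fun _ _ _ _ _ _ => none) (fun _ _ _ _ _ _ _ _ _ => none)
    (fun _ _ _ _ _ _ _ _ _ => none) (fun _ _ _ _ _ _ _ _ _ => none)
    (fun _ _ _ _ _ _ _ _ _ => none)
    (fun a b _ _ inf chk Γ T path => chkPath inf chk Γ T path (.pair a b))
    (fun _ ih inf chk Γ T path => ih inf chk Γ T (false :: path))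
    (fun _ ih inf chk Γ T path => ih inf chk Γ T (true :: path))
    (fun _ _ _ _ _ _ _ _ _ => none) (fun _ _ _ _ _ _ _ => none) (fun _ _ _ _ _ _ _ => none)
    (fun _ _ _ _ _ _ _ _ _ _ _ _ _ => none) (fun _ _ _ _ _ => none)
    (fun _ _ _ _ _ _ _ _ _ => none) (fun _ _ _ _ _ => none) (fun _ _ _ _ _ => none)
    (fun _ _ _ _ _ _ _ _ _ _ _ => none) (fun _ _ _ _ _ => none) (fun _ _ _ _ _ => none)
    (fun _ _ _ _ _ _ _ => none) (fun _ _ _ _ _ _ _ _ _ _ _ _ _ => none)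
    (fun _ _ _ _ _ _ _ _ _ _ _ => none) (fun _ _ _ _ _ _ _ => none)
    (fun _ _ _ _ _ _ _ _ _ _ _ => none) (fun _ _ _ _ _ _ _ => none)
    (fun _ _ _ _ _ _ _ => none) (fun _ _ _ _ _ _ _ _ _ => none)
    (fun _ _ _ _ _ _ _ _ _ _ _ _ _ => none) (fun _ _ _ _ _ _ => none)
    (fun _ _ _ _ _ _ => none) t

noncomputable def chkInf (t : Tm) (inf : Inf) (_ : Chk) (Γ : Ctx) (T : Tm) : Option Tm :=
  obind (inf Γ t) fun r => bcase (subTy r.2 T) (some r.1) none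

noncomputable def chkProjInf (t : Tm) (inf : Inf) (chk : Chk) (Γ : Ctx) (T : Tm) : Option Tm :=
  ocase (chkProj t inf chk Γ T []) (chkInf t inf chk Γ T) fun r => some r

noncomputable def chkLam (A b : Tm) (inf : Inf) (chk : Chk) (Γ : Ctx) (T : Tm) : Option Tm :=
  bcase (T.isTag 2)
    (obind (infTy inf Γ A) fun r => bcase (r.1.beq T.fst!)
      (obind (chk (T.fst! :: Γ) b T.snd!) fun b' => etaLam chk Γ T.fst! b' T.snd!) none)
    none

/-- Find the normal form of `(λ (x : A), b) a` of type `T`, where `T` may be a type for `b`,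
too. -/
noncomputable def chkBeta (A b a : Tm) (inf : Inf) (chk : Chk) (Γ : Ctx) (T : Tm) : Option Tm :=
  obind (infTy inf Γ A) fun r => obind (chk Γ a r.1) fun a' =>
  obind (chk (r.1 :: Γ) b T.wk) fun b' => nfTm (isNf b' [a'.ann r.1] 0) chk Γ (b'.at₁
    (a'.ann r.1)) T

/-- A redex that is not an annotation is first tried with the expected type pushed into the body,
since that body may have no inferable type; inference is the fallback. -/
noncomputable def chkApp (f a : Tm) (inf : Inf) (chk : Chk) (Γ : Ctx) (T : Tm) : Option Tm :=
  bcase (andb (f.isTag 3) (bcase (f.snd!.beq (.var 0)) false true))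
    (ocase (chkBeta f.fst! f.snd! a inf chk Γ T) (chkInf (.app f a) inf chk Γ T) fun r => some r)
    (chkInf (.app f a) inf chk Γ T)

noncomputable def chkPair (a b : Tm) (inf : Inf) (chk : Chk) (Γ : Ctx) (T : Tm) : Option Tm :=
  bcase (T.isTag 5)
    (obind (chk Γ a T.fst!) fun a' => obind (nfTy (isNf T.snd! [a'.ann T.fst!] 0) inf Γ
      (T.snd!.at₁ (a'.ann T.fst!))) fun B =>
     obind (chk Γ b B) fun b' => etaPair chk Γ a' b' T)
    none

noncomputable def chkInl (a : Tm) (_ : Inf) (chk : Chk) (Γ : Ctx) (T : Tm) : Option Tm :=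
  bcase (T.isTag 9) (obind (chk Γ a T.fst!) fun a' => some (.inl a')) none

noncomputable def chkInr (b : Tm) (_ : Inf) (chk : Chk) (Γ : Ctx) (T : Tm) : Option Tm :=
  bcase (T.isTag 9) (obind (chk Γ b T.snd!) fun b' => some (.inr b')) none

noncomputable def chkRefl (a : Tm) (_ : Inf) (chk : Chk) (Γ : Ctx) (T : Tm) : Option Tm :=
  bcase (T.isTag 22)
    (obind (chk Γ a T.fst!) fun a' =>
      bcase (andb (a'.beq T.snd!) (a'.beq T.thd!)) (some (.refl a')) none)
    none

noncomputable def chkStep (t : Tm) : Inf → Chk → Ctx → Tm → Option Tm :=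
  Tm.rec (motive := fun _ => Inf → Chk → Ctx → Tm → Option Tm)
    (fun n => chkInf (.var n)) (fun n => chkInf (.univ n)) (fun a b _ _ => chkInf (.pi a b))
    (fun a b _ _ => chkLam a b) (fun a b _ _ => chkApp a b) (fun a b _ _ => chkInf (.sg a b))
    (fun a b _ _ => chkPair a b) (fun a _ => chkProjInf (.fst a)) (fun a _ => chkProjInf (.snd a))
    (fun a b _ _ => chkInf (.sum a b)) (fun a _ => chkInl a) (fun a _ => chkInr a)
    (fun a b c d _ _ _ _ => chkInf (.sumInd a b c d)) (chkInf .zero)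
    (fun a b _ _ => chkInf (.zeroInd a b)) (chkInf .one) (chkInf .star)
    (fun a b c _ _ _ => chkInf (.oneInd a b c)) (chkInf .nat) (chkInf .natZero)
    (fun a _ => chkInf (.natSucc a)) (fun a b c d _ _ _ _ => chkInf (.natInd a b c d))
    (fun a b c _ _ _ => chkInf (.id a b c)) (fun a _ => chkRefl a)
    (fun a b c _ _ _ => chkInf (.idInd a b c)) (fun a _ => chkInf (.trunc a))
    (fun a _ => chkInf (.tr a)) (fun a b _ _ => chkInf (.squash a b))
    (fun a b c d _ _ _ _ => chkInf (.truncRec a b c d)) (fun n => chkInf (.funext n))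
    (fun n => chkInf (.ua n)) t

/-- The type checker with recursion depth `n`. -/
noncomputable def run (n : ℕ) : Inf × Chk :=
  Nat.rec (motive := fun _ => Inf × Chk) (fun _ _ => none, fun _ _ _ => none)
    (fun _ ih => (fun Γ t => infStep t ih.1 ih.2 Γ, fun Γ t => chkStep t ih.1 ih.2 Γ)) n

/-- `t` is recognised as a closed term of type `A`. -/
noncomputable def hasType (t A : Tm) : Bool :=
  -- The number 1000 bounds the recursion depth only; every bound gives a sound checker.
  ocase (infTy (run 1000).1 [] A) false fun r => ocase ((run 1000).2 [] t r.1) false fun _ => true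

/-! ## Correctness of the operations on terms -/

theorem obind_eq_some {α β : Type} {x : Option α} {f : α → Option β} {r : β} :
    obind x f = some r ↔ ∃ a, x = some a ∧ f a = some r := by
  cases x <;> simp [obind]

theorem bcase_eq {α : Type} {c : Bool} {x y z : α} :
    bcase c x y = z ↔ c = true ∧ x = z ∨ c = false ∧ y = z := by
  cases c <;> simp [bcase]

theorem andb_eq_true {c d : Bool} : andb c d = true ↔ c = true ∧ d = true := by
  cases c <;> simp [andb]

theorem ocase_some {α : Type} {x y : Option α} {r : α} :
    ocase x y (fun a => some a) = some r → x = some r ∨ y = some r := by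
  cases x <;> simp [ocase]; exact Or.inl

namespace Tm

theorem isTag_iff {t : Tm} {k : ℕ} : t.isTag k = true ↔ t.tag = k := by
  rw [isTag, Nat.beq_eq]

theorem of_isTag_univ {t : Tm} (h : t.isTag 1 = true) : t = univ t.num! := by
  rw [isTag_iff] at h; cases t <;> first | rfl | cases h
theorem of_isTag_pi {t : Tm} (h : t.isTag 2 = true) : t = pi t.fst! t.snd! := by
  rw [isTag_iff] at h; cases t <;> first | rfl | cases h
theorem of_isTag_lam {t : Tm} (h : t.isTag 3 = true) : t = lam t.fst! t.snd! := by
  rw [isTag_iff] at h; cases t <;> first | rfl | cases h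
theorem of_isTag_app {t : Tm} (h : t.isTag 4 = true) : t = app t.fst! t.snd! := by
  rw [isTag_iff] at h; cases t <;> first | rfl | cases h
theorem of_isTag_sg {t : Tm} (h : t.isTag 5 = true) : t = sg t.fst! t.snd! := by
  rw [isTag_iff] at h; cases t <;> first | rfl | cases h
theorem of_isTag_pair {t : Tm} (h : t.isTag 6 = true) : t = pair t.fst! t.snd! := by
  rw [isTag_iff] at h; cases t <;> first | rfl | cases h
theorem of_isTag_fst {t : Tm} (h : t.isTag 7 = true) : t = fst t.fst! := by
  rw [isTag_iff] at h; cases t <;> first | rfl | cases h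
theorem of_isTag_snd {t : Tm} (h : t.isTag 8 = true) : t = snd t.fst! := by
  rw [isTag_iff] at h; cases t <;> first | rfl | cases h
theorem of_isTag_sum {t : Tm} (h : t.isTag 9 = true) : t = sum t.fst! t.snd! := by
  rw [isTag_iff] at h; cases t <;> first | rfl | cases h
theorem of_isTag_inl {t : Tm} (h : t.isTag 10 = true) : t = inl t.fst! := by
  rw [isTag_iff] at h; cases t <;> first | rfl | cases h
theorem of_isTag_inr {t : Tm} (h : t.isTag 11 = true) : t = inr t.fst! := by
  rw [isTag_iff] at h; cases t <;> first | rfl | cases h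
theorem of_isTag_star {t : Tm} (h : t.isTag 16 = true) : t = star := by
  rw [isTag_iff] at h; cases t <;> first | rfl | cases h
theorem of_isTag_id {t : Tm} (h : t.isTag 22 = true) : t = id t.fst! t.snd! t.thd! := by
  rw [isTag_iff] at h; cases t <;> first | rfl | cases h
theorem of_isTag_refl {t : Tm} (h : t.isTag 23 = true) : t = refl t.fst! := by
  rw [isTag_iff] at h; cases t <;> first | rfl | cases h

theorem of_isTag_zero {t : Tm} (h : t.isTag 13 = true) : t = zero := by
  rw [isTag_iff] at h; cases t <;> first | rfl | cases h
theorem of_isTag_one {t : Tm} (h : t.isTag 15 = true) : t = one := by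
  rw [isTag_iff] at h; cases t <;> first | rfl | cases h
theorem of_isTag_var {t : Tm} (h : t.isTag 0 = true) : t = var t.num! := by
  rw [isTag_iff] at h; cases t <;> first | rfl | cases h
theorem of_isTag_funext {t : Tm} (h : t.isTag 29 = true) : t = funext t.num! := by
  rw [isTag_iff] at h; cases t <;> first | rfl | cases h
theorem of_isTag_ua {t : Tm} (h : t.isTag 30 = true) : t = ua t.num! := by
  rw [isTag_iff] at h; cases t <;> first | rfl | cases h
theorem of_isTag_zeroInd {t : Tm} (h : t.isTag 14 = true) : t = zeroInd t.fst! t.snd! := by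
  rw [isTag_iff] at h; cases t <;> first | rfl | cases h
theorem of_isTag_oneInd {t : Tm} (h : t.isTag 17 = true) : t = oneInd t.fst! t.snd! t.thd! := by
  rw [isTag_iff] at h; cases t <;> first | rfl | cases h
theorem of_isTag_idInd {t : Tm} (h : t.isTag 24 = true) : t = idInd t.fst! t.snd! t.thd! := by
  rw [isTag_iff] at h; cases t <;> first | rfl | cases h
theorem of_isTag_sumInd {t : Tm} (h : t.isTag 12 = true) :
    t = sumInd t.fst! t.snd! t.thd! t.fth! := by
  rw [isTag_iff] at h; cases t <;> first | rfl | cases h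

/-- On the constructors outside the supported fragment `beq` is constantly false, so those cases are
vacuous. -/
theorem eq_of_beq {t u : Tm} (h : t.beq u = true) : t = u := by
  induction t generalizing u with
  | var n =>
    obtain ⟨h, h₁⟩ := andb_eq_true.1 h
    exact (congrArg var (Nat.eq_of_beq_eq_true h₁)).trans (of_isTag_var h).symm
  | univ n =>
    obtain ⟨h, h₁⟩ := andb_eq_true.1 h
    exact (congrArg univ (Nat.eq_of_beq_eq_true h₁)).trans (of_isTag_univ h).symm
  | pi a b ih0 ih1 =>
    obtain ⟨h, h0⟩ := andb_eq_true.1 h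
    obtain ⟨h0, h1⟩ := andb_eq_true.1 h0
    exact (congrArg₂ pi (ih0 h0) (ih1 h1)).trans (of_isTag_pi h).symm
  | lam a b ih0 ih1 =>
    obtain ⟨h, h0⟩ := andb_eq_true.1 h
    obtain ⟨h0, h1⟩ := andb_eq_true.1 h0
    exact (congrArg₂ lam (ih0 h0) (ih1 h1)).trans (of_isTag_lam h).symm
  | app a b ih0 ih1 =>
    obtain ⟨h, h0⟩ := andb_eq_true.1 h
    obtain ⟨h0, h1⟩ := andb_eq_true.1 h0
    exact (congrArg₂ app (ih0 h0) (ih1 h1)).trans (of_isTag_app h).symm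
  | sg a b ih0 ih1 =>
    obtain ⟨h, h0⟩ := andb_eq_true.1 h
    obtain ⟨h0, h1⟩ := andb_eq_true.1 h0
    exact (congrArg₂ sg (ih0 h0) (ih1 h1)).trans (of_isTag_sg h).symm
  | pair a b ih0 ih1 =>
    obtain ⟨h, h0⟩ := andb_eq_true.1 h
    obtain ⟨h0, h1⟩ := andb_eq_true.1 h0
    exact (congrArg₂ pair (ih0 h0) (ih1 h1)).trans (of_isTag_pair h).symm
  | fst a ih0 =>
    obtain ⟨h, h0⟩ := andb_eq_true.1 h
    exact (congrArg fst (ih0 h0)).trans (of_isTag_fst h).symm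
  | snd a ih0 =>
    obtain ⟨h, h0⟩ := andb_eq_true.1 h
    exact (congrArg snd (ih0 h0)).trans (of_isTag_snd h).symm
  | sum a b ih0 ih1 =>
    obtain ⟨h, h0⟩ := andb_eq_true.1 h
    obtain ⟨h0, h1⟩ := andb_eq_true.1 h0
    exact (congrArg₂ sum (ih0 h0) (ih1 h1)).trans (of_isTag_sum h).symm
  | inl a ih0 =>
    obtain ⟨h, h0⟩ := andb_eq_true.1 h
    exact (congrArg inl (ih0 h0)).trans (of_isTag_inl h).symm
  | inr a ih0 =>
    obtain ⟨h, h0⟩ := andb_eq_true.1 h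
    exact (congrArg inr (ih0 h0)).trans (of_isTag_inr h).symm
  | sumInd a b c d ih0 ih1 ih2 ih3 =>
    obtain ⟨h, h0⟩ := andb_eq_true.1 h
    obtain ⟨h0, h1⟩ := andb_eq_true.1 h0
    obtain ⟨h1, h2⟩ := andb_eq_true.1 h1
    obtain ⟨h2, h3⟩ := andb_eq_true.1 h2
    rw [ih0 h0, ih1 h1, ih2 h2, ih3 h3]
    exact (of_isTag_sumInd h).symm
  | zero => exact (of_isTag_zero h).symm
  | zeroInd a b ih0 ih1 =>
    obtain ⟨h, h0⟩ := andb_eq_true.1 h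
    obtain ⟨h0, h1⟩ := andb_eq_true.1 h0
    exact (congrArg₂ zeroInd (ih0 h0) (ih1 h1)).trans (of_isTag_zeroInd h).symm
  | one => exact (of_isTag_one h).symm
  | star => exact (of_isTag_star h).symm
  | oneInd a b c ih0 ih1 ih2 =>
    obtain ⟨h, h0⟩ := andb_eq_true.1 h
    obtain ⟨h0, h1⟩ := andb_eq_true.1 h0
    obtain ⟨h1, h2⟩ := andb_eq_true.1 h1
    rw [ih0 h0, ih1 h1, ih2 h2]
    exact (of_isTag_oneInd h).symm
  | id a b c ih0 ih1 ih2 =>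
    obtain ⟨h, h0⟩ := andb_eq_true.1 h
    obtain ⟨h0, h1⟩ := andb_eq_true.1 h0
    obtain ⟨h1, h2⟩ := andb_eq_true.1 h1
    rw [ih0 h0, ih1 h1, ih2 h2]
    exact (of_isTag_id h).symm
  | refl a ih0 =>
    obtain ⟨h, h0⟩ := andb_eq_true.1 h
    exact (congrArg refl (ih0 h0)).trans (of_isTag_refl h).symm
  | idInd a b c ih0 ih1 ih2 =>
    obtain ⟨h, h0⟩ := andb_eq_true.1 h
    obtain ⟨h0, h1⟩ := andb_eq_true.1 h0
    obtain ⟨h1, h2⟩ := andb_eq_true.1 h1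
    rw [ih0 h0, ih1 h1, ih2 h2]
    exact (of_isTag_idInd h).symm
  | funext n =>
    obtain ⟨h, h₁⟩ := andb_eq_true.1 h
    exact (congrArg funext (Nat.eq_of_beq_eq_true h₁)).trans (of_isTag_funext h).symm
  | ua n =>
    obtain ⟨h, h₁⟩ := andb_eq_true.1 h
    exact (congrArg ua (Nat.eq_of_beq_eq_true h₁)).trans (of_isTag_ua h).symm
  | _ => exact absurd h Bool.false_ne_true

/-- The substitution `σ` under `c` binders. -/
def ups : ℕ → (ℕ → Tm) → ℕ → Tm
  | 0, σ => σ
  | c + 1, σ => up (ups c σ)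

theorem ups_apply (c : ℕ) (σ : ℕ → Tm) (n : ℕ) :
    ups c σ n = if c ≤ n then (σ (n - c)).shift c else var n := by
  induction c generalizing n with
  | zero => simp [ups, shift, rename_eq_subst, subst_var]
  | succ c ih =>
    cases n with
    | zero => simp [ups, up, scons]
    | succ n =>
      simp only [ups, up, scons, ih]
      by_cases h : c ≤ n <;> simp [h, shift, rename_rename, rename, Nat.add_assoc]

theorem lift_eq (t : Tm) (k c : ℕ) : t.lift k c = t.subst (ups c fun n => var (n + k)) := by
  induction t generalizing c with
  | var n =>
    change bcase (Nat.ble c n) (var (n + k)) (var n) = ups c _ n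
    rw [ups_apply]
    by_cases h : c ≤ n
    · have := Nat.ble_eq_true_of_le h
      simp only [this, bcase, h, if_true, shift, rename]
      congr 1; omega
    · have : Nat.ble c n = false := by rwa [← Bool.not_eq_true, Nat.ble_eq]
      simp [this, bcase, h]
  | _ => simp_all [lift, subst, ups]

/-- The substitution by the terms in `env`, followed by the weakening by `k` variables. -/
def envSub : List Tm → ℕ → ℕ → Tm
  | [], k => fun n => var (n + k)
  | u :: env, k => scons u (envSub env k)

theorem pick_eq (env : List Tm) (n k : ℕ) : pick env n k = envSub env k n := by
  induction env generalizing n with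
  | nil => rfl
  | cons u env ih =>
    cases n with
    | zero => rfl
    | succ n => exact ih n

theorem sub_eq (t : Tm) (env : List Tm) (k c : ℕ) :
    t.sub env k c = t.subst (ups c (envSub env k)) := by
  induction t generalizing c with
  | var n =>
    change bcase (Nat.ble c n)
      (bcase (Nat.beq c 0) (pick env n k) ((pick env (n - c) k).lift c 0)) (var n) = ups c _ n
    rw [ups_apply]
    by_cases h : c ≤ n
    · have := Nat.ble_eq_true_of_le h
      cases c with
      | zero => simp [this, bcase, pick_eq, shift, rename_eq_subst, subst_var]
      | succ c =>
        simp only [this, bcase, h, if_true, pick_eq, lift_eq, shift, rename_eq_subst]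
        rfl
    · have : Nat.ble c n = false := by rwa [← Bool.not_eq_true, Nat.ble_eq]
      simp [this, bcase, h]
  | _ => simp_all [sub, subst, ups]

theorem wk_eq (t : Tm) : t.wk = t.shift 1 := by
  rw [wk, lift_eq, shift, rename_eq_subst]; rfl

theorem at₁_eq (B a : Tm) : B.at₁ a = B.inst a := by
  rw [at₁, sub_eq]; rfl

theorem at₂_eq (B a b : Tm) : B.at₂ a b = B.inst₂ a b := by
  rw [at₂, sub_eq]; rfl

theorem atUnder_eq (B a : Tm) : B.atUnder a = B.instUnder 1 a := by
  rw [atUnder, sub_eq]; rfl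

/-- That undoing the weakening and weakening again restores the function already shows it to be a
weakening; the test `noVar` is not needed for correctness. -/
theorem eq_of_isEtaBody {b : Tm} (h : b.isEtaBody = true) :
    b = app (b.fst!.unwk.shift 1) (var 0) := by
  simp only [isEtaBody, andb_eq_true] at h
  obtain ⟨h, h₁, -, h₂⟩ := h
  rw [← wk_eq, eq_of_beq h₂, ← eq_of_beq h₁]
  exact of_isTag_app h

theorem eq_of_isEtaPair {a b : Tm} (h : isEtaPair a b = true) :
    a = fst a.fst! ∧ b = snd a.fst! := by
  simp only [isEtaPair, andb_eq_true] at h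
  obtain ⟨h₁, h₂, h⟩ := h
  exact ⟨of_isTag_fst h₁, eq_of_beq h ▸ of_isTag_snd h₂⟩

end Tm

theorem look_eq (Γ : Ctx) (n : ℕ) : look Γ n = Γ[n]? := by
  induction Γ generalizing n with
  | nil => rfl
  | cons A Γ ih =>
    cases n with
    | zero => rfl
    | succ n => exact ih n

/-! ## Typed reductions -/

/-- `t` and `t'` are equal terms of type `T`. -/
structure Red (Γ : Ctx) (t t' T : Tm) : Prop where
  tm : Der (.tm Γ t T)
  tm' : Der (.tm Γ t' T)
  eq : Der (.eq Γ t t' T)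

theorem Der.red {Γ t T} (h : Der (.tm Γ t T)) : Red Γ t t T := ⟨h, h, h.rfl⟩

theorem EqTy.pi {Γ A A' B B'} (hA : EqTy Γ A A') (hB : EqTy (A :: Γ) B B') :
    EqTy Γ (.pi A B) (.pi A' B') := by
  -- The rule `piCongr` compares the codomains over `A`, whereas the right-hand type needs `B'` over
  -- `A'`. The converted judgement comes with its own unspecified level, hence the maximum of three
  -- levels.
  have hB' := EqTy.ctxConv hA hB
  obtain ⟨i, h₁, h₂, h₃⟩ := hA
  obtain ⟨j, k₁, -, k₃⟩ := hB
  obtain ⟨j', -, k₂, -⟩ := hB'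
  have l₁ : i ≤ max i (max j j') := le_max_left _ _
  have l₂ : j ≤ max i (max j j') := (le_max_left _ _).trans (le_max_right _ _)
  have l₃ : j' ≤ max i (max j j') := (le_max_right _ _).trans (le_max_right _ _)
  exact ⟨_, (h₁.cumul_le l₁).pi (k₁.cumul_le l₂), (h₂.cumul_le l₁).pi (k₂.cumul_le l₃),
    (h₃.cumulEq_le l₁).piCongr (k₃.cumulEq_le l₂)⟩

theorem IsTy.of_pi {Γ A B} (h : IsTy Γ (.pi A B)) : IsTy Γ A ∧ IsTy (A :: Γ) B := by
  obtain ⟨i, h⟩ := h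
  exact gen_of_der h _ _ _ rfl

theorem IsTy.of_sg {Γ A B} (h : IsTy Γ (.sg A B)) : IsTy Γ A ∧ IsTy (A :: Γ) B := by
  obtain ⟨i, h⟩ := h
  exact gen_of_der h _ _ _ rfl

theorem IsTy.of_sum {Γ A B} (h : IsTy Γ (.sum A B)) : IsTy Γ A ∧ IsTy Γ B := by
  obtain ⟨i, h⟩ := h
  exact gen_of_der h _ _ _ rfl

theorem IsTy.of_id {Γ A a b} (h : IsTy Γ (.id A a b)) :
    IsTy Γ A ∧ Der (.tm Γ a A) ∧ Der (.tm Γ b A) := by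
  obtain ⟨i, h⟩ := h
  exact gen_of_der h _ _ _ rfl

theorem IsTy.pi {Γ A B} (hA : IsTy Γ A) (hB : IsTy (A :: Γ) B) : IsTy Γ (.pi A B) :=
  (hA.eqRfl.pi hB.eqRfl).left

theorem IsTy.sg {Γ A B} (hA : IsTy Γ A) (hB : IsTy (A :: Γ) B) : IsTy Γ (.sg A B) := by
  obtain ⟨i, hA⟩ := hA
  obtain ⟨j, hB⟩ := hB
  exact ⟨max i j, (hA.cumul_le (le_max_left _ _)).sg (hB.cumul_le (le_max_right _ _))⟩

theorem IsTy.sum {Γ A B} (hA : IsTy Γ A) (hB : IsTy Γ B) : IsTy Γ (.sum A B) := by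
  obtain ⟨i, hA⟩ := hA
  obtain ⟨j, hB⟩ := hB
  exact ⟨max i j, (hA.cumul_le (le_max_left _ _)).sum (hB.cumul_le (le_max_right _ _))⟩

theorem IsTy.id {Γ A a b} (hA : IsTy Γ A) (ha : Der (.tm Γ a A)) (hb : Der (.tm Γ b A)) :
    IsTy Γ (.id A a b) := by
  obtain ⟨i, hA⟩ := hA
  exact ⟨i, hA.id ha hb⟩

theorem IsTy.univ {Γ i} (hΓ : Der (.ctx Γ)) : IsTy Γ (.univ i) := ⟨_, .univ hΓ⟩

theorem IsTy.zero {Γ} (hΓ : Der (.ctx Γ)) : IsTy Γ .zero := ⟨0, .zero hΓ⟩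

theorem IsTy.one {Γ} (hΓ : Der (.ctx Γ)) : IsTy Γ .one := ⟨0, .one hΓ⟩

theorem EqTy.id {Γ A A' a a' b b'} (hA : EqTy Γ A A') (ha : Red Γ a a' A) (hb : Red Γ b b' A) :
    EqTy Γ (.id A a b) (.id A' a' b') := by
  have hA' := hA
  obtain ⟨i, h₁, h₂, h₃⟩ := hA
  exact ⟨i, h₁.id ha.tm hb.tm, h₂.id (ha.tm'.conv' hA') (hb.tm'.conv' hA'),
    h₃.idCongr ha.eq hb.eq⟩

theorem EqTy.subst {Γ Δ σ A B} (hΓ : Der (.ctx Γ)) (hσ : Sb Γ σ Δ) (h : EqTy Δ A B) :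
    EqTy Γ (A.subst σ) (B.subst σ) := by
  obtain ⟨i, h₁, h₂, h₃⟩ := h
  exact ⟨i, hσ.tm hΓ h₁, hσ.tm hΓ h₂, hσ.eq hΓ h₃⟩

namespace Red

theorem conv {Γ t t' T T'} (h : Red Γ t t' T) (e : EqTy Γ T T') : Red Γ t t' T' :=
  ⟨h.tm.conv' e, h.tm'.conv' e, h.eq.convEq' e⟩

theorem trans {Γ t u v T} (h : Red Γ t u T) (h' : Red Γ u v T) : Red Γ t v T :=
  ⟨h.tm, h'.tm', h.eq.trans h'.eq⟩

theorem symm {Γ t u T} (h : Red Γ t u T) : Red Γ u t T := ⟨h.tm', h.tm, h.eq.symm⟩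

theorem eqTy {Γ A A' i} (h : Red Γ A A' (.univ i)) : EqTy Γ A A' := ⟨i, h.tm, h.tm', h.eq⟩

theorem cumul_le {Γ A A' i j} (h : Red Γ A A' (.univ i)) (hij : i ≤ j) : Red Γ A A' (.univ j) :=
  ⟨h.tm.cumul_le hij, h.tm'.cumul_le hij, h.eq.cumulEq_le hij⟩

theorem ctxConv {Γ A A' t t' T} (h : Red (A :: Γ) t t' T) (e : EqTy Γ A A') :
    Red (A' :: Γ) t t' T := ⟨h.tm.ctxConv e, h.tm'.ctxConv e, h.eq.ctxConvEq e⟩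

/-- The checker normalises the domain before entering the body, so the body is typed over `A'`;
conversion of the context supplies what the rules want over `A`. -/
theorem lam {Γ A A' b b' B} (hA : EqTy Γ A A') (hB : IsTy (A' :: Γ) B)
    (hb : Red (A' :: Γ) b b' B) : Red Γ (.lam A b) (.lam A' b') (.pi A' B) := by
  have hb' := hb.ctxConv hA.symm
  have e : EqTy Γ (.pi A B) (.pi A' B) := hA.pi (EqTy.ctxConv hA.symm hB.eqRfl)
  obtain ⟨i, h₁, h₂, h₃⟩ := hA
  exact ⟨(h₁.lam hb'.tm).conv' e, h₂.lam hb.tm', (h₃.lamCongr hb'.eq).convEq' e⟩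

theorem app {Γ A B f f' a a'} (hΓ : Der (.ctx Γ)) (hT : IsTy Γ (.pi A B))
    (hf : Red Γ f f' (.pi A B)) (ha : Red Γ a a' A) :
    Red Γ (.app f a) (.app f' a') (B.inst a) :=
  ⟨hf.tm.app ha.tm,
    (hf.tm'.app ha.tm').conv' (IsTy.inst_congr hΓ hT.of_pi.1 hT.of_pi.2 ha.tm' ha.tm ha.eq.symm),
    hf.eq.appCongr ha.eq⟩

theorem beta {Γ A B b a} (hΓ : Der (.ctx Γ)) (hA : IsTy Γ A) (hb : Der (.tm (A :: Γ) b B))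
    (ha : Der (.tm Γ a A)) : Red Γ (.app (.lam A b) a) (b.inst a) (B.inst a) := by
  obtain ⟨i, hA⟩ := hA
  exact ⟨(hA.lam hb).app ha, Der.inst hΓ hb ha, .piBeta hb ha⟩

theorem inst {Γ A B b b' a a'} (hΓ : Der (.ctx Γ)) (hA : IsTy Γ A) (hB : IsTy (A :: Γ) B)
    (hb : Red (A :: Γ) b b' B) (ha : Red Γ a a' A) :
    Red Γ (b.inst a) (b'.inst a') (B.inst a) := by
  have e := IsTy.inst_congr hΓ hA hB ha.tm' ha.tm ha.eq.symm
  exact ⟨Der.inst hΓ hb.tm ha.tm, (Der.inst hΓ hb.tm' ha.tm').conv' e,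
    (Der.instEq hΓ hb.eq ha.tm).trans (Der.inst_congr hA hb.tm' ha.tm ha.tm' e ha.eq)⟩

theorem app_lam {Γ A A' B b b' a a'} (hΓ : Der (.ctx Γ)) (hA : EqTy Γ A A')
    (hB : IsTy (A' :: Γ) B) (hb : Red (A' :: Γ) b b' B) (ha : Red Γ a a' A') :
    Red Γ (.app (.lam A b) a) (b'.inst a') (B.inst a') :=
  ((app hΓ (hA.right.pi hB) (lam hA hB hb) ha).trans
    ((beta hΓ hA.right hb.tm' ha.tm').conv
      (IsTy.inst_congr hΓ hA.right hB ha.tm' ha.tm ha.eq.symm))).conv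
    (IsTy.inst_congr hΓ hA.right hB ha.tm ha.tm' ha.eq)

/-- An annotation is an application of the identity function, so it disappears by β. -/
theorem ann {Γ a a' A} (hΓ : Der (.ctx Γ)) (hA : IsTy Γ A) (ha : Red Γ a a' A) :
    Red Γ a (a'.ann A) A := by
  refine ha.trans ?_
  rw [Tm.ann]
  cases a'.needsAnn
  · exact ha.tm'.red
  · have hv : Der (.tm (A :: Γ) (.var 0) (A.shift 1)) := .var hA.ctx_cons rfl
    have := beta hΓ hA hv ha.tm'
    rw [shift_one_inst] at this
    exact this.symm

theorem fst {Γ p p' A B} (h : Red Γ p p' (.sg A B)) : Red Γ (.fst p) (.fst p') A :=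
  ⟨h.tm.fst, h.tm'.fst, h.eq.fstCongr⟩

theorem snd {Γ p p' A B} (hΓ : Der (.ctx Γ)) (hT : IsTy Γ (.sg A B)) (h : Red Γ p p' (.sg A B)) :
    Red Γ (.snd p) (.snd p') (B.inst (.fst p)) :=
  ⟨h.tm.snd, h.tm'.snd.conv'
    (IsTy.inst_congr hΓ hT.of_sg.1 hT.of_sg.2 h.fst.tm' h.fst.tm h.fst.eq.symm), h.eq.sndCongr⟩

theorem pair {Γ A B a a' b b'} (hΓ : Der (.ctx Γ)) (hT : IsTy Γ (.sg A B)) (ha : Red Γ a a' A)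
    (hb : Red Γ b b' (B.inst a)) : Red Γ (.pair a b) (.pair a' b') (.sg A B) := by
  have e := IsTy.inst_congr hΓ hT.of_sg.1 hT.of_sg.2 ha.tm ha.tm' ha.eq
  obtain ⟨i, hB⟩ := hT.of_sg.2
  exact ⟨hB.pair ha.tm hb.tm, hB.pair ha.tm' (hb.tm'.conv' e), hB.pairCongr ha.eq hb.eq⟩

theorem fst_pair {Γ A B a b} (hB : IsTy (A :: Γ) B) (ha : Der (.tm Γ a A))
    (hb : Der (.tm Γ b (B.inst a))) : Red Γ (.fst (.pair a b)) a A := by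
  obtain ⟨i, hB⟩ := hB
  exact ⟨(hB.pair ha hb).fst, ha, hB.fstBeta ha hb⟩

theorem snd_pair {Γ A B a b} (hΓ : Der (.ctx Γ)) (hT : IsTy Γ (.sg A B)) (ha : Der (.tm Γ a A))
    (hb : Der (.tm Γ b (B.inst a))) : Red Γ (.snd (.pair a b)) b (B.inst a) := by
  have h := fst_pair hT.of_sg.2 ha hb
  have e := IsTy.inst_congr hΓ hT.of_sg.1 hT.of_sg.2 h.tm h.tm' h.eq
  obtain ⟨i, hB⟩ := hT.of_sg.2
  exact ⟨(hB.pair ha hb).snd.conv' e, hb, hB.sndBeta ha hb⟩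

theorem inl {Γ A B a a'} (hB : IsTy Γ B) (h : Red Γ a a' A) :
    Red Γ (.inl a) (.inl a') (.sum A B) := by
  obtain ⟨i, hB⟩ := hB
  exact ⟨hB.inl h.tm, hB.inl h.tm', hB.inlCongr h.eq⟩

theorem inr {Γ A B b b'} (hA : IsTy Γ A) (h : Red Γ b b' B) :
    Red Γ (.inr b) (.inr b') (.sum A B) := by
  obtain ⟨i, hA⟩ := hA
  exact ⟨hA.inr h.tm, hA.inr h.tm', hA.inrCongr h.eq⟩

theorem refl {Γ A a a'} (hA : IsTy Γ A) (h : Red Γ a a' A) :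
    Red Γ (.refl a) (.refl a') (.id A a a) :=
  ⟨h.tm.refl, h.tm'.refl.conv' (hA.eqRfl.id h.symm h.symm), h.eq.reflCongr⟩

theorem eqTy_inst {Γ A B B' a a'} (hΓ : Der (.ctx Γ)) (hA : IsTy Γ A)
    (hB : EqTy (A :: Γ) B B') (ha : Red Γ a a' A) : EqTy Γ (B.inst a) (B'.inst a') :=
  (EqTy.inst hΓ hB ha.tm).trans (IsTy.inst_congr hΓ hA hB.right ha.tm ha.tm' ha.eq)

theorem eqTy_instUnder {Γ X E C C' u u'} (hX : Der (.ctx (X :: Γ))) (hE : IsTy Γ E)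
    (hC : EqTy (E :: Γ) C C') (hu : Red (X :: Γ) u u' (E.shift 1)) :
    EqTy (X :: Γ) (C.instUnder 1 u) (C'.instUnder 1 u') := by
  rw [shift, rename_eq_subst] at hu
  exact (hC.subst hX (Sb.scons (Sb.wk hX) hu.tm)).trans
    (IsTy.subst_congr hX (Sb.wk hX) hE hC.right hu.tm hu.tm' hu.eq)

end Red

/-! ## Soundness of the type checker -/

/-- Well-formedness of the inferred type is part of the claim, since callers use this type as the
target of further checks or decompose it. -/
def InfSound (inf : Inf) : Prop :=
  ∀ Γ t r, Der (.ctx Γ) → inf Γ t = some r → Red Γ t r.1 r.2 ∧ IsTy Γ r.2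

def ChkSound (chk : Chk) : Prop :=
  ∀ Γ t T r, Der (.ctx Γ) → IsTy Γ T → chk Γ t T = some r → Red Γ t r T

/-- The type denoted by a closure. -/
def Clo.den (F : Clo) : Tm := F.ty.subst (envSub F.env F.k)

theorem Clo.den_nil (T : Tm) : Clo.den ⟨T, [], 0⟩ = T := subst_var T

section

variable {inf : Inf} {chk : Chk} (hi : InfSound inf) (hc : ChkSound chk)

include hi in
theorem infTy_sound {Γ A r} (hΓ : Der (.ctx Γ)) (h : infTy inf Γ A = some r) :
    Red Γ A r.1 (.univ r.2) := by
  simp only [infTy, obind_eq_some, bcase_eq] at h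
  obtain ⟨s, hs, ⟨h, h'⟩ | ⟨_, h'⟩⟩ := h
  · cases h'
    have := (hi _ _ _ hΓ hs).1
    rw [of_isTag_univ h] at this
    exact this
  · cases h'

include hi in
theorem nfTy_sound {nf Γ A A'} (hΓ : Der (.ctx Γ)) (hA : IsTy Γ A) (h : nfTy nf inf Γ A = some A') :
    EqTy Γ A A' := by
  simp only [nfTy, obind_eq_some, bcase_eq] at h
  obtain ⟨_, h⟩ | ⟨_, r, hr, h⟩ := h
  · cases h; exact hA.eqRfl
  · cases h; exact (infTy_sound hi hΓ hr).eqTy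

include hc in
theorem nfTm_sound {nf Γ t t' T} (hΓ : Der (.ctx Γ)) (hT : IsTy Γ T) (ht : Der (.tm Γ t T))
    (h : nfTm nf chk Γ t T = some t') : Red Γ t t' T := by
  simp only [nfTm, bcase_eq] at h
  obtain ⟨_, h⟩ | ⟨_, h⟩ := h
  · cases h; exact ht.red
  · exact hc _ _ _ _ hΓ hT h

theorem isIdSub_sound {env : List Tm} {k : ℕ} (h : isIdSub env k = true) : env = [] ∧ k = 0 := by
  cases env with
  | nil => exact ⟨rfl, Nat.eq_of_beq_eq_true h⟩
  | cons => cases h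

include hi in
theorem force_sound {Γ F T} (hΓ : Der (.ctx Γ)) (hF : IsTy Γ F.den)
    (h : force inf Γ F = some T) : EqTy Γ F.den T := by
  have e : F.ty.sub F.env F.k 0 = F.den := by rw [sub_eq]; rfl
  simp only [force, bcase_eq, e] at h
  obtain ⟨h', h⟩ | ⟨_, h⟩ := h
  · cases h
    have : F.den = F.ty := by
      rw [Clo.den, (isIdSub_sound h').1, (isIdSub_sound h').2]
      exact subst_var _
    rw [this] at hF ⊢
    exact hF.eqRfl
  · exact nfTy_sound hi hΓ hF h

theorem subTy_sound {Γ t t' T T'} (h : subTy T T' = true) (ht : Red Γ t t' T) :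
    Red Γ t t' T' := by
  simp only [subTy, bcase_eq, andb_eq_true] at h
  obtain ⟨h₁, h₂, h₃⟩ | ⟨_, h⟩ := h
  · rw [of_isTag_univ h₁]
    rw [of_isTag_univ h₂] at ht
    exact ht.cumul_le (Nat.le_of_ble_eq_true h₃)
  · rwa [← eq_of_beq h]

include hc in
-- In the η-case the contracted function is checked against the Π-type, which provides the typing
-- that the rule `piEta` requires.
theorem etaLam_sound {Γ A b B t} (hΓ : Der (.ctx Γ)) (hA : IsTy Γ A) (hB : IsTy (A :: Γ) B)
    (hb : Der (.tm (A :: Γ) b B)) (h : etaLam chk Γ A b B = some t) :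
    Red Γ (.lam A b) t (.pi A B) := by
  simp only [etaLam, bcase_eq] at h
  obtain ⟨h', h⟩ | ⟨_, h⟩ := h
  · have hf := hc _ _ _ _ hΓ (hA.pi hB) h
    obtain ⟨i, hA'⟩ := hA
    refine ⟨hA'.lam hb, hf.tm', ?_⟩
    rw [eq_of_isEtaBody h']
    exact (Der.piEta hf.tm).symm.trans hf.eq
  · cases h
    obtain ⟨i, hA⟩ := hA
    exact (hA.lam hb).red

include hc in
theorem etaPair_sound {Γ A a b B t} (hΓ : Der (.ctx Γ)) (hT : IsTy Γ (.sg A B))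
    (ha : Der (.tm Γ a A)) (hb : Der (.tm Γ b (B.inst a)))
    (h : etaPair chk Γ a b (.sg A B) = some t) : Red Γ (.pair a b) t (.sg A B) := by
  have hp := Red.pair hΓ hT ha.red hb.red
  simp only [etaPair, bcase_eq] at h
  obtain ⟨h', h⟩ | ⟨_, h⟩ := h
  · have hf := hc _ _ _ _ hΓ hT h
    refine ⟨hp.tm, hf.tm', ?_⟩
    obtain ⟨e₁, e₂⟩ := eq_of_isEtaPair h'
    rw [e₁, e₂] at hp ⊢
    exact (Der.sgEta hf.tm).symm.trans hf.eq
  · cases h; exact hp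

theorem maxLevel_eq (i j : ℕ) : maxLevel i j = max i j := by
  simp only [maxLevel, bcase_eq]
  rcases h : Nat.ble i j with _ | _
  · rw [← Bool.not_eq_true, Nat.ble_eq] at h
    exact .inr ⟨rfl, by omega⟩
  · rw [Nat.ble_eq] at h
    exact .inl ⟨rfl, by omega⟩

include hi in
theorem infPi_sound {Γ A B r} (hΓ : Der (.ctx Γ)) (h : infPi A B inf chk Γ = some r) :
    Red Γ (.pi A B) r.1 r.2 ∧ IsTy Γ r.2 := by
  simp only [infPi, obind_eq_some] at h
  obtain ⟨r, hr, s, hs, ⟨⟩⟩ := h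
  have h₁ := infTy_sound hi hΓ hr
  have h₂ := infTy_sound hi h₁.eqTy.right.ctx_cons hs
  have h₃ := (h₂.ctxConv h₁.eqTy.symm).cumul_le (le_max_right r.2 s.2)
  replace h₂ := h₂.cumul_le (le_max_right r.2 s.2)
  replace h₁ := h₁.cumul_le (le_max_left r.2 s.2)
  rw [maxLevel_eq]
  exact ⟨⟨h₁.tm.pi h₃.tm, h₁.tm'.pi h₂.tm', h₁.eq.piCongr h₃.eq⟩, .univ hΓ⟩

include hi in
theorem infSg_sound {Γ A B r} (hΓ : Der (.ctx Γ)) (h : infSg A B inf chk Γ = some r) :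
    Red Γ (.sg A B) r.1 r.2 ∧ IsTy Γ r.2 := by
  simp only [infSg, obind_eq_some] at h
  obtain ⟨r, hr, s, hs, ⟨⟩⟩ := h
  have h₁ := infTy_sound hi hΓ hr
  have h₂ := infTy_sound hi h₁.eqTy.right.ctx_cons hs
  have h₃ := (h₂.ctxConv h₁.eqTy.symm).cumul_le (le_max_right r.2 s.2)
  replace h₂ := h₂.cumul_le (le_max_right r.2 s.2)
  replace h₁ := h₁.cumul_le (le_max_left r.2 s.2)
  rw [maxLevel_eq]
  exact ⟨⟨h₁.tm.sg h₃.tm, h₁.tm'.sg h₂.tm', h₁.eq.sgCongr h₃.eq⟩, .univ hΓ⟩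

include hi in
theorem infSum_sound {Γ A B r} (hΓ : Der (.ctx Γ)) (h : infSum A B inf chk Γ = some r) :
    Red Γ (.sum A B) r.1 r.2 ∧ IsTy Γ r.2 := by
  simp only [infSum, obind_eq_some] at h
  obtain ⟨r, hr, s, hs, ⟨⟩⟩ := h
  have h₁ := (infTy_sound hi hΓ hr).cumul_le (le_max_left r.2 s.2)
  have h₂ := (infTy_sound hi hΓ hs).cumul_le (le_max_right r.2 s.2)
  rw [maxLevel_eq]
  exact ⟨⟨h₁.tm.sum h₂.tm, h₁.tm'.sum h₂.tm', h₁.eq.sumCongr h₂.eq⟩, .univ hΓ⟩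

include hi hc in
theorem infLam_sound {Γ A b r} (hΓ : Der (.ctx Γ)) (h : infLam A b inf chk Γ = some r) :
    Red Γ (.lam A b) r.1 r.2 ∧ IsTy Γ r.2 := by
  simp only [infLam, obind_eq_some] at h
  obtain ⟨r, hr, s, hs, t, ht, ⟨⟩⟩ := h
  have h₁ := (infTy_sound hi hΓ hr).eqTy
  obtain ⟨h₂, h₃⟩ := hi _ _ _ h₁.right.ctx_cons hs
  exact ⟨(Red.lam h₁ h₃ h₂).trans (etaLam_sound hc hΓ h₁.right h₃ h₂.tm' ht), h₁.right.pi h₃⟩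

include hi hc in
theorem infBeta_sound {Γ A b a r} (hΓ : Der (.ctx Γ)) (h : infBeta A b a inf chk Γ = some r) :
    Red Γ (.app (.lam A b) a) r.1 r.2 ∧ IsTy Γ r.2 := by
  simp only [infBeta, obind_eq_some, bcase_eq, at₁_eq] at h
  obtain ⟨r, hr, a', ha', ⟨hb, ⟨⟩⟩ | ⟨_, s, hs, T, hT, t, ht, ⟨⟩⟩⟩ := h
  · have h₁ := (infTy_sound hi hΓ hr).eqTy
    have h₂ := hc _ _ _ _ hΓ h₁.right ha'
    have hv : Der (.tm (r.1 :: Γ) (.var 0) (r.1.shift 1)) := .var h₁.right.ctx_cons rfl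
    have := Red.app_lam hΓ h₁ (IsTy.wk h₁.right.ctx_cons h₁.right) hv.red h₂
    rw [shift_one_inst] at this
    rw [eq_of_beq hb]
    exact ⟨this, h₁.right⟩
  · have h₁ := (infTy_sound hi hΓ hr).eqTy
    have h₂ := (hc _ _ _ _ hΓ h₁.right ha').ann hΓ h₁.right
    obtain ⟨h₃, h₄⟩ := hi _ _ _ h₁.right.ctx_cons hs
    have h₅ := nfTy_sound hi hΓ (IsTy.inst hΓ h₄ h₂.tm') hT
    have h₆ := (Red.app_lam hΓ h₁ h₄ h₃ h₂).conv h₅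
    exact ⟨h₆.trans (nfTm_sound hc hΓ h₅.right h₆.tm' ht), h₅.right⟩

include hi in
-- The last conclusion covers introduction forms: for these the type has been forced, so the
-- substitution of the closure is trivial and a β-step can be made at an explicit type.
theorem expose_sound {Γ t f F F' i j} (hΓ : Der (.ctx Γ)) (hF : IsTy Γ F.den)
    (hf : Red Γ t f F.den) (h : expose i j inf Γ f F = some F') :
    F'.ty.isTag i = true ∧ Red Γ t f F'.den ∧ IsTy Γ F'.den ∧
      (f.isTag j = true → F'.env = [] ∧ F'.k = 0) := by
  simp only [expose, obind_eq_some, bcase_eq, andb_eq_true] at h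
  obtain ⟨⟨h, h' | h'⟩, ⟨⟩⟩ | ⟨_, T, hT, ⟨h, ⟨⟩⟩ | ⟨_, h⟩⟩ := h
  · simp at h'
  · exact ⟨h, hf, hF, fun h => by simp [h'.1] at h⟩
  · have := force_sound hi hΓ hF hT
    refine ⟨h, ?_, ?_, fun _ => ⟨rfl, rfl⟩⟩ <;> rw [Clo.den_nil]
    · exact hf.conv this
    · exact this.right
  · cases h

include hi hc in
theorem spApp_sound {Γ t f a a' D F r} (hΓ : Der (.ctx Γ)) (hF : IsTy Γ F.den)
    (hf : Red Γ t f F.den) (hpi : F.ty = .pi F.ty.fst! F.ty.snd!)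
    (hl : f.isTag 3 = true → F.env = [] ∧ F.k = 0)
    (hD : EqTy Γ (Clo.den ⟨F.ty.fst!, F.env, F.k⟩) D) (ha : Red Γ a a' D)
    (h : spApp f a' D F inf chk Γ = some r) :
    Red Γ (.app t a) r.1 r.2.den ∧ IsTy Γ r.2.den := by
  obtain ⟨F, env, k⟩ := F
  obtain ⟨A, B, rfl⟩ : ∃ A B, F = .pi A B := ⟨_, _, hpi⟩
  have ha' := (ha.ann hΓ hD.right).conv hD.symm
  simp only [spApp, obind_eq_some, bcase_eq, at₁_eq] at h
  have happ := Red.app hΓ hF hf ha'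
  have e : ∀ u, (B.subst (up (envSub env k))).inst u = Clo.den ⟨B, u :: env, k⟩ :=
    fun u => subst_up_inst _ _ _
  have hB := IsTy.inst_congr hΓ hF.of_pi.1 hF.of_pi.2 ha'.tm ha'.tm' ha'.eq
  obtain ⟨h', ⟨hA, b, hb, T, hT, t', ht, ⟨⟩⟩ | ⟨_, h⟩⟩ | ⟨_, ⟨⟩⟩ := h
  · obtain ⟨⟨⟩, ⟨⟩⟩ := hl h'
    have e' : Clo.den ⟨.pi A B, [], 0⟩ = .pi A B := Clo.den_nil _
    have eA : Clo.den ⟨A, [], 0⟩ = A := Clo.den_nil _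
    change f.fst!.beq A = true at hA
    change chk (A :: Γ) f.snd! B = some b at hb
    change force inf Γ ⟨B, [a'.ann D], 0⟩ = some T at hT
    change EqTy Γ (Clo.den ⟨A, [], 0⟩) D at hD
    rw [e'] at hF hf
    rw [eA] at hD
    rw [of_isTag_lam h', eq_of_beq hA] at hf
    have ha' := (ha.ann hΓ hD.right).conv hD.symm
    have happ := Red.app hΓ hF hf ha'
    have hB := IsTy.inst_congr hΓ hF.of_pi.1 hF.of_pi.2 ha'.tm ha'.tm' ha'.eq
    -- The typing of a λ-term does not directly yield one of its body, so the body is checked again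
    -- against the codomain.
    have hb' := hc _ _ _ _ hF.of_pi.1.ctx_cons hF.of_pi.2 hb
    have h₁ := (Red.beta hΓ hF.of_pi.1 hb'.tm ha'.tm').conv hB.symm
    have h₂ := (Red.inst hΓ hF.of_pi.1 hF.of_pi.2 hb' ha'.tm'.red).conv hB.symm
    have h₃ := force_sound hi hΓ (F := ⟨B, [a'.ann D], 0⟩) hB.right hT
    have h₄ := ((happ.trans h₁).trans h₂).conv (hB.trans h₃)
    rw [Clo.den_nil]
    exact ⟨h₄.trans (nfTm_sound hc hΓ h₃.right h₄.tm' ht), h₃.right⟩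
  · cases h
  · have h₁ := (Red.app hΓ hF hf ((ha.conv hD.symm))).conv hB
    exact ⟨(e _) ▸ h₁, (e _) ▸ hB.right⟩

include hi in
theorem spInf_sound {t Γ r} (hΓ : Der (.ctx Γ)) (h : spInf t inf chk Γ = some r) :
    Red Γ t r.1 r.2.den ∧ IsTy Γ r.2.den := by
  simp only [spInf, obind_eq_some] at h
  obtain ⟨r, hr, ⟨⟩⟩ := h
  rw [Clo.den_nil]
  exact hi _ _ _ hΓ hr

/-- The context of a judgement. -/
def Judgement.base : Judgement → Ctx
  | .ctx Γ => Γ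
  | .tm Γ _ _ => Γ
  | .eq Γ _ _ _ => Γ

/-- Every rule other than the two context rules has a premise over the same context as its
conclusion. -/
theorem Der.base {J} (h : Der J) : Der (.ctx J.base) := by
  induction h with
  | nil => exact .nil
  | cons h => exact h.cons
  | _ => assumption

theorem isTy_of_getElem {Γ : Ctx} {n : ℕ} {A : Tm} (hΓ : Der (.ctx Γ)) (h : Γ[n]? = some A) :
    IsTy Γ (A.shift (n + 1)) := by
  induction Γ generalizing n with
  | nil => simp at h
  | cons B Γ ih =>
    obtain ⟨i, hB⟩ : IsTy Γ B := by
      cases hΓ with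
      | cons h => exact ⟨_, h⟩
    cases n with
    | zero =>
      obtain rfl : B = A := by simpa using h
      exact IsTy.wk hΓ ⟨i, hB⟩
    | succ n =>
      have := IsTy.wk hΓ (ih hB.base (by simpa using h))
      rwa [shift, shift, rename_rename] at this

include hi hc in
-- The components are checked again because no inversion for pairs is available. The projections of
-- `p` then reduce to them through `p'`.
theorem chkComps_sound {Γ p p' A B r} (hΓ : Der (.ctx Γ)) (hT : IsTy Γ (.sg A B))
    (hp : Red Γ p p' (.sg A B)) (h' : p'.isTag 6 = true)
    (h : chkComps p' A B inf chk Γ = some r) :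
    Red Γ (.fst p) r.1 A ∧ Red Γ (.snd p) r.2.1 r.2.2 ∧ IsTy Γ r.2.2 := by
  obtain ⟨a₀, b₀, rfl⟩ : ∃ a b, p' = .pair a b := ⟨_, _, of_isTag_pair h'⟩
  simp only [chkComps, obind_eq_some, at₁_eq] at h
  obtain ⟨a, ha, T, hT', b, hb, ⟨⟩⟩ := h
  have h₁ : Red Γ a₀ a A := hc _ _ _ _ hΓ hT.of_sg.1 ha
  have h₂ := h₁.ann hΓ hT.of_sg.1
  have h₃ := nfTy_sound hi hΓ (IsTy.inst hΓ hT.of_sg.2 h₂.tm') hT'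
  have h₄ : Red Γ b₀ b T := hc _ _ _ _ hΓ h₃.right hb
  have h₅ := (IsTy.inst_congr hΓ hT.of_sg.1 hT.of_sg.2 h₂.tm h₂.tm' h₂.eq).trans h₃
  have h₆ := Red.fst_pair hT.of_sg.2 h₁.tm (h₄.tm.conv' h₅.symm)
  have h₇ := Red.snd_pair hΓ hT h₁.tm (h₄.tm.conv' h₅.symm)
  have h₈ := hp.fst.trans h₆
  have h₉ := IsTy.inst_congr hΓ hT.of_sg.1 hT.of_sg.2 h₈.tm h₈.tm' h₈.eq
  exact ⟨h₈.trans h₁, (((Red.snd hΓ hT hp).conv h₉).trans h₇).conv h₅ |>.trans h₄, h₃.right⟩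

include hi hc in
theorem spFst_sound {Γ t p F r} (hΓ : Der (.ctx Γ)) (hF : IsTy Γ F.den) (hp : Red Γ t p F.den)
    (hsg : F.ty = .sg F.ty.fst! F.ty.snd!) (hl : p.isTag 6 = true → F.env = [] ∧ F.k = 0)
    (h : spFst p F inf chk Γ = some r) : Red Γ (.fst t) r.1 r.2.den ∧ IsTy Γ r.2.den := by
  obtain ⟨F, env, k⟩ := F
  obtain ⟨A, B, rfl⟩ : ∃ A B, F = .sg A B := ⟨_, _, hsg⟩
  simp only [spFst, obind_eq_some, bcase_eq] at h
  obtain ⟨h', c, hc', ⟨⟩⟩ | ⟨_, ⟨⟩⟩ := h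
  · obtain ⟨⟨⟩, ⟨⟩⟩ := hl h'
    rw [Clo.den_nil] at hF hp
    have := chkComps_sound hi hc hΓ hF hp h' hc'
    rw [Clo.den_nil]
    exact ⟨this.1, hF.of_sg.1⟩
  · exact ⟨Red.fst hp, hF.of_sg.1⟩

include hi hc in
theorem spSnd_sound {Γ t p F r} (hΓ : Der (.ctx Γ)) (hF : IsTy Γ F.den) (hp : Red Γ t p F.den)
    (hsg : F.ty = .sg F.ty.fst! F.ty.snd!) (hl : p.isTag 6 = true → F.env = [] ∧ F.k = 0)
    (h : spSnd p F inf chk Γ = some r) : Red Γ (.snd t) r.1 r.2.den ∧ IsTy Γ r.2.den := by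
  obtain ⟨F, env, k⟩ := F
  obtain ⟨A, B, rfl⟩ : ∃ A B, F = .sg A B := ⟨_, _, hsg⟩
  simp only [spSnd, obind_eq_some, bcase_eq] at h
  obtain ⟨h', c, hc', ⟨⟩⟩ | ⟨_, ⟨⟩⟩ := h
  · obtain ⟨⟨⟩, ⟨⟩⟩ := hl h'
    rw [Clo.den_nil] at hF hp
    have := chkComps_sound hi hc hΓ hF hp h' hc'
    rw [Clo.den_nil]
    exact this.2
  · have e : ∀ u, (B.subst (up (envSub env k))).inst u = Clo.den ⟨B, u :: env, k⟩ :=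
      fun u => subst_up_inst _ _ _
    have h₁ := Red.fst hp
    have h₂ := IsTy.inst_congr hΓ hF.of_sg.1 hF.of_sg.2 h₁.tm h₁.tm' h₁.eq
    have h₃ := (Red.snd hΓ hF hp).conv h₂
    exact ⟨(e _) ▸ h₃, (e _) ▸ h₂.right⟩

include hi hc in
-- Types along a spine are kept as closures, so each elimination only extends an environment; a
-- substitution is carried out when a domain or an explicit type is needed.
theorem spine_sound {t Γ r} (hΓ : Der (.ctx Γ)) (h : spine t inf chk Γ = some r) :
    Red Γ t r.1 r.2.den ∧ IsTy Γ r.2.den := by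
  induction t generalizing r with
  | var n =>
    obtain ⟨A, hA, ⟨⟩⟩ := obind_eq_some.1 h
    rw [look_eq] at hA
    have e : A.shift (n + 1) = Clo.den ⟨A, [], n + 1⟩ := rename_eq_subst _ _
    exact ⟨e ▸ (Der.var hΓ hA).red, e ▸ isTy_of_getElem hΓ hA⟩
  | app f a ihf _ =>
    obtain ⟨_, h⟩ | ⟨_, h⟩ := bcase_eq.1 h
    · exact spInf_sound (chk := chk) hi hΓ h
    · simp only [obind_eq_some] at h
      obtain ⟨r, hr, F, hF, D, hD, a', ha', h⟩ := h
      obtain ⟨h₁, h₂⟩ := ihf hr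
      obtain ⟨h₃, h₄, h₅, h₆⟩ := expose_sound hi hΓ h₂ h₁ hF
      have h₃ := of_isTag_pi h₃
      have hA : IsTy Γ (Clo.den ⟨F.ty.fst!, F.env, F.k⟩) := by
        have := h₅
        rw [Clo.den, h₃] at this
        exact this.of_pi.1
      have h₇ := force_sound hi hΓ hA hD
      exact spApp_sound hi hc hΓ h₅ h₄ h₃ h₆ h₇ (hc _ _ _ _ hΓ h₇.right ha') h
  | fst p ih =>
    obtain ⟨_, h⟩ | ⟨_, h⟩ := bcase_eq.1 h
    · exact spInf_sound (chk := chk) hi hΓ h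
    · simp only [obind_eq_some] at h
      obtain ⟨r, hr, F, hF, h⟩ := h
      obtain ⟨h₁, h₂⟩ := ih hr
      obtain ⟨h₃, h₄, h₅, h₆⟩ := expose_sound hi hΓ h₂ h₁ hF
      exact spFst_sound hi hc hΓ h₅ h₄ (of_isTag_sg h₃) h₆ h
  | snd p ih =>
    obtain ⟨_, h⟩ | ⟨_, h⟩ := bcase_eq.1 h
    · exact spInf_sound (chk := chk) hi hΓ h
    · simp only [obind_eq_some] at h
      obtain ⟨r, hr, F, hF, h⟩ := h
      obtain ⟨h₁, h₂⟩ := ih hr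
      obtain ⟨h₃, h₄, h₅, h₆⟩ := expose_sound hi hΓ h₂ h₁ hF
      exact spSnd_sound hi hc hΓ h₅ h₄ (of_isTag_sg h₃) h₆ h
  | _ => exact spInf_sound (chk := chk) hi hΓ h

include hi hc in
theorem infSpine_sound {Γ t r} (hΓ : Der (.ctx Γ)) (h : infSpine t inf chk Γ = some r) :
    Red Γ t r.1 r.2 ∧ IsTy Γ r.2 := by
  simp only [infSpine, obind_eq_some] at h
  obtain ⟨r, hr, T, hT, ⟨⟩⟩ := h
  obtain ⟨h₁, h₂⟩ := spine_sound hi hc hΓ hr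
  have h₃ := force_sound hi hΓ h₂ hT
  exact ⟨h₁.conv h₃, h₃.right⟩

include hi hc in
theorem infApp_sound {Γ f a r} (hΓ : Der (.ctx Γ)) (h : infApp f a inf chk Γ = some r) :
    Red Γ (.app f a) r.1 r.2 ∧ IsTy Γ r.2 := by
  obtain ⟨h', h⟩ | ⟨_, h⟩ := bcase_eq.1 h
  · rw [of_isTag_lam h']
    exact infBeta_sound hi hc hΓ h
  · exact infSpine_sound hi hc hΓ h

include hi hc in
theorem infPair_sound {Γ a b r} (hΓ : Der (.ctx Γ)) (h : infPair a b inf chk Γ = some r) :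
    Red Γ (.pair a b) r.1 r.2 ∧ IsTy Γ r.2 := by
  simp only [infPair, obind_eq_some, wk_eq] at h
  obtain ⟨r, hr, s, hs, t, ht, ⟨⟩⟩ := h
  obtain ⟨h₁, h₂⟩ := hi _ _ _ hΓ hr
  obtain ⟨h₃, h₄⟩ := hi _ _ _ hΓ hs
  have hT := h₂.sg (IsTy.wk h₂.ctx_cons h₄)
  have e : ∀ u, (s.2.shift 1).inst u = s.2 := shift_one_inst _
  have h₅ := Red.pair hΓ hT h₁ (b := b) (b' := s.1) ((e a).symm ▸ h₃)
  exact ⟨h₅.trans (etaPair_sound hc hΓ hT h₁.tm' ((e r.1).symm ▸ h₃.tm') ht), hT⟩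

include hi hc in
theorem infFst_sound {Γ p r} (hΓ : Der (.ctx Γ)) (h : infFst p inf chk Γ = some r) :
    Red Γ (.fst p) r.1 r.2 ∧ IsTy Γ r.2 := by
  simp only [infFst, obind_eq_some, bcase_eq] at h
  obtain ⟨h', r, hr, s, hs, ⟨⟩⟩ | ⟨_, h⟩ := h
  · obtain ⟨h₁, h₂⟩ := hi _ _ _ hΓ hr
    obtain ⟨h₃, h₄⟩ := hi _ _ _ hΓ hs
    rw [of_isTag_pair h']
    have e : (s.2.shift 1).inst p.fst! = s.2 := shift_one_inst _ _
    exact ⟨(Red.fst_pair (IsTy.wk h₂.ctx_cons h₄) h₁.tm (e.symm ▸ h₃.tm)).trans h₁, h₂⟩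
  · exact infSpine_sound hi hc hΓ h

include hi hc in
theorem infSnd_sound {Γ p r} (hΓ : Der (.ctx Γ)) (h : infSnd p inf chk Γ = some r) :
    Red Γ (.snd p) r.1 r.2 ∧ IsTy Γ r.2 := by
  simp only [infSnd, obind_eq_some, bcase_eq] at h
  obtain ⟨h', s, hs, hr⟩ | ⟨_, h⟩ := h
  · obtain ⟨h₁, h₂⟩ := hi _ _ _ hΓ hs
    obtain ⟨h₃, h₄⟩ := hi _ _ _ hΓ hr
    rw [of_isTag_pair h']
    have e : (r.2.shift 1).inst p.fst! = r.2 := shift_one_inst _ _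
    have := Red.snd_pair hΓ (h₂.sg (IsTy.wk h₂.ctx_cons h₄)) h₁.tm (e.symm ▸ h₃.tm)
    rw [e] at this
    exact ⟨this.trans h₃, h₄⟩
  · exact infSpine_sound hi hc hΓ h

end

/-! ### Congruence of the remaining eliminators -/

namespace Red

theorem sumInd {Γ A B C C' c c' d d' e e'} (hΓ : Der (.ctx Γ)) (hA : IsTy Γ A) (hB : IsTy Γ B)
    (hC : EqTy (.sum A B :: Γ) C C')
    (hc : Red (A :: Γ) c c' (C.instUnder 1 (.inl (.var 0))))
    (hd : Red (B :: Γ) d d' (C.instUnder 1 (.inr (.var 0)))) (he : Red Γ e e' (.sum A B)) :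
    Red Γ (.sumInd C c d e) (.sumInd C' c' d' e') (C.inst e) := by
  have hT := hA.sum hB
  have hA' := IsTy.wk hA.ctx_cons hA
  have hB' := IsTy.wk hB.ctx_cons hB
  have hl := Red.inl (IsTy.wk hA.ctx_cons hB) (Der.var (n := 0) hA.ctx_cons rfl).red
  have hr := Red.inr (IsTy.wk hB.ctx_cons hA) (Der.var (n := 0) hB.ctx_cons rfl).red
  have hc' := hc.tm'.conv' (Red.eqTy_instUnder hA.ctx_cons hT hC hl)
  have hd' := hd.tm'.conv' (Red.eqTy_instUnder hB.ctx_cons hT hC hr)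
  have e₁ := Red.eqTy_inst hΓ hT hC he
  obtain ⟨i, h₁, h₂, h₃⟩ := hC
  exact ⟨h₁.sumInd hc.tm hd.tm he.tm, (h₂.sumInd hc' hd' he.tm').conv' e₁.symm,
    h₃.sumIndCongr hc.eq hd.eq he.eq⟩

theorem zeroInd {Γ C C' e e'} (hΓ : Der (.ctx Γ)) (hC : EqTy (.zero :: Γ) C C')
    (he : Red Γ e e' .zero) : Red Γ (.zeroInd C e) (.zeroInd C' e') (C.inst e) := by
  have e₁ := Red.eqTy_inst hΓ (.zero hΓ) hC he
  obtain ⟨i, h₁, h₂, h₃⟩ := hC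
  exact ⟨h₁.zeroInd he.tm, (h₂.zeroInd he.tm').conv' e₁.symm, h₃.zeroIndCongr he.eq⟩

theorem oneInd {Γ C C' c c' e e'} (hΓ : Der (.ctx Γ)) (hC : EqTy (.one :: Γ) C C')
    (hc : Red Γ c c' (C.inst .star)) (he : Red Γ e e' .one) :
    Red Γ (.oneInd C c e) (.oneInd C' c' e') (C.inst e) := by
  have e₁ := Red.eqTy_inst hΓ (.one hΓ) hC he
  have e₂ := EqTy.inst hΓ hC (.star hΓ)
  obtain ⟨i, h₁, h₂, h₃⟩ := hC
  exact ⟨h₁.oneInd hc.tm he.tm, (h₂.oneInd (hc.tm'.conv' e₂) he.tm').conv' e₁.symm,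
    h₃.oneIndCongr hc.eq he.eq⟩

/-- As for one variable: the family is abstracted twice, and congruence of application is used for
the point and then for the path. The two instances are related to the applications by two β-steps.
-/
theorem eqTy_inst₂ {Γ A a b b' C p p'} (hΓ : Der (.ctx Γ)) (hA : IsTy Γ A) (ha : Der (.tm Γ a A))
    (hC : IsTy (.id (A.shift 1) (a.shift 1) (.var 0) :: A :: Γ) C) (hb : Red Γ b b' A)
    (hp : Red Γ p p' (.id A a b)) : EqTy Γ (C.inst₂ b p) (C.inst₂ b' p') := by
  have hAΓ := hA.ctx_cons
  have hE : IsTy (A :: Γ) (.id (A.shift 1) (a.shift 1) (.var 0)) :=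
    IsTy.id (IsTy.wk hAΓ hA) (Der.wk hAΓ ha) (.var hAΓ rfl)
  have eE : ∀ u, (Tm.id (A.shift 1) (a.shift 1) (.var 0)).inst u = .id A a u := fun u => by
    change Tm.id ((A.shift 1).inst u) ((a.shift 1).inst u) u = _
    rw [shift_one_inst, shift_one_inst]
  have hp' : Red Γ p' p' (.id A a b') :=
    hp.tm'.red.conv (EqTy.id hA.eqRfl ha.red hb)
  obtain ⟨i, hC⟩ := hC
  have hlC : Der (.tm (A :: Γ) (.lam (.id (A.shift 1) (a.shift 1) (.var 0)) C)
      (.pi (.id (A.shift 1) (a.shift 1) (.var 0)) (.univ i))) := by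
    obtain ⟨j, hE⟩ := hE
    exact hE.lam hC
  have hlU : IsTy (A :: Γ) (.pi (.id (A.shift 1) (a.shift 1) (.var 0)) (.univ i)) :=
    hE.pi (.univ hE.ctx_cons)
  -- The doubly applied abstraction reduces to the instance of `C` at `u` and `q`.
  have key : ∀ u q, Der (.tm Γ u A) → Der (.tm Γ q (.id A a u)) →
      Red Γ (.app (.app (.lam A (.lam (.id (A.shift 1) (a.shift 1) (.var 0)) C)) u) q)
        (C.inst₂ u q) (.univ i) := fun u q hu hq => by
    have h₁ := Red.beta hΓ hA hlC hu
    have hT := IsTy.inst hΓ hlU hu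
    change Red Γ _ (.lam (Tm.inst _ u) (C.subst (up (scons u var))))
      (.pi (Tm.inst _ u) (.univ i)) at h₁
    change IsTy Γ (.pi (Tm.inst _ u) (.univ i)) at hT
    rw [eE] at h₁ hT
    have h₂ := Red.app hΓ hT h₁ hq.red
    have hC' : Der (.tm (.id A a u :: Γ) (C.subst (up (scons u var))) (.univ i)) := by
      have := (Sb.up (Sb.inst hΓ hu) (IsTy.inst hΓ hE hu)).tm (IsTy.inst hΓ hE hu).ctx_cons hC
      change Der (.tm (Tm.inst _ u :: Γ) _ _) at this
      rwa [eE] at this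
    have h₃ := Red.beta hΓ hT.of_pi.1 hC' hq
    rw [inst₂_eq]
    exact h₂.trans h₃
  obtain ⟨j, hA'⟩ := id hA
  have hf := (hA'.lam hlC).red
  have h₁ := Red.app hΓ (hA.pi hlU) hf hb
  change Red Γ _ _ (.pi (Tm.inst _ b) (.univ i)) at h₁
  rw [eE] at h₁
  have hT := (hA.id ha hb.tm).pi (IsTy.univ (i := i) (hA.id ha hb.tm).ctx_cons)
  exact ((key _ _ hb.tm hp.tm).symm.trans (Red.app hΓ hT h₁ hp)).trans
    (key _ _ hb.tm' hp'.tm) |>.eqTy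

theorem eqTy_inst₂' {Γ A a b C C' p} (hΓ : Der (.ctx Γ))
    (hC : EqTy (.id (A.shift 1) (a.shift 1) (.var 0) :: A :: Γ) C C') (hb : Der (.tm Γ b A))
    (hp : Der (.tm Γ p (.id A a b))) : EqTy Γ (C.inst₂ b p) (C'.inst₂ b p) := by
  refine hC.subst hΓ (Sb.scons (Sb.inst hΓ hb) ?_)
  change Der (.tm Γ p (.id ((A.shift 1).inst b) ((a.shift 1).inst b) b))
  rwa [shift_one_inst, shift_one_inst]

theorem idInd {Γ A a b C C' c c' p p'} (hΓ : Der (.ctx Γ)) (hA : IsTy Γ A) (ha : Der (.tm Γ a A))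
    (hb : Der (.tm Γ b A))
    (hC : EqTy (.id (A.shift 1) (a.shift 1) (.var 0) :: A :: Γ) C C')
    (hc : Red Γ c c' (C.inst₂ a (.refl a))) (hp : Red Γ p p' (.id A a b)) :
    Red Γ (.idInd C c p) (.idInd C' c' p') (C.inst₂ b p) := by
  have e₁ := (Red.eqTy_inst₂ hΓ hA ha hC.left hb.red hp).trans
    (Red.eqTy_inst₂' hΓ hC hb hp.tm')
  have e₂ := Red.eqTy_inst₂' hΓ hC ha ha.refl
  obtain ⟨i, h₁, h₂, h₃⟩ := hC
  exact ⟨h₁.idInd ha hc.tm hp.tm, (h₂.idInd ha (hc.tm'.conv' e₂) hp.tm').conv' e₁.symm,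
    h₃.idIndCongr ha hc.eq hp.eq⟩

end Red

section

variable {inf : Inf} {chk : Chk} (hi : InfSound inf) (hc : ChkSound chk)

include hi in
theorem infInl_sound {Γ a r} (hΓ : Der (.ctx Γ)) (h : infInl a inf chk Γ = some r) :
    Red Γ (.inl a) r.1 r.2 ∧ IsTy Γ r.2 := by
  simp only [infInl, obind_eq_some] at h
  obtain ⟨r, hr, ⟨⟩⟩ := h
  obtain ⟨h₁, h₂⟩ := hi _ _ _ hΓ hr
  exact ⟨h₁.inl (.zero hΓ), h₂.sum (.zero hΓ)⟩

include hi in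
theorem infInr_sound {Γ b r} (hΓ : Der (.ctx Γ)) (h : infInr b inf chk Γ = some r) :
    Red Γ (.inr b) r.1 r.2 ∧ IsTy Γ r.2 := by
  simp only [infInr, obind_eq_some] at h
  obtain ⟨r, hr, ⟨⟩⟩ := h
  obtain ⟨h₁, h₂⟩ := hi _ _ _ hΓ hr
  exact ⟨h₁.inr (.zero hΓ), (IsTy.zero hΓ).sum h₂⟩

include hc in
-- If the scrutinee is an injection, its argument is checked anew at the summand, since the typing
-- of an injection is not inverted; then congruence and the β-rule apply.
theorem sumIndRed_sound {Γ A B C c d e T t} (hΓ : Der (.ctx Γ)) (hA : IsTy Γ A) (hB : IsTy Γ B)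
    (hC : IsTy (.sum A B :: Γ) C) (h₁ : Der (.tm (A :: Γ) c (C.instUnder 1 (.inl (.var 0)))))
    (h₂ : Der (.tm (B :: Γ) d (C.instUnder 1 (.inr (.var 0))))) (he : Der (.tm Γ e (.sum A B)))
    (hT : EqTy Γ (C.inst e) T) (h : sumIndRed A B C c d e T chk Γ = some t) :
    Red Γ (.sumInd C c d e) t T := by
  simp only [sumIndRed, obind_eq_some, bcase_eq, at₁_eq] at h
  obtain ⟨h', a, ha, h⟩ | ⟨_, ⟨h', b, hb, h⟩ | ⟨_, ⟨⟩⟩⟩ := h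
  · rw [of_isTag_inl h'] at he hT ⊢
    have ha' := (hc _ _ _ _ hΓ hA ha).ann hΓ hA
    have h₃ := (Red.sumInd hΓ hA hB hC.eqRfl h₁.red h₂.red (ha'.inl hB)).conv hT
    have e' := Red.eqTy_inst hΓ (hA.sum hB) hC.eqRfl (ha'.inl hB)
    obtain ⟨i, hC⟩ := hC
    have h₄ := (hC.inlBeta h₁ h₂ ha'.tm').convEq' (e'.symm.trans hT)
    have eI : (C.instUnder 1 (.inl (.var 0))).inst (a.ann A) = C.inst (.inl (a.ann A)) := by
      rw [instUnder, inst, subst_subst, scons_comp]; rfl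
    have h₅ := (eI ▸ Der.inst hΓ h₁ ha'.tm').conv' (e'.symm.trans hT)
    have h₆ : Red Γ (.sumInd C c d (.inl e.fst!)) (c.inst (a.ann A)) T :=
      ⟨h₃.tm, h₅, h₃.eq.trans h₄⟩
    exact h₆.trans (nfTm_sound hc hΓ hT.right h₅ h)
  · rw [of_isTag_inr h'] at he hT ⊢
    have hb' := (hc _ _ _ _ hΓ hB hb).ann hΓ hB
    have h₃ := (Red.sumInd hΓ hA hB hC.eqRfl h₁.red h₂.red (hb'.inr hA)).conv hT
    have e' := Red.eqTy_inst hΓ (hA.sum hB) hC.eqRfl (hb'.inr hA)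
    obtain ⟨i, hC⟩ := hC
    have h₄ := (hC.inrBeta h₁ h₂ hb'.tm').convEq' (e'.symm.trans hT)
    have eI : (C.instUnder 1 (.inr (.var 0))).inst (b.ann B) = C.inst (.inr (b.ann B)) := by
      rw [instUnder, inst, subst_subst, scons_comp]; rfl
    have h₅ := (eI ▸ Der.inst hΓ h₂ hb'.tm').conv' (e'.symm.trans hT)
    have h₆ : Red Γ (.sumInd C c d (.inr e.fst!)) (d.inst (b.ann B)) T :=
      ⟨h₃.tm, h₅, h₃.eq.trans h₄⟩
    exact h₆.trans (nfTm_sound hc hΓ hT.right h₅ h)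
  · exact (Red.sumInd hΓ hA hB hC.eqRfl h₁.red h₂.red he.red).conv hT

include hi hc in
theorem infSumInd_sound {Γ C c d e r} (hΓ : Der (.ctx Γ))
    (h : infSumInd C c d e inf chk Γ = some r) : Red Γ (.sumInd C c d e) r.1 r.2 ∧ IsTy Γ r.2 := by
  simp only [infSumInd, obind_eq_some, bcase_eq, at₁_eq, atUnder_eq, wk_eq] at h
  obtain ⟨⟨e', E⟩, hr, ⟨h', s, hs, L, hL, c', hc', R, hR, d', hd', T, hT, t, ht, ⟨⟩⟩ | ⟨_, h⟩⟩ := h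
  · obtain ⟨h₁, h₂⟩ := hi _ _ _ hΓ hr
    obtain ⟨A, B, rfl⟩ : ∃ A B, E = .sum A B := ⟨_, _, of_isTag_sum h'⟩
    obtain ⟨hA, hB⟩ := h₂.of_sum
    have hC := (infTy_sound hi h₂.ctx_cons hs).eqTy
    have hl := (Red.inl (IsTy.wk hA.ctx_cons hB) (Der.var (n := 0) hA.ctx_cons rfl).red).ann
      hA.ctx_cons (IsTy.wk hA.ctx_cons h₂)
    have hr := (Red.inr (IsTy.wk hB.ctx_cons hA) (Der.var (n := 0) hB.ctx_cons rfl).red).ann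
      hB.ctx_cons (IsTy.wk hB.ctx_cons h₂)
    have eL := Red.eqTy_instUnder hA.ctx_cons h₂ hC hl
    have eL' := Red.eqTy_instUnder hA.ctx_cons h₂ hC.right.eqRfl hl
    have eR := Red.eqTy_instUnder hB.ctx_cons h₂ hC hr
    have eR' := Red.eqTy_instUnder hB.ctx_cons h₂ hC.right.eqRfl hr
    have hL := nfTy_sound hi hA.ctx_cons eL.right hL
    have hR := nfTy_sound hi hB.ctx_cons eR.right hR
    have hc' := hc _ _ _ _ hA.ctx_cons hL.right hc'
    have hd' := hc _ _ _ _ hB.ctx_cons hR.right hd'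
    have he := h₁.ann hΓ h₂
    have eT := Red.eqTy_inst hΓ h₂ hC he
    have eT' := Red.eqTy_inst hΓ h₂ hC.right.eqRfl ((h₁.symm.trans he))
    have hT := nfTy_sound hi hΓ eT.right hT
    have h₃ := (Red.sumInd hΓ hA hB hC (hc'.conv (eL.trans hL).symm) (hd'.conv (eR.trans hR).symm)
      h₁).conv (eT.trans hT)
    exact ⟨h₃.trans (sumIndRed_sound hc hΓ hA hB hC.right (hc'.conv (eL'.trans hL).symm).tm'
      (hd'.conv (eR'.trans hR).symm).tm' h₁.tm' (eT'.trans hT) ht), hT.right⟩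
  · cases h

include hi hc in
theorem infZeroInd_sound {Γ C e r} (hΓ : Der (.ctx Γ))
    (h : infZeroInd C e inf chk Γ = some r) : Red Γ (.zeroInd C e) r.1 r.2 ∧ IsTy Γ r.2 := by
  simp only [infZeroInd, obind_eq_some, at₁_eq] at h
  obtain ⟨s, hs, e', he, T, hT, ⟨⟩⟩ := h
  have hZ := IsTy.zero hΓ
  have hC := (infTy_sound hi hZ.ctx_cons hs).eqTy
  have h₁ := hc _ _ _ _ hΓ hZ he
  have e₁ := Red.eqTy_inst hΓ hZ hC (h₁.ann hΓ hZ)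
  have e₂ := e₁.trans (nfTy_sound hi hΓ e₁.right hT)
  exact ⟨(Red.zeroInd hΓ hC h₁).conv e₂, e₂.right⟩

include hi hc in
theorem infOneInd_sound {Γ C c e r} (hΓ : Der (.ctx Γ))
    (h : infOneInd C c e inf chk Γ = some r) : Red Γ (.oneInd C c e) r.1 r.2 ∧ IsTy Γ r.2 := by
  simp only [infOneInd, obind_eq_some, bcase_eq, at₁_eq] at h
  obtain ⟨s, hs, e', he, S, hS, c', hc', h⟩ := h
  have hO := IsTy.one hΓ
  have hC := (infTy_sound hi hO.ctx_cons hs).eqTy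
  have h₁ := hc _ _ _ _ hΓ hO he
  have eS := EqTy.inst hΓ hC (.star hΓ)
  have eS' := nfTy_sound hi hΓ eS.right hS
  have h₂ := (hc _ _ _ _ hΓ eS'.right hc')
  have h₃ := Red.oneInd hΓ hC (h₂.conv (eS.trans eS').symm) h₁
  obtain ⟨h', ⟨⟩⟩ | ⟨_, T, hT, ⟨⟩⟩ := h
  · rw [of_isTag_star h'] at h₁ h₃
    have e₁ := Red.eqTy_inst hΓ hO hC h₁
    have h₄ := h₂.conv eS'.symm
    obtain ⟨i, _, hC', _⟩ := hC
    have h₅ : Red Γ (.oneInd s.1 c' .star) c' (s.1.inst .star) :=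
      ⟨hC'.oneInd h₄.tm' (.star hΓ), h₄.tm', hC'.oneBeta h₄.tm'⟩
    exact ⟨((h₃.conv e₁).trans h₅).conv eS', eS'.right⟩
  · have e₁ := Red.eqTy_inst hΓ hO hC (h₁.ann hΓ hO)
    have e₂ := e₁.trans (nfTy_sound hi hΓ e₁.right hT)
    exact ⟨h₃.conv e₂, e₂.right⟩

include hi hc in
theorem infId_sound {Γ A a b r} (hΓ : Der (.ctx Γ)) (h : infId A a b inf chk Γ = some r) :
    Red Γ (.id A a b) r.1 r.2 ∧ IsTy Γ r.2 := by
  simp only [infId, obind_eq_some] at h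
  obtain ⟨s, hs, a', ha, b', hb, ⟨⟩⟩ := h
  have hA := infTy_sound hi hΓ hs
  have h₁ := hc _ _ _ _ hΓ hA.eqTy.right ha
  have h₂ := hc _ _ _ _ hΓ hA.eqTy.right hb
  have h₃ := h₁.conv hA.eqTy.symm
  have h₄ := h₂.conv hA.eqTy.symm
  exact ⟨⟨hA.tm.id h₃.tm h₄.tm, hA.tm'.id h₁.tm' h₂.tm', hA.eq.idCongr h₃.eq h₄.eq⟩, .univ hΓ⟩

include hi in
theorem infRefl_sound {Γ a r} (hΓ : Der (.ctx Γ)) (h : infRefl a inf chk Γ = some r) :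
    Red Γ (.refl a) r.1 r.2 ∧ IsTy Γ r.2 := by
  simp only [infRefl, obind_eq_some] at h
  obtain ⟨s, hs, ⟨⟩⟩ := h
  obtain ⟨h₁, h₂⟩ := hi _ _ _ hΓ hs
  exact ⟨(Red.refl h₂ h₁).conv (h₂.eqRfl.id h₁ h₁), h₂.id h₁.tm' h₁.tm'⟩

include hc in
-- In the reflexivity case the tests make both endpoints equal to the normalised point, so the path
-- is replaced by `refl` at that point before the β-rule is used.
theorem idIndRed_sound {Γ A a b C c p t} (hΓ : Der (.ctx Γ)) (hT : IsTy Γ (.id A a b))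
    (hC : IsTy (.id (A.shift 1) (a.shift 1) (.var 0) :: A :: Γ) C)
    (h₁ : Der (.tm Γ c (C.inst₂ a (.refl a)))) (hp : Der (.tm Γ p (.id A a b)))
    (h : idIndRed A a b C c p chk Γ = some t) : Red Γ (.idInd C c p) t (C.inst₂ b p) := by
  obtain ⟨hA, ha, hb⟩ := hT.of_id
  simp only [idIndRed, obind_eq_some, bcase_eq, andb_eq_true] at h
  obtain ⟨h', a', ha', ⟨⟨h₂, h₃⟩, ⟨⟩⟩ | ⟨_, h⟩⟩ | ⟨_, ⟨⟩⟩ := h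
  · rw [of_isTag_refl h'] at hp ⊢
    have h₄ := hc _ _ _ _ hΓ hA ha'
    obtain rfl := eq_of_beq h₂
    obtain rfl := eq_of_beq h₃
    have h₅ := (Red.refl hA h₄).conv (hA.eqRfl.id h₄ h₄)
    have h₆ := Red.idInd hΓ hA ha ha hC.eqRfl h₁.red h₅
    have e := Red.eqTy_inst₂ hΓ hA ha hC ha.red h₅
    obtain ⟨i, hC⟩ := hC
    have h₇ := (hC.idBeta ha h₁).convEq' e.symm
    exact ⟨h₆.tm, h₁.conv' e.symm, h₆.eq.trans h₇⟩
  · cases h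
  · exact Red.idInd hΓ hA ha hb hC.eqRfl h₁.red hp.red

include hi hc in
theorem infIdInd_sound {Γ C c p r} (hΓ : Der (.ctx Γ))
    (h : infIdInd C c p inf chk Γ = some r) : Red Γ (.idInd C c p) r.1 r.2 ∧ IsTy Γ r.2 := by
  simp only [infIdInd, obind_eq_some, bcase_eq, at₂_eq, wk_eq] at h
  obtain ⟨⟨p', E⟩, hr, ⟨h', s, hs, S, hS, c', hc', T, hT, t, ht, ⟨⟩⟩ | ⟨_, h⟩⟩ := h
  · obtain ⟨h₁, h₂⟩ := hi _ _ _ hΓ hr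
    obtain ⟨A, a, b, rfl⟩ : ∃ A a b, E = .id A a b := ⟨_, _, _, of_isTag_id h'⟩
    obtain ⟨hA, ha, hb⟩ := h₂.of_id
    have hAΓ := hA.ctx_cons
    have hE : IsTy (A :: Γ) (.id (A.shift 1) (a.shift 1) (.var 0)) :=
      IsTy.id (IsTy.wk hAΓ hA) (Der.wk hAΓ ha) (.var hAΓ rfl)
    have hC := (infTy_sound hi hE.ctx_cons hs).eqTy
    have hl := ha.refl.red.ann hΓ (hA.id ha ha)
    have eS := Red.eqTy_inst₂ hΓ hA ha hC.right (ha.red.ann hΓ hA) hl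
    have eS' := eS.trans (nfTy_sound hi hΓ eS.right hS)
    have h₃ := hc _ _ _ _ hΓ eS'.right hc'
    have eC := Red.eqTy_inst₂' hΓ hC ha ha.refl
    have eT := Red.eqTy_inst₂ hΓ hA ha hC.right (hb.red.ann hΓ hA) (h₁.ann hΓ h₂)
    have eT' := eT.trans (nfTy_sound hi hΓ eT.right hT)
    have e₁ := Red.eqTy_inst₂' hΓ hC hb h₁.tm
    have e₂ := Red.eqTy_inst₂ hΓ hA ha hC.right hb.red h₁
    have h₄ := (Red.idInd hΓ hA ha hb hC (h₃.conv (eC.trans eS').symm) h₁).conv (e₁.trans e₂)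
    have h₅ := idIndRed_sound hc hΓ h₂ hC.right (h₃.conv eS'.symm).tm' h₁.tm' ht
    exact ⟨(h₄.trans h₅).conv (e₂.symm.trans eT'), eT'.right⟩
  · cases h

include hi hc in
theorem infStep_sound {t Γ r} (hΓ : Der (.ctx Γ)) (h : infStep t inf chk Γ = some r) :
    Red Γ t r.1 r.2 ∧ IsTy Γ r.2 := by
  cases t with
  | var n =>
    obtain ⟨A, hA, ⟨⟩⟩ := obind_eq_some.1 h
    rw [look_eq] at hA
    have e : A.lift (n + 1) 0 = A.shift (n + 1) := by rw [lift_eq, shift, rename_eq_subst]; rfl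
    exact ⟨e ▸ (Der.var hΓ hA).red, e ▸ isTy_of_getElem hΓ hA⟩
  | univ i => cases h; exact ⟨(Der.univ hΓ).red, .univ hΓ⟩
  | pi => exact infPi_sound (chk := chk) hi hΓ h
  | lam => exact infLam_sound hi hc hΓ h
  | app => exact infApp_sound hi hc hΓ h
  | sg => exact infSg_sound (chk := chk) hi hΓ h
  | pair => exact infPair_sound hi hc hΓ h
  | fst => exact infFst_sound hi hc hΓ h
  | snd => exact infSnd_sound hi hc hΓ h
  | sum => exact infSum_sound (chk := chk) hi hΓ h
  | inl => exact infInl_sound (chk := chk) hi hΓ h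
  | inr => exact infInr_sound (chk := chk) hi hΓ h
  | sumInd => exact infSumInd_sound hi hc hΓ h
  | zero => cases h; exact ⟨(Der.zero hΓ).red, .univ hΓ⟩
  | zeroInd => exact infZeroInd_sound hi hc hΓ h
  | one => cases h; exact ⟨(Der.one hΓ).red, .univ hΓ⟩
  | star => cases h; exact ⟨(Der.star hΓ).red, .one hΓ⟩
  | oneInd => exact infOneInd_sound hi hc hΓ h
  | id => exact infId_sound hi hc hΓ h
  | refl => exact infRefl_sound (chk := chk) hi hΓ h
  | idInd => exact infIdInd_sound hi hc hΓ h
  | funext i =>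
    obtain ⟨r, hr, ⟨⟩⟩ := obind_eq_some.1 h
    have e := (infTy_sound hi hΓ hr).eqTy
    exact ⟨(Der.funext hΓ).red.conv e, e.right⟩
  | ua i =>
    obtain ⟨r, hr, ⟨⟩⟩ := obind_eq_some.1 h
    have e := (infTy_sound hi hΓ hr).eqTy
    exact ⟨(Der.ua hΓ).red.conv e, e.right⟩
  | _ => cases h

include hi hc in
-- The nested pair is given a non-dependent type `P` found along the way. The claim is made for all
-- `s` equal to `t` at `P`, so that in the induction `s` can be a projection of the surrounding
-- pair.
theorem chkPath_sound {Γ T path t r} (hΓ : Der (.ctx Γ)) (hT : IsTy Γ T)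
    (h : chkPath inf chk Γ T path t = some r) :
    ∃ P, IsTy Γ P ∧ Der (.tm Γ t P) ∧ ∀ s, Red Γ s t P → Red Γ (applyPath path s) r T := by
  induction path generalizing t with
  | nil =>
    have := hc _ _ _ _ hΓ hT h
    exact ⟨T, hT, this.tm, fun s hs => hs.trans this⟩
  | cons b path ih =>
    obtain ⟨h', h⟩ | ⟨_, h⟩ := bcase_eq.1 h
    · obtain ⟨a₀, b₀, rfl⟩ : ∃ a b, t = .pair a b := ⟨_, _, of_isTag_pair h'⟩
      obtain ⟨rfl, h⟩ | ⟨rfl, h⟩ := bcase_eq.1 h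
      · obtain ⟨s, hs, h⟩ := obind_eq_some.1 h
        obtain ⟨h₁, h₂⟩ := hi _ _ _ hΓ hs
        obtain ⟨P, hP, h₃, h₄⟩ := ih h
        have hQ := h₂.sg (IsTy.wk h₂.ctx_cons hP)
        have e : ∀ u, (P.shift 1).inst u = P := shift_one_inst _
        have h₅ : Red Γ b₀ b₀ ((P.shift 1).inst a₀) := (e a₀).symm ▸ Der.red h₃
        refine ⟨_, hQ, (Red.pair hΓ hQ h₁.tm.red h₅).tm, fun u hu => h₄ _ ?_⟩
        have h₆ := Red.snd hΓ hQ hu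
        have h₇ := Red.snd_pair hΓ hQ h₁.tm h₅.tm
        rw [e] at h₆ h₇
        exact h₆.trans h₇
      · obtain ⟨s, hs, h⟩ := obind_eq_some.1 h
        obtain ⟨h₁, h₂⟩ := hi _ _ _ hΓ hs
        obtain ⟨P, hP, h₃, h₄⟩ := ih h
        have hQ := hP.sg (IsTy.wk hP.ctx_cons h₂)
        have h₅ : Red Γ b₀ b₀ ((s.2.shift 1).inst a₀) := (shift_one_inst _ _).symm ▸ h₁.tm.red
        exact ⟨_, hQ, (Red.pair hΓ hQ (Der.red h₃) h₅).tm, fun u hu => h₄ _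
          (hu.fst.trans (Red.fst_pair hQ.of_sg.2 h₃ h₅.tm))⟩
    · cases h

include hi hc in
theorem chkProj_sound {Γ T path t r} (hΓ : Der (.ctx Γ)) (hT : IsTy Γ T)
    (h : chkProj t inf chk Γ T path = some r) : Red Γ (applyPath path t) r T := by
  induction t generalizing path with
  | pair a b =>
    obtain ⟨P, hP, h₁, h₂⟩ := chkPath_sound hi hc hΓ hT h
    exact h₂ _ h₁.red
  | fst p ih => exact ih (path := false :: path) h
  | snd p ih => exact ih (path := true :: path) h
  | _ => cases h

include hi in
theorem chkInf_sound {Γ t T r} (hΓ : Der (.ctx Γ)) (h : chkInf t inf chk Γ T = some r) :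
    Red Γ t r T := by
  simp only [chkInf, obind_eq_some, bcase_eq] at h
  obtain ⟨s, hs, ⟨h, ⟨⟩⟩ | ⟨_, h⟩⟩ := h
  · exact subTy_sound h (hi _ _ _ hΓ hs).1
  · cases h

include hi hc in
theorem chkProjInf_sound {Γ t T r} (hΓ : Der (.ctx Γ)) (hT : IsTy Γ T)
    (h : chkProjInf t inf chk Γ T = some r) : Red Γ t r T := by
  obtain h | h := ocase_some h
  · exact chkProj_sound hi hc hΓ hT h
  · exact chkInf_sound (chk := chk) hi hΓ h

include hi hc in
theorem chkLam_sound {Γ A b T r} (hΓ : Der (.ctx Γ)) (hT : IsTy Γ T)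
    (h : chkLam A b inf chk Γ T = some r) : Red Γ (.lam A b) r T := by
  simp only [chkLam, obind_eq_some, bcase_eq] at h
  obtain ⟨h', s, hs, ⟨h₁, b', hb, h⟩ | ⟨_, h⟩⟩ | ⟨_, h⟩ := h
  · obtain ⟨A', B, rfl⟩ : ∃ A B, T = .pi A B := ⟨_, _, of_isTag_pi h'⟩
    have h₁ : s.1 = A' := eq_of_beq h₁
    have e := (infTy_sound hi hΓ hs).eqTy
    rw [h₁] at e
    have h₂ : Red _ b b' B := hc _ _ _ _ hT.of_pi.1.ctx_cons hT.of_pi.2 hb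
    exact (Red.lam e hT.of_pi.2 h₂).trans (etaLam_sound hc hΓ hT.of_pi.1 hT.of_pi.2 h₂.tm' h)
  · cases h
  · cases h

include hi hc in
theorem chkBeta_sound {Γ A b a T r} (hΓ : Der (.ctx Γ)) (hT : IsTy Γ T)
    (h : chkBeta A b a inf chk Γ T = some r) : Red Γ (.app (.lam A b) a) r T := by
  simp only [chkBeta, obind_eq_some, at₁_eq, wk_eq] at h
  obtain ⟨s, hs, a', ha, b', hb, h⟩ := h
  have h₁ := (infTy_sound hi hΓ hs).eqTy
  have h₂ := (hc _ _ _ _ hΓ h₁.right ha).ann hΓ h₁.right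
  have hT' := IsTy.wk h₁.right.ctx_cons hT
  have h₃ := Red.app_lam hΓ h₁ hT' (hc _ _ _ _ h₁.right.ctx_cons hT' hb) h₂
  rw [shift_one_inst] at h₃
  exact h₃.trans (nfTm_sound hc hΓ hT h₃.tm' h)

include hi hc in
theorem chkApp_sound {Γ f a T r} (hΓ : Der (.ctx Γ)) (hT : IsTy Γ T)
    (h : chkApp f a inf chk Γ T = some r) : Red Γ (.app f a) r T := by
  simp only [chkApp, bcase_eq, andb_eq_true] at h
  obtain ⟨⟨h', _⟩, h⟩ | ⟨_, h⟩ := h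
  · obtain h | h := ocase_some h
    · rw [of_isTag_lam h']
      exact chkBeta_sound hi hc hΓ hT h
    · exact chkInf_sound (chk := chk) hi hΓ h
  · exact chkInf_sound (chk := chk) hi hΓ h

include hi hc in
theorem chkPair_sound {Γ a b T r} (hΓ : Der (.ctx Γ)) (hT : IsTy Γ T)
    (h : chkPair a b inf chk Γ T = some r) : Red Γ (.pair a b) r T := by
  simp only [chkPair, obind_eq_some, bcase_eq, at₁_eq] at h
  obtain ⟨h', a', ha, B', hB, b', hb, h⟩ | ⟨_, h⟩ := h
  · obtain ⟨A, B, rfl⟩ : ∃ A B, T = .sg A B := ⟨_, _, of_isTag_sg h'⟩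
    have h₁ : Red Γ a a' A := hc _ _ _ _ hΓ hT.of_sg.1 ha
    have h₁' := h₁.ann hΓ hT.of_sg.1
    have e := Red.eqTy_inst hΓ hT.of_sg.1 hT.of_sg.2.eqRfl h₁'
    have e' := Red.eqTy_inst hΓ hT.of_sg.1 hT.of_sg.2.eqRfl h₁
    have eB : EqTy Γ _ B' := nfTy_sound hi hΓ e.right hB
    have h₂ := hc _ _ _ _ hΓ eB.right hb
    have h₃ := h₂.conv (e.trans eB).symm
    exact (Red.pair hΓ hT h₁ h₃).trans (etaPair_sound hc hΓ hT h₁.tm' (h₃.tm'.conv' e') h)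
  · cases h

include hi hc in
theorem chkStep_sound {t Γ T r} (hΓ : Der (.ctx Γ)) (hT : IsTy Γ T)
    (h : chkStep t inf chk Γ T = some r) : Red Γ t r T := by
  cases t with
  | lam => exact chkLam_sound hi hc hΓ hT h
  | app => exact chkApp_sound hi hc hΓ hT h
  | pair => exact chkPair_sound hi hc hΓ hT h
  | fst => exact chkProjInf_sound hi hc hΓ hT h
  | snd => exact chkProjInf_sound hi hc hΓ hT h
  | inl a =>
    obtain ⟨h', h⟩ | ⟨_, h⟩ := bcase_eq.1 h
    · obtain ⟨a', ha, ⟨⟩⟩ := obind_eq_some.1 h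
      rw [of_isTag_sum h'] at hT ⊢
      exact (hc _ _ _ _ hΓ hT.of_sum.1 ha).inl hT.of_sum.2
    · cases h
  | inr a =>
    obtain ⟨h', h⟩ | ⟨_, h⟩ := bcase_eq.1 h
    · obtain ⟨a', ha, ⟨⟩⟩ := obind_eq_some.1 h
      rw [of_isTag_sum h'] at hT ⊢
      exact (hc _ _ _ _ hΓ hT.of_sum.2 ha).inr hT.of_sum.1
    · cases h
  | refl a =>
    obtain ⟨h', h⟩ | ⟨_, h⟩ := bcase_eq.1 h
    · obtain ⟨a', ha, h⟩ := obind_eq_some.1 h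
      obtain ⟨h₀, ⟨⟩⟩ | ⟨_, h⟩ := bcase_eq.1 h
      · obtain ⟨h₁, h₂⟩ := andb_eq_true.1 h₀
        rw [of_isTag_id h'] at hT ⊢
        have hA := hT.of_id.1
        have h₃ := hc _ _ _ _ hΓ hA ha
        rw [← Tm.eq_of_beq h₁, ← Tm.eq_of_beq h₂]
        exact (Red.refl hA h₃).conv (hA.eqRfl.id h₃ h₃)
      · cases h
    · cases h
  | _ => exact chkInf_sound (chk := chk) hi hΓ h

end

/-- At depth zero every query fails; each further level is sound relative to the previous one. -/
theorem run_sound (n : ℕ) : InfSound (run n).1 ∧ ChkSound (run n).2 := by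
  induction n with
  | zero =>
    constructor
    · rintro Γ t r _ ⟨⟩
    · rintro Γ t T r _ _ ⟨⟩
  | succ n ih =>
    exact ⟨fun Γ t r hΓ h => infStep_sound ih.1 ih.2 hΓ h,
      fun Γ t T r hΓ hT h => chkStep_sound ih.1 ih.2 hΓ hT h⟩

theorem der_of_hasType {t A : Tm} (h : hasType t A = true) : Der (.tm [] t A) := by
  rw [hasType] at h
  rcases h' : infTy (run 1000).1 [] A with _ | r
  · rw [h'] at h; cases h
  · rw [h'] at h
    change ocase ((run 1000).2 [] t r.1) false (fun _ => true) = true at h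
    rcases h'' : (run 1000).2 [] t r.1 with _ | s
    · rw [h''] at h; cases h
    · have e := (infTy_sound (run_sound _).1 .nil h').eqTy
      exact ((run_sound _).2 _ _ _ _ .nil e.right h'').tm.conv' e.symm

/-! ## Universe lifting -/

namespace Tm

/-- Raise all universes by `k` levels. -/
def raise (k : ℕ) : Tm → Tm
  | var n => var n
  | univ i => univ (k + i)
  | pi A B => pi (A.raise k) (B.raise k)
  | lam A b => lam (A.raise k) (b.raise k)
  | app f a => app (f.raise k) (a.raise k)
  | sg A B => sg (A.raise k) (B.raise k)
  | pair a b => pair (a.raise k) (b.raise k)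
  | fst p => fst (p.raise k)
  | snd p => snd (p.raise k)
  | sum A B => sum (A.raise k) (B.raise k)
  | inl a => inl (a.raise k)
  | inr b => inr (b.raise k)
  | sumInd C c d e => sumInd (C.raise k) (c.raise k) (d.raise k) (e.raise k)
  | zero => zero
  | zeroInd C e => zeroInd (C.raise k) (e.raise k)
  | one => one
  | star => star
  | oneInd C c e => oneInd (C.raise k) (c.raise k) (e.raise k)
  | nat => nat
  | natZero => natZero
  | natSucc n => natSucc (n.raise k)
  | natInd C c d e => natInd (C.raise k) (c.raise k) (d.raise k) (e.raise k)
  | id A a b => id (A.raise k) (a.raise k) (b.raise k)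
  | refl a => refl (a.raise k)
  | idInd C c p => idInd (C.raise k) (c.raise k) (p.raise k)
  | trunc A => trunc (A.raise k)
  | tr a => tr (a.raise k)
  | squash x y => squash (x.raise k) (y.raise k)
  | truncRec B h f e => truncRec (B.raise k) (h.raise k) (f.raise k) (e.raise k)
  | funext i => funext (k + i)
  | ua i => ua (k + i)

theorem raise_rename (k : ℕ) (t : Tm) (ρ : ℕ → ℕ) :
    (t.rename ρ).raise k = (t.raise k).rename ρ := by
  induction t generalizing ρ <;> simp_all [rename, raise]

theorem raise_shift (k n : ℕ) (t : Tm) : (t.shift n).raise k = (t.raise k).shift n :=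
  raise_rename _ _ _

theorem raise_scons (k : ℕ) (a : Tm) (σ : ℕ → Tm) :
    (fun n => (scons a σ n).raise k) = scons (a.raise k) fun n => (σ n).raise k := by
  funext n
  cases n <;> rfl

theorem raise_up (k : ℕ) (σ : ℕ → Tm) :
    (fun n => (up σ n).raise k) = up fun n => (σ n).raise k := by
  simp only [up, raise_scons, raise_shift, raise]

theorem raise_subst (k : ℕ) (t : Tm) (σ : ℕ → Tm) :
    (t.subst σ).raise k = (t.raise k).subst fun n => (σ n).raise k := by
  induction t generalizing σ <;> simp_all [subst, raise, ← raise_up]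

theorem raise_inst (k : ℕ) (B a : Tm) : (B.inst a).raise k = (B.raise k).inst (a.raise k) := by
  simp only [inst, raise_subst, raise_scons, raise]

theorem raise_inst₂ (k : ℕ) (B a b : Tm) :
    (B.inst₂ a b).raise k = (B.raise k).inst₂ (a.raise k) (b.raise k) := by
  simp only [inst₂, raise_subst, raise_scons, raise]

theorem raise_instUnder (k n : ℕ) (B a : Tm) :
    (B.instUnder n a).raise k = (B.raise k).instUnder n (a.raise k) := by
  simp only [instUnder, raise_subst, raise_scons, raise]

end Tm

/-- Raise all universes by `k` levels. -/
def Judgement.raise (k : ℕ) : Judgement → Judgement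
  | .ctx Γ => .ctx (Γ.map (Tm.raise k))
  | .tm Γ t A => .tm (Γ.map (Tm.raise k)) (t.raise k) (A.raise k)
  | .eq Γ t u A => .eq (Γ.map (Tm.raise k)) (t.raise k) (u.raise k) (A.raise k)

/-- The level occurs in the axioms only through universes, so raising merely renames it. -/
theorem funextType_raise (k i : ℕ) : (funextType i 0).raise k = funextType (k + i) 0 := rfl

theorem uaType_raise (k i : ℕ) : (uaType i 0).raise k = uaType (k + i) 0 := rfl

theorem Sb.raise {Γ Δ : Ctx} {σ : ℕ → Tm} (k : ℕ)
    (h : ∀ (n : ℕ) (B : Tm), Δ[n]? = some B →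
      Der (Judgement.raise k (.tm Γ (σ n) ((B.shift (n + 1)).subst σ)))) :
    Sb (Γ.map (Tm.raise k)) (fun n => (σ n).raise k) (Δ.map (Tm.raise k)) := by
  intro n B hB
  rw [List.getElem?_map, Option.map_eq_some_iff] at hB
  obtain ⟨B, hB, rfl⟩ := hB
  have := h n B hB
  rwa [Judgement.raise, raise_subst, raise_shift] at this

-- Every rule is uniform in the universe levels: only differences of levels matter, and the base
-- types inhabit every universe. The syntactic operations in the rules commute with raising.
set_option linter.unusedSimpArgs false in
theorem Der.raise {J : Judgement} (k : ℕ) (h : Der J) : Der (J.raise k) := by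
  induction h
  case substTm hΓ hσ h =>
    have := (Sb.raise k hσ).tm hΓ h
    rwa [← raise_subst, ← raise_subst] at this
  case substEq hΓ hσ h =>
    have := (Sb.raise k hσ).eq hΓ h
    rwa [← raise_subst, ← raise_subst, ← raise_subst] at this
  case var n A _ hn hΓ =>
    have := Der.var (n := n) (A := A.raise k) hΓ (by rw [List.getElem?_map, hn]; rfl)
    rwa [← raise_shift] at this
  case nil => exact .nil
  case cons h₁ => exact .cons h₁
  case conv h₁ h₂ => exact .conv h₁ h₂
  case convEq h₁ h₂ => exact .convEq h₁ h₂
  case rfl h₁ => exact .rfl h₁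
  case symm h₁ => exact .symm h₁
  case trans h₁ h₂ => exact .trans h₁ h₂
  -- With the sum written as `k + i`, raising commutes with successor by computation.
  case univ h₁ => exact .univ h₁
  case cumul h₁ => exact .cumul h₁
  case cumulEq h₁ => exact .cumulEq h₁
  case pi h₁ h₂ => exact .pi h₁ h₂
  case lam h₁ h₂ => exact .lam h₁ h₂
  case app h₁ h₂ =>
    simp only [Judgement.raise, Tm.raise, List.map_cons, raise_shift, raise_inst, raise_inst₂,
      raise_instUnder, funextType_raise, uaType_raise] at *
    exact .app h₁ h₂
  case piBeta h₁ h₂ =>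
    simp only [Judgement.raise, Tm.raise, List.map_cons, raise_shift, raise_inst, raise_inst₂,
      raise_instUnder, funextType_raise, uaType_raise] at *
    exact .piBeta h₁ h₂
  case piEta h₁ =>
    simp only [Judgement.raise, Tm.raise, List.map_cons, raise_shift, raise_inst, raise_inst₂,
      raise_instUnder, funextType_raise, uaType_raise] at *
    exact .piEta h₁
  case piCongr h₁ h₂ => exact .piCongr h₁ h₂
  case lamCongr h₁ h₂ => exact .lamCongr h₁ h₂
  case appCongr h₁ h₂ =>
    simp only [Judgement.raise, Tm.raise, List.map_cons, raise_shift, raise_inst, raise_inst₂,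
      raise_instUnder, funextType_raise, uaType_raise] at *
    exact .appCongr h₁ h₂
  case sg h₁ h₂ => exact .sg h₁ h₂
  case pair h₁ h₂ h₃ =>
    simp only [Judgement.raise, Tm.raise, List.map_cons, raise_shift, raise_inst, raise_inst₂,
      raise_instUnder, funextType_raise, uaType_raise] at *
    exact .pair h₁ h₂ h₃
  case fst h₁ => exact .fst h₁
  case snd h₁ =>
    simp only [Judgement.raise, Tm.raise, List.map_cons, raise_shift, raise_inst, raise_inst₂,
      raise_instUnder, funextType_raise, uaType_raise] at *
    exact .snd h₁
  case fstBeta h₁ h₂ h₃ =>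
    simp only [Judgement.raise, Tm.raise, List.map_cons, raise_shift, raise_inst, raise_inst₂,
      raise_instUnder, funextType_raise, uaType_raise] at *
    exact .fstBeta h₁ h₂ h₃
  case sndBeta h₁ h₂ h₃ =>
    simp only [Judgement.raise, Tm.raise, List.map_cons, raise_shift, raise_inst, raise_inst₂,
      raise_instUnder, funextType_raise, uaType_raise] at *
    exact .sndBeta h₁ h₂ h₃
  case sgEta h₁ => exact .sgEta h₁
  case sgCongr h₁ h₂ => exact .sgCongr h₁ h₂
  case pairCongr h₁ h₂ h₃ =>
    simp only [Judgement.raise, Tm.raise, List.map_cons, raise_shift, raise_inst, raise_inst₂,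
      raise_instUnder, funextType_raise, uaType_raise] at *
    exact .pairCongr h₁ h₂ h₃
  case fstCongr h₁ => exact .fstCongr h₁
  case sndCongr h₁ =>
    simp only [Judgement.raise, Tm.raise, List.map_cons, raise_shift, raise_inst, raise_inst₂,
      raise_instUnder, funextType_raise, uaType_raise] at *
    exact .sndCongr h₁
  case sum h₁ h₂ => exact .sum h₁ h₂
  case inl h₁ h₂ => exact .inl h₁ h₂
  case inr h₁ h₂ => exact .inr h₁ h₂
  case sumInd h₁ h₂ h₃ h₄ =>
    simp only [Judgement.raise, Tm.raise, List.map_cons, raise_shift, raise_inst, raise_inst₂,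
      raise_instUnder, funextType_raise, uaType_raise] at *
    exact .sumInd h₁ h₂ h₃ h₄
  case inlBeta h₁ h₂ h₃ h₄ =>
    simp only [Judgement.raise, Tm.raise, List.map_cons, raise_shift, raise_inst, raise_inst₂,
      raise_instUnder, funextType_raise, uaType_raise] at *
    exact .inlBeta h₁ h₂ h₃ h₄
  case inrBeta h₁ h₂ h₃ h₄ =>
    simp only [Judgement.raise, Tm.raise, List.map_cons, raise_shift, raise_inst, raise_inst₂,
      raise_instUnder, funextType_raise, uaType_raise] at *
    exact .inrBeta h₁ h₂ h₃ h₄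
  case sumCongr h₁ h₂ => exact .sumCongr h₁ h₂
  case inlCongr h₁ h₂ => exact .inlCongr h₁ h₂
  case inrCongr h₁ h₂ => exact .inrCongr h₁ h₂
  case sumIndCongr h₁ h₂ h₃ h₄ =>
    simp only [Judgement.raise, Tm.raise, List.map_cons, raise_shift, raise_inst, raise_inst₂,
      raise_instUnder, funextType_raise, uaType_raise] at *
    exact .sumIndCongr h₁ h₂ h₃ h₄
  case zero h₁ => exact .zero h₁
  case zeroInd h₁ h₂ =>
    simp only [Judgement.raise, Tm.raise, List.map_cons, raise_shift, raise_inst, raise_inst₂,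
      raise_instUnder, funextType_raise, uaType_raise] at *
    exact .zeroInd h₁ h₂
  case zeroIndCongr h₁ h₂ =>
    simp only [Judgement.raise, Tm.raise, List.map_cons, raise_shift, raise_inst, raise_inst₂,
      raise_instUnder, funextType_raise, uaType_raise] at *
    exact .zeroIndCongr h₁ h₂
  case one h₁ => exact .one h₁
  case star h₁ => exact .star h₁
  case oneInd h₁ h₂ h₃ =>
    simp only [Judgement.raise, Tm.raise, List.map_cons, raise_shift, raise_inst, raise_inst₂,
      raise_instUnder, funextType_raise, uaType_raise] at *
    exact .oneInd h₁ h₂ h₃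
  case oneBeta h₁ h₂ =>
    simp only [Judgement.raise, Tm.raise, List.map_cons, raise_shift, raise_inst, raise_inst₂,
      raise_instUnder, funextType_raise, uaType_raise] at *
    exact .oneBeta h₁ h₂
  case oneIndCongr h₁ h₂ h₃ =>
    simp only [Judgement.raise, Tm.raise, List.map_cons, raise_shift, raise_inst, raise_inst₂,
      raise_instUnder, funextType_raise, uaType_raise] at *
    exact .oneIndCongr h₁ h₂ h₃
  case nat h₁ => exact .nat h₁
  case natZero h₁ => exact .natZero h₁
  case natSucc h₁ => exact .natSucc h₁
  case natInd h₁ h₂ h₃ h₄ =>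
    simp only [Judgement.raise, Tm.raise, List.map_cons, raise_shift, raise_inst, raise_inst₂,
      raise_instUnder, funextType_raise, uaType_raise] at *
    exact .natInd h₁ h₂ h₃ h₄
  case natZeroBeta h₁ h₂ h₃ =>
    simp only [Judgement.raise, Tm.raise, List.map_cons, raise_shift, raise_inst, raise_inst₂,
      raise_instUnder, funextType_raise, uaType_raise] at *
    exact .natZeroBeta h₁ h₂ h₃
  case natSuccBeta h₁ h₂ h₃ h₄ =>
    simp only [Judgement.raise, Tm.raise, List.map_cons, raise_shift, raise_inst, raise_inst₂,
      raise_instUnder, funextType_raise, uaType_raise] at *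
    exact .natSuccBeta h₁ h₂ h₃ h₄
  case natSuccCongr h₁ => exact .natSuccCongr h₁
  case natIndCongr h₁ h₂ h₃ h₄ =>
    simp only [Judgement.raise, Tm.raise, List.map_cons, raise_shift, raise_inst, raise_inst₂,
      raise_instUnder, funextType_raise, uaType_raise] at *
    exact .natIndCongr h₁ h₂ h₃ h₄
  case id h₁ h₂ h₃ => exact .id h₁ h₂ h₃
  case refl h₁ => exact .refl h₁
  case idInd h₁ h₂ h₃ h₄ =>
    simp only [Judgement.raise, Tm.raise, List.map_cons, raise_shift, raise_inst, raise_inst₂,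
      raise_instUnder, funextType_raise, uaType_raise] at *
    exact .idInd h₁ h₂ h₃ h₄
  case idBeta h₁ h₂ h₃ =>
    simp only [Judgement.raise, Tm.raise, List.map_cons, raise_shift, raise_inst, raise_inst₂,
      raise_instUnder, funextType_raise, uaType_raise] at *
    exact .idBeta h₁ h₂ h₃
  case idCongr h₁ h₂ h₃ => exact .idCongr h₁ h₂ h₃
  case reflCongr h₁ => exact .reflCongr h₁
  case idIndCongr h₁ h₂ h₃ h₄ =>
    simp only [Judgement.raise, Tm.raise, List.map_cons, raise_shift, raise_inst, raise_inst₂,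
      raise_instUnder, funextType_raise, uaType_raise] at *
    exact .idIndCongr h₁ h₂ h₃ h₄
  case trunc h₁ => exact .trunc h₁
  case tr h₁ => exact .tr h₁
  case squash h₁ h₂ => exact .squash h₁ h₂
  case truncRec h₁ h₂ h₃ h₄ =>
    simp only [Judgement.raise, Tm.raise, List.map_cons, raise_shift, raise_inst, raise_inst₂,
      raise_instUnder, funextType_raise, uaType_raise] at *
    exact .truncRec h₁ h₂ h₃ h₄
  case truncBeta h₁ h₂ h₃ h₄ =>
    simp only [Judgement.raise, Tm.raise, List.map_cons, raise_shift, raise_inst, raise_inst₂,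
      raise_instUnder, funextType_raise, uaType_raise] at *
    exact .truncBeta h₁ h₂ h₃ h₄
  case truncCongr h₁ => exact .truncCongr h₁
  case trCongr h₁ => exact .trCongr h₁
  case squashCongr h₁ h₂ => exact .squashCongr h₁ h₂
  case truncRecCongr h₁ h₂ h₃ h₄ =>
    simp only [Judgement.raise, Tm.raise, List.map_cons, raise_shift, raise_inst, raise_inst₂,
      raise_instUnder, funextType_raise, uaType_raise] at *
    exact .truncRecCongr h₁ h₂ h₃ h₄
  case funext h₁ =>
    simp only [Judgement.raise, Tm.raise, List.map_cons, raise_shift, raise_inst, raise_inst₂,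
      raise_instUnder, funextType_raise, uaType_raise] at *
    exact .funext h₁
  case ua h₁ =>
    simp only [Judgement.raise, Tm.raise, List.map_cons, raise_shift, raise_inst, raise_inst₂,
      raise_instUnder, funextType_raise, uaType_raise] at *
    exact .ua h₁

theorem IsInhabited.raise {A A' : Exp} (k : ℕ) (h : IsInhabited A) (e : (A 0).raise k = A' 0) :
    IsInhabited A' := by
  obtain ⟨t, ht⟩ := h
  exact ⟨t.raise k, e ▸ ht.raise k⟩

/-- The two terms agree by computation, because `i + 0` reduces to `i`. -/
theorem derivativeAdjunction_raise (i : ℕ) :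
    (derivativeAdjunction 0 0).raise i = derivativeAdjunction i 0 := rfl

/-! ## Paths and equivalences -/

/-- A type annotation. -/
def the (A a : Exp) : Exp := lam A (fun x => x) ⬝ₑ a

/-- Transport along `p`. -/
def tp (P : Exp → Exp) (t p : Exp) : Exp := idInd (fun y _ => P y) t p

/-- The inverse of a path `p : a = b`. -/
def sym (A a p : Exp) : Exp := tp (fun y => eq A y a) (refl a) p

/-- The composite of `p : a = b` and `q : b = c`. -/
def trans (A a p q : Exp) : Exp := tp (fun y => eq A a y) p q

/-- The path `f a = f b` for `p : a = b`. -/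
def ap (B : Exp) (f : Exp → Exp) (a p : Exp) : Exp := tp (fun y => eq B (f a) (f y)) (refl (f a)) p

def isProp (A : Exp) : Exp := pi A fun x => pi A fun y => eq A x y

def idEquiv (A : Exp) : Exp := pair (lam A fun x => x) (idIsEquiv A)

def homotopy (A B f g : Exp) : Exp := pi A fun x => eq B (f ⬝ₑ x) (g ⬝ₑ x)

/-- Only the function from homotopies to paths is recorded here; `homotopyInd` uses the axiom in
full. -/
def FunextInv : Exp :=
  pi (univ 0) fun A => pi (arr A (univ 0)) fun B =>
  pi (pi A fun x => B ⬝ₑ x) fun f => pi (pi A fun x => B ⬝ₑ x) fun g =>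
    arr (pi A fun x => eq (B ⬝ₑ x) (f ⬝ₑ x) (g ⬝ₑ x)) (eq (pi A fun x => B ⬝ₑ x) f g)

def funextInv : Exp :=
  lam (univ 0) fun A => lam (arr A (univ 0)) fun B =>
  lam (pi A fun x => B ⬝ₑ x) fun f => lam (pi A fun x => B ⬝ₑ x) fun g =>
  lam (pi A fun x => eq (B ⬝ₑ x) (f ⬝ₑ x) (g ⬝ₑ x)) fun h =>
    inv ((fun _ => Tm.funext 0) ⬝ₑ A ⬝ₑ B ⬝ₑ f ⬝ₑ g) h

def EquivInd : Exp :=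
  pi (univ 0) fun A => pi (pi (univ 0) fun B => arr (equiv A B) (univ 1)) fun C =>
    arr (C ⬝ₑ A ⬝ₑ idEquiv A) (pi (univ 0) fun B => pi (equiv A B) fun e => C ⬝ₑ B ⬝ₑ e)

/-- By univalence `e` is the image of a path `p : A = B`. Path induction proves the claim for the
image of `p`, and transport along the path from this image to `e` finishes. -/
def equivInd : Exp :=
  lam (univ 0) fun A => lam (pi (univ 0) fun B => arr (equiv A B) (univ 1)) fun C =>
  lam (C ⬝ₑ A ⬝ₑ idEquiv A) fun c => lam (univ 0) fun B => lam (equiv A B) fun e =>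
    tp (fun e => C ⬝ₑ B ⬝ₑ e)
      (idInd (fun B p => C ⬝ₑ B ⬝ₑ idInd (fun B' _ => equiv A B') (idEquiv A) p) c
        (fst (fst ((fun _ => Tm.ua 0) ⬝ₑ A ⬝ₑ B ⬝ₑ e))))
      (snd (fst ((fun _ => Tm.ua 0) ⬝ₑ A ⬝ₑ B ⬝ₑ e)))

/-- Pairs with second components in propositions are equal if the first components are. -/
def SgPath : Exp :=
  pi (univ 0) fun A => pi (arr A (univ 0)) fun B => arr (pi A fun a => isProp (B ⬝ₑ a))
    (pi (sg A fun a => B ⬝ₑ a) fun u => pi (sg A fun a => B ⬝ₑ a) fun v =>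
      arr (eq A (fst u) (fst v)) (eq (sg A fun a => B ⬝ₑ a) u v))

/-- The claim is generalised over all second components `y` before path induction on `p`, so no
transport of second components appears. -/
def sgPath : Exp :=
  lam (univ 0) fun A => lam (arr A (univ 0)) fun B => lam (pi A fun a => isProp (B ⬝ₑ a)) fun h =>
  lam (sg A fun a => B ⬝ₑ a) fun u => lam (sg A fun a => B ⬝ₑ a) fun v =>
  lam (eq A (fst u) (fst v)) fun p =>
    tp (fun a => pi (B ⬝ₑ a) fun y => eq (sg A fun a => B ⬝ₑ a) u (pair a y))
      (lam (B ⬝ₑ fst u) fun y => tp (fun z => eq (sg A fun a => B ⬝ₑ a) u (pair (fst u) z)) (refl u)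
        (h ⬝ₑ fst u ⬝ₑ snd u ⬝ₑ y)) p ⬝ₑ snd v

def IsPropOfIsContr : Exp := pi (univ 0) fun A => arr (isContr A) (isProp A)

def isPropOfIsContr : Exp :=
  lam (univ 0) fun A => lam (isContr A) fun c => lam A fun x => lam A fun y =>
    tp (fun t => eq A t y) (snd c ⬝ₑ y) (snd c ⬝ₑ x)

/-- `p⁻¹ ∘ p = refl`. -/
def symTrans (A x p : Exp) : Exp :=
  idInd (fun z q => eq (eq A z z) (tp (fun t => eq A t z) q q) (refl z)) (refl (refl x)) p

/-- If `k` is a family of maps `x = y → x = y` all of whose values are equal, then paths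
from `x` are equal. -/
def pathsEq (A x : Exp) (k : Exp → Exp → Exp) (c : Exp → Exp → Exp → Exp) (y p q : Exp) : Exp :=
  -- `T z r` is `k z r` preceded by the inverse of `k x refl`. It equals `r` by path induction, and
  -- it does not depend on `r` up to the paths `c`; hence `p = T y p = T y q = q`.
  let T : Exp → Exp → Exp := fun z r => tp (fun t => eq A t z) (k z r) (k x (refl x))
  let M : Exp → Exp := fun p =>
    idInd (fun z r => eq (eq A x z) (T z r) r) (symTrans A x (k x (refl x))) p
  tp (fun r => eq (eq A x y) r q)
    (tp (fun r => eq (eq A x y) (tp (fun t => eq A t y) r (k x (refl x))) q) (M q) (c y q p)) (M p)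

def IsSetOfIsProp : Exp :=
  pi (univ 0) fun A => arr (isProp A) (pi A fun x => pi A fun y => isProp (eq A x y))

def isSetOfIsProp : Exp :=
  lam (univ 0) fun A => lam (isProp A) fun h => lam A fun x => lam A fun y =>
  lam (eq A x y) fun p => lam (eq A x y) fun q =>
    pathsEq A x (fun z _ => h ⬝ₑ x ⬝ₑ z) (fun z _ _ => refl (h ⬝ₑ x ⬝ₑ z)) y p q

def IsPropIsContr : Exp := pi (univ 0) fun A => isProp (isContr A)

/-- The centres are joined by the contraction. The contractions are compared pointwise, in a type of
paths of a contractible type, which is therefore a set. -/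
def isPropIsContr (funextInv sgPath isPropOfIsContr isSetOfIsProp : Exp) : Exp :=
  lam (univ 0) fun A => lam (isContr A) fun u => lam (isContr A) fun v =>
    sgPath ⬝ₑ A ⬝ₑ (lam A fun a => pi A fun b => eq A a b) ⬝ₑ
      (lam A fun a => lam (pi A fun b => eq A a b) fun x => lam (pi A fun b => eq A a b) fun y =>
        funextInv ⬝ₑ A ⬝ₑ (lam A fun b => eq A a b) ⬝ₑ x ⬝ₑ y ⬝ₑ lam A fun b =>
          isSetOfIsProp ⬝ₑ A ⬝ₑ (isPropOfIsContr ⬝ₑ A ⬝ₑ u) ⬝ₑ a ⬝ₑ b ⬝ₑ (x ⬝ₑ b) ⬝ₑ (y ⬝ₑ b)) ⬝ₑ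
      u ⬝ₑ v ⬝ₑ (snd u ⬝ₑ fst v)

def IsPropIsEquiv : Exp :=
  pi (univ 0) fun A => pi (univ 0) fun B => pi (arr A B) fun f => isProp (isEquiv A B f)

def isPropIsEquiv (funextInv isPropIsContr : Exp) : Exp :=
  lam (univ 0) fun A => lam (univ 0) fun B => lam (arr A B) fun f =>
  lam (isEquiv A B f) fun u => lam (isEquiv A B f) fun v =>
    funextInv ⬝ₑ B ⬝ₑ (lam B fun y => isContr (fiber A B f y)) ⬝ₑ u ⬝ₑ v ⬝ₑ lam B fun y =>
      isPropIsContr ⬝ₑ fiber A B f y ⬝ₑ (u ⬝ₑ y) ⬝ₑ (v ⬝ₑ y)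

def EquivPath : Exp :=
  pi (univ 0) fun A => pi (univ 0) fun B => pi (equiv A B) fun u => pi (equiv A B) fun v =>
    arr (homotopy A B (fst u) (fst v)) (eq (equiv A B) u v)

def equivPath (funextInv sgPath isPropIsEquiv : Exp) : Exp :=
  lam (univ 0) fun A => lam (univ 0) fun B => lam (equiv A B) fun u => lam (equiv A B) fun v =>
  lam (homotopy A B (fst u) (fst v)) fun h =>
    sgPath ⬝ₑ arr A B ⬝ₑ (lam (arr A B) fun f => isEquiv A B f) ⬝ₑ (isPropIsEquiv ⬝ₑ A ⬝ₑ B) ⬝ₑ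
      u ⬝ₑ v ⬝ₑ (funextInv ⬝ₑ A ⬝ₑ (lam A fun _ => B) ⬝ₑ fst u ⬝ₑ fst v ⬝ₑ h)

def EquivOfHomotopy : Exp :=
  pi (univ 0) fun A => pi (univ 0) fun B => pi (arr A B) fun f => pi (arr A B) fun g =>
    arr (isEquiv A B f) (arr (homotopy A B f g) (isEquiv A B g))

def equivOfHomotopy (funextInv : Exp) : Exp :=
  lam (univ 0) fun A => lam (univ 0) fun B => lam (arr A B) fun f => lam (arr A B) fun g =>
  lam (isEquiv A B f) fun e => lam (homotopy A B f g) fun h =>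
    tp (fun g => isEquiv A B g) e (funextInv ⬝ₑ A ⬝ₑ (lam A fun _ => B) ⬝ₑ f ⬝ₑ g ⬝ₑ h)

def IsPropNeg : Exp := pi (univ 0) fun A => isProp (neg A)

def isPropNeg (funextInv : Exp) : Exp :=
  lam (univ 0) fun A => lam (neg A) fun x => lam (neg A) fun y =>
    funextInv ⬝ₑ A ⬝ₑ (lam A fun _ => zero) ⬝ₑ x ⬝ₑ y ⬝ₑ lam A fun a =>
      zeroInd (fun _ => eq zero (x ⬝ₑ a) (y ⬝ₑ a)) (x ⬝ₑ a)

def IsPropIsIsolated : Exp := pi (univ 0) fun A => pi A fun a => isProp (isIsolated A a)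

/-- Paths from an isolated point are equal. -/
def isolatedPaths (A a h y p q : Exp) : Exp :=
  -- Hedberg's argument: `K` returns the path produced by the decision, and uses the given path only
  -- to refute a negative answer. Its values are thus equal by cases on the decision.
  let K : Exp → Exp → Exp → Exp := fun z r d =>
    sumInd (fun _ => eq A a z) (fun q => q) (fun n => zeroInd (fun _ => eq A a z) (n ⬝ₑ r)) d
  pathsEq A a (fun z r => K z r (h ⬝ₑ z))
    (fun y p q => sumInd (fun d => eq (eq A a y) (K y p d) (K y q d)) (fun q' => refl q')
      (fun n => zeroInd (fun _ => eq (eq A a y)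
        (K y p (the (dec (eq A a y)) (inr n))) (K y q (the (dec (eq A a y)) (inr n)))) (n ⬝ₑ p))
      (h ⬝ₑ y)) y p q

/-- Two decisions are compared by cases. Positive ones agree by `isolatedPaths`, negative ones
because negations are propositions, and mixed cases are contradictory. -/
def isPropIsIsolated (funextInv isPropNeg : Exp) : Exp :=
  lam (univ 0) fun A => lam A fun a => lam (isIsolated A a) fun u => lam (isIsolated A a) fun v =>
    funextInv ⬝ₑ A ⬝ₑ (lam A fun b => dec (eq A a b)) ⬝ₑ u ⬝ₑ v ⬝ₑ lam A fun b =>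
      let X := eq A a b
      sumInd (fun d => eq (dec X) d (v ⬝ₑ b))
        (fun p => sumInd (fun d => eq (dec X) (inl p) d)
          (fun q => ap (dec X) inl p (isolatedPaths A a u b p q))
          (fun n => zeroInd (fun _ => eq (dec X) (inl p) (inr n)) (n ⬝ₑ p)) (v ⬝ₑ b))
        (fun n => sumInd (fun d => eq (dec X) (inr n) d)
          (fun q => zeroInd (fun _ => eq (dec X) (inr n) (inl q)) (n ⬝ₑ q))
          (fun m => ap (dec X) inr n (isPropNeg ⬝ₑ X ⬝ₑ n ⬝ₑ m)) (v ⬝ₑ b))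
        (u ⬝ₑ b)

def EquivOfInverse : Exp :=
  pi (univ 0) fun A => pi (univ 0) fun B => pi (arr A B) fun f => pi (arr B A) fun g =>
    arr (pi B fun b => eq B (f ⬝ₑ (g ⬝ₑ b)) b)
      (arr (pi A fun a => eq A (g ⬝ₑ (f ⬝ₑ a)) a) (isEquiv A B f))

/-- `refl = p ∘ p⁻¹`. -/
def transSym (A a p : Exp) : Exp :=
  idInd (fun _ q => eq (eq A a a) (refl a) (trans A a q (sym A a q))) (refl (refl a)) p

/-- No triangle identity is required. The maps `s` and `r` exhibit `f x = y` as a retract of `g y =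
x`, so the fibre over `y` is a retract of the singleton of points `x` with `g y = x`, which is
contractible. The correction by `ε` at `f x` in `W` makes the composite of `s` and `r` the identity.
-/
def equivOfInverse : Exp :=
  lam (univ 0) fun A => lam (univ 0) fun B => lam (arr A B) fun f => lam (arr B A) fun g =>
  lam (pi B fun b => eq B (f ⬝ₑ (g ⬝ₑ b)) b) fun ε =>
  lam (pi A fun a => eq A (g ⬝ₑ (f ⬝ₑ a)) a) fun η => lam B fun y =>
    let W : Exp → Exp → Exp → Exp := fun y x m =>
      tp (fun b => eq B b y) (tp (fun t => eq B (f ⬝ₑ t) y) (ε ⬝ₑ y) m) (ε ⬝ₑ (f ⬝ₑ x))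
    let r : Exp → Exp → Exp → Exp := fun y x q =>
      W y x (trans A (g ⬝ₑ y) q (sym A (g ⬝ₑ (f ⬝ₑ x)) (η ⬝ₑ x)))
    let s : Exp → Exp → Exp := fun x p => tp (fun y => eq A (g ⬝ₑ y) x) (η ⬝ₑ x) p
    let rs : Exp → Exp → Exp := fun x p =>
      idInd (fun y p => eq (eq B (f ⬝ₑ x) y) (r y x (s x p)) p)
        (tp (fun m => eq (eq B (f ⬝ₑ x) (f ⬝ₑ x)) (W (f ⬝ₑ x) x m) (refl (f ⬝ₑ x)))
          (symTrans B (f ⬝ₑ (g ⬝ₑ (f ⬝ₑ x))) (ε ⬝ₑ (f ⬝ₑ x)))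
          (transSym A (g ⬝ₑ (f ⬝ₑ x)) (η ⬝ₑ x))) p
    let c := pair (g ⬝ₑ y) (r y (g ⬝ₑ y) (refl (g ⬝ₑ y)))
    let F := fiber A B f y
    pair c (lam F fun z =>
      tp (fun p => eq F c (pair (fst z) p))
        (idInd (fun x q => eq F c (pair x (r y x q))) (refl c) (s (fst z) (snd z)))
        (rs (fst z) (snd z)))

/-! ## Proofs of the propositions inside the structure maps -/

/-- Equivalence induction on `g`: composition with the identity is `f` by β and η. -/
def compE (equivInd : Exp) : Exp :=
  lam (univ 0) fun A => lam (univ 0) fun B => lam (univ 0) fun C =>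
  lam (arr A B) fun f => lam (arr B C) fun g => lam (isEquiv A B f) fun ef =>
  lam (isEquiv B C g) fun eg =>
    equivInd ⬝ₑ B ⬝ₑ (lam (univ 0) fun C => lam (equiv B C) fun g =>
      isEquiv A C (lam A fun a => fst g ⬝ₑ (f ⬝ₑ a))) ⬝ₑ ef ⬝ₑ C ⬝ₑ pair g eg

/-- Two equivalence inductions reduce to the sum of two identities. This is only homotopic to the
identity, because coproducts have no judgmental η. -/
def sumE (equivInd equivOfHomotopy : Exp) : Exp :=
  lam (univ 0) fun A => lam (univ 0) fun B => lam (univ 0) fun A' => lam (univ 0) fun B' =>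
  lam (arr A A') fun f => lam (arr B B') fun g => lam (isEquiv A A' f) fun ef =>
  lam (isEquiv B B' g) fun eg =>
    let S := sum A B
    let j := sumMap A B A B (lam A fun a => a) (lam B fun b => b)
    equivInd ⬝ₑ A ⬝ₑ (lam (univ 0) fun A' => lam (equiv A A') fun f =>
        isEquiv S (sum A' B') (sumMap A B A' B' (fst f) g)) ⬝ₑ
      (equivInd ⬝ₑ B ⬝ₑ (lam (univ 0) fun B' => lam (equiv B B') fun g =>
          isEquiv S (sum A B') (sumMap A B A B' (lam A fun a => a) (fst g))) ⬝ₑ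
        (equivOfHomotopy ⬝ₑ S ⬝ₑ S ⬝ₑ (lam S fun x => x) ⬝ₑ j ⬝ₑ idIsEquiv S ⬝ₑ lam S fun x =>
          sumInd (fun x => eq S x (j ⬝ₑ x)) (fun a => refl (inl a)) (fun b => refl (inr b)) x) ⬝ₑ
        B' ⬝ₑ pair g eg) ⬝ₑ
      A' ⬝ₑ pair f ef

/-- For the identity equivalence the chosen inverse is judgmentally the identity. The same fact
proves `isoE` and `neqE`. -/
def invE (equivInd : Exp) : Exp :=
  lam (univ 0) fun A => lam (univ 0) fun B => lam (arr A B) fun f => lam (isEquiv A B f) fun e =>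
    equivInd ⬝ₑ A ⬝ₑ (lam (univ 0) fun B => lam (equiv A B) fun f => isEquiv B A (invMap B (snd f)))
      ⬝ₑ idIsEquiv A ⬝ₑ B ⬝ₑ pair f e

def isoE (equivInd : Exp) : Exp :=
  lam (univ 0) fun A => lam (univ 0) fun B => lam (arr A B) fun f => lam (isEquiv A B f) fun e =>
    equivInd ⬝ₑ A ⬝ₑ (lam (univ 0) fun B => lam (equiv A B) fun f => pi B fun b =>
        arr (isIsolated B b) (isIsolated A (inv (snd f) b))) ⬝ₑ
      (lam A fun a => lam (isIsolated A a) fun h => h) ⬝ₑ B ⬝ₑ pair f e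

def neqE (equivInd : Exp) : Exp :=
  lam (univ 0) fun A => lam (univ 0) fun B => lam (arr A B) fun f => lam (isEquiv A B f) fun e =>
    equivInd ⬝ₑ A ⬝ₑ (lam (univ 0) fun B => lam (equiv A B) fun f => pi B fun b => pi A fun a =>
        arr (neg (eq A (inv (snd f) b) a)) (neg (eq B b (fst f ⬝ₑ a)))) ⬝ₑ
      (lam A fun b => lam A fun a => lam (neg (eq A b a)) fun h => h) ⬝ₑ B ⬝ₑ pair f e

/-- Elements of `A ∖ a` are equal if the underlying elements of `A` are. -/
def removePath (sgPath isPropNeg A a x y p : Exp) : Exp :=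
  sgPath ⬝ₑ A ⬝ₑ (lam A fun b => neg (eq A a b)) ⬝ₑ
    (lam A fun b => isPropNeg ⬝ₑ eq A a b) ⬝ₑ x ⬝ₑ y ⬝ₑ p

def removeE (equivInd equivOfHomotopy sgPath isPropNeg neqE : Exp) : Exp :=
  lam (univ 0) fun A => lam (univ 0) fun B => lam (arr A B) fun f => lam (isEquiv A B f) fun e =>
    equivInd ⬝ₑ A ⬝ₑ (lam (univ 0) fun B => lam (equiv A B) fun f => pi B fun b =>
        isEquiv (remove A (inv (snd f) b)) (remove B b) (removeMap neqE A B (fst f) (snd f) b)) ⬝ₑ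
      (lam A fun a =>
        let R := remove A a
        let m := removeMap neqE A A (lam A fun x => x) (idIsEquiv A) a
        -- Here `neqE` is arbitrary, so the restricted identity need not fix second components
        -- judgmentally; that these are negations gives a homotopy to the identity.
        equivOfHomotopy ⬝ₑ R ⬝ₑ R ⬝ₑ (lam R fun x => x) ⬝ₑ m ⬝ₑ idIsEquiv R ⬝ₑ lam R fun x =>
          removePath sgPath isPropNeg A a x (m ⬝ₑ x) (refl (fst x))) ⬝ₑ B ⬝ₑ pair f e

/-- `nothing ≠ inl a`. -/
def nothingNe (A a : Exp) : Exp :=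
  lam (eq (sum A one) nothing (inl a)) fun p =>
    tp (fun x => sumInd (fun _ => univ 0) (fun _ => zero) (fun _ => one) x) star p

def nothingE : Exp :=
  lam (univ 0) fun A => lam (sum A one) fun x =>
    sumInd (fun x => dec (eq (sum A one) nothing x)) (fun a => inr (nothingNe A a))
      (fun b => inl (oneInd (fun y => eq (sum A one) nothing (inr y)) (refl nothing) b)) x

def minusE (equivOfInverse sgPath isPropNeg : Exp) : Exp :=
  lam (univ 0) fun A =>
    let M := sum A one
    let R := remove M nothing
    let g := lam A fun a => the R (pair (inl a) (nothingNe A a))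
    -- One composite is the identity by computation. For the other, the point is split into cases,
    -- and the case `inr` contradicts its being distinct from `nothing`.
    equivOfInverse ⬝ₑ R ⬝ₑ A ⬝ₑ minusMap A ⬝ₑ g ⬝ₑ (lam A fun a => refl a) ⬝ₑ lam R fun x =>
      sumInd (fun z => pi (neg (eq M nothing z)) fun n =>
          eq R (g ⬝ₑ (minusMap A ⬝ₑ the R (pair z n))) (pair z n))
        (fun a => lam (neg (eq M nothing (inl a))) fun n =>
          removePath sgPath isPropNeg M nothing (pair (inl a) (nothingNe A a)) (pair (inl a) n)
            (refl (inl a)))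
        (fun b => lam (neg (eq M nothing (inr b))) fun n =>
          zeroInd (fun _ => eq R (g ⬝ₑ (minusMap A ⬝ₑ the R (pair (inr b) n))) (pair (inr b) n))
            (n ⬝ₑ oneInd (fun y => eq M nothing (inr y)) (refl nothing) b))
        (fst x) ⬝ₑ snd x

def replaceE (equivOfInverse sgPath isPropNeg : Exp) : Exp :=
  lam (univ 0) fun A => lam A fun a => lam (isIsolated A a) fun h =>
    let R := remove A a
    let M := sum R one
    let F : Exp → Exp := fun x => sumInd (fun _ => A) (fun y => fst y) (fun _ => a) x
    -- The inverse depends on the decision whether `a = b`, taken as a separate argument `d`, so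
    -- that both composites can be analysed by induction on `d`.
    let G : Exp → Exp → Exp := fun b d =>
      sumInd (fun _ => M) (fun _ => nothing) (fun n => inl (pair b n)) d
    equivOfInverse ⬝ₑ M ⬝ₑ A ⬝ₑ replaceMap A a ⬝ₑ (lam A fun b => G b (h ⬝ₑ b)) ⬝ₑ
      (lam A fun b => sumInd (fun d => eq A (F (G b d)) b) (fun p => p) (fun _ => refl b)
        (h ⬝ₑ b)) ⬝ₑ
      lam M fun x => sumInd (fun x => eq M (G (F x) (h ⬝ₑ F x)) x)
        (fun y => sumInd (fun d => eq M (G (fst y) d) (inl y))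
          (fun p => zeroInd (fun _ => eq M nothing (inl y)) (snd y ⬝ₑ p))
          (fun n => ap M inl (pair (fst y) n)
            (removePath sgPath isPropNeg A a (pair (fst y) n) y (refl (fst y)))) (h ⬝ₑ fst y))
        (fun u => sumInd (fun d => eq M (G a d) (inr u))
          (fun _ => oneInd (fun u => eq M nothing (inr u)) (refl nothing) u)
          (fun n => zeroInd (fun _ => eq M (inl (pair a n)) (inr u)) (n ⬝ₑ refl a)) (h ⬝ₑ a)) x

/-! ## Paths between cartesian morphisms -/

def RemovePath : Exp :=
  pi (univ 0) fun A => pi A fun a => pi (remove A a) fun x => pi (remove A a) fun y =>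
    arr (eq A (fst x) (fst y)) (eq (remove A a) x y)

def removePath' (sgPath isPropNeg : Exp) : Exp :=
  lam (univ 0) fun A => lam A fun a => lam (remove A a) fun x => lam (remove A a) fun y =>
  lam (eq A (fst x) (fst y)) fun p => removePath sgPath isPropNeg A a x y p

/-- `Π (S : Type) (P : S → Type), B (S ▷ P)`. -/
def piCon (B : Con → Exp) : Exp :=
  pi (univ 0) fun S => pi (arr S (univ 0)) fun P => B ⟨S, fun s => P ⬝ₑ s⟩

def lamCon (B : Con → Exp) : Exp :=
  lam (univ 0) fun S => lam (arr S (univ 0)) fun P => B ⟨S, fun s => P ⬝ₑ s⟩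

/-- The type of families of equivalences of positions over `f`. -/
def psEquiv (F G : Con) (f : Exp → Exp) : Exp := pi F.sh fun s => equiv (G.ps (f s)) (F.ps s)

/-- Cartesian morphisms with the same map on shapes are equal if the maps on positions are. -/
def CartPath : Exp :=
  piCon fun F => piCon fun G => pi (arr F.sh G.sh) fun f =>
  pi (psEquiv F G fun s => f ⬝ₑ s) fun u => pi (psEquiv F G fun s => f ⬝ₑ s) fun v =>
    arr (pi F.sh fun s => pi (G.ps (f ⬝ₑ s)) fun q =>
        eq (F.ps s) (fst (u ⬝ₑ s) ⬝ₑ q) (fst (v ⬝ₑ s) ⬝ₑ q))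
      (eq (cart F G) (pair f u) (pair f v))

def cartPath (funextInv equivPath : Exp) : Exp :=
  lamCon fun F => lamCon fun G => lam (arr F.sh G.sh) fun f =>
  lam (psEquiv F G fun s => f ⬝ₑ s) fun u => lam (psEquiv F G fun s => f ⬝ₑ s) fun v =>
  lam (pi F.sh fun s => pi (G.ps (f ⬝ₑ s)) fun q =>
      eq (F.ps s) (fst (u ⬝ₑ s) ⬝ₑ q) (fst (v ⬝ₑ s) ⬝ₑ q)) fun h =>
    tp (fun v => eq (cart F G) (pair f u) (pair f v)) (refl (pair f u))
      (funextInv ⬝ₑ F.sh ⬝ₑ (lam F.sh fun s => equiv (G.ps (f ⬝ₑ s)) (F.ps s)) ⬝ₑ u ⬝ₑ v ⬝ₑ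
        lam F.sh fun s => equivPath ⬝ₑ G.ps (f ⬝ₑ s) ⬝ₑ F.ps s ⬝ₑ (u ⬝ₑ s) ⬝ₑ (v ⬝ₑ s) ⬝ₑ (h ⬝ₑ s))

/-- The constant homotopy. -/
def reflHomotopy (A f : Exp) : Exp := lam A fun x => refl (f ⬝ₑ x)

def HomotopyInd : Exp :=
  pi (univ 0) fun A => pi (univ 0) fun B => pi (arr A B) fun f =>
  pi (pi (arr A B) fun g => arr (homotopy A B f g) (univ 0)) fun C =>
    arr (C ⬝ₑ f ⬝ₑ reflHomotopy A f)
      (pi (arr A B) fun g => pi (homotopy A B f g) fun h => C ⬝ₑ g ⬝ₑ h)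

/-- The analogue of equivalence induction for function extensionality: the homotopy is replaced by
the one induced by a path, and path induction applies. -/
def homotopyInd : Exp :=
  lam (univ 0) fun A => lam (univ 0) fun B => lam (arr A B) fun f =>
  lam (pi (arr A B) fun g => arr (homotopy A B f g) (univ 0)) fun C =>
  lam (C ⬝ₑ f ⬝ₑ reflHomotopy A f) fun c => lam (arr A B) fun g => lam (homotopy A B f g) fun h =>
    let e := (fun _ => Tm.funext 0) ⬝ₑ A ⬝ₑ (lam A fun _ => B) ⬝ₑ f ⬝ₑ g ⬝ₑ h
    tp (fun h => C ⬝ₑ g ⬝ₑ h)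
      (idInd (fun g p => C ⬝ₑ g ⬝ₑ tp (fun g => homotopy A B f g) (reflHomotopy A f) p) c
        (fst (fst e)))
      (snd (fst e))

/-- Cartesian morphisms are equal if the maps on shapes are equal and the maps on positions
agree. -/
def CartPathSh : Exp :=
  piCon fun F => piCon fun G => pi (arr F.sh G.sh) fun f => pi (arr F.sh G.sh) fun g =>
  pi (homotopy F.sh G.sh f g) fun r =>
  pi (psEquiv F G fun s => f ⬝ₑ s) fun u => pi (psEquiv F G fun s => g ⬝ₑ s) fun v =>
    arr (pi F.sh fun s => pi (G.ps (f ⬝ₑ s)) fun q =>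
        eq (F.ps s) (fst (u ⬝ₑ s) ⬝ₑ q) (fst (v ⬝ₑ s) ⬝ₑ tp G.ps q (r ⬝ₑ s)))
      (eq (cart F G) (pair f u) (pair g v))

/-- By homotopy induction the maps on shapes coincide. The transport in the hypothesis then computes
away and `cartPath` remains. -/
def cartPathSh (homotopyInd cartPath : Exp) : Exp :=
  lamCon fun F => lamCon fun G => lam (arr F.sh G.sh) fun f => lam (arr F.sh G.sh) fun g =>
  lam (homotopy F.sh G.sh f g) fun r =>  lam (psEquiv F G fun s => f ⬝ₑ s) fun u =>
    homotopyInd ⬝ₑ F.sh ⬝ₑ G.sh ⬝ₑ f ⬝ₑ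
      (lam (arr F.sh G.sh) fun g => lam (homotopy F.sh G.sh f g) fun r =>
        pi (psEquiv F G fun s => g ⬝ₑ s) fun v => arr (pi F.sh fun s => pi (G.ps (f ⬝ₑ s)) fun q =>
            eq (F.ps s) (fst (u ⬝ₑ s) ⬝ₑ q) (fst (v ⬝ₑ s) ⬝ₑ tp G.ps q (r ⬝ₑ s)))
          (eq (cart F G) (pair f u) (pair g v))) ⬝ₑ
      (cartPath ⬝ₑ F.sh ⬝ₑ (lam F.sh F.ps) ⬝ₑ G.sh ⬝ₑ (lam G.sh G.ps) ⬝ₑ f ⬝ₑ u) ⬝ₑ g ⬝ₑ r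

/-- Cartesian morphisms to a derivative are equal if the underlying maps on shapes coincide, the
isolated points are equal and the maps on positions agree. -/
def CartPathDer : Exp :=
  piCon fun F => piCon fun G => pi (arr F.sh G.sh) fun f =>
  pi (pi F.sh fun s => isolated (G.ps (f ⬝ₑ s))) fun a =>
  pi (pi F.sh fun s => isolated (G.ps (f ⬝ₑ s))) fun b =>
  arr (pi F.sh fun s => eq (G.ps (f ⬝ₑ s)) (fst (a ⬝ₑ s)) (fst (b ⬝ₑ s))) <|
  pi (pi F.sh fun s => equiv (remove (G.ps (f ⬝ₑ s)) (fst (a ⬝ₑ s))) (F.ps s)) fun u =>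
  pi (pi F.sh fun s => equiv (remove (G.ps (f ⬝ₑ s)) (fst (b ⬝ₑ s))) (F.ps s)) fun v =>
  arr (pi F.sh fun s => pi (G.ps (f ⬝ₑ s)) fun q =>
      pi (neg (eq (G.ps (f ⬝ₑ s)) (fst (a ⬝ₑ s)) q)) fun n =>
      pi (neg (eq (G.ps (f ⬝ₑ s)) (fst (b ⬝ₑ s)) q)) fun n' =>
        eq (F.ps s) (fst (u ⬝ₑ s) ⬝ₑ pair q n) (fst (v ⬝ₑ s) ⬝ₑ pair q n')) <|
    eq (cart F (der G)) (pair (lam F.sh fun s => pair (f ⬝ₑ s) (a ⬝ₑ s)) u)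
      (pair (lam F.sh fun s => pair (f ⬝ₑ s) (b ⬝ₑ s)) v)

/-- Being isolated is a proposition, so `r` gives a path between the families of isolated points,
along which path induction is performed. The hypothesis ranges over all proofs `n` and `n'` of
distinctness and therefore involves no transport. -/
def cartPathDer (funextInv sgPath equivPath isPropIsIsolated : Exp) : Exp :=
  lamCon fun F => lamCon fun G => lam (arr F.sh G.sh) fun f =>
  let A : Exp → Exp := fun s => G.ps (f ⬝ₑ s)
  let E : Exp → Exp := fun a => pi F.sh fun s => equiv (remove (A s) (fst (a ⬝ₑ s))) (F.ps s)
  lam (pi F.sh fun s => isolated (A s)) fun a => lam (pi F.sh fun s => isolated (A s)) fun b =>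
  lam (pi F.sh fun s => eq (A s) (fst (a ⬝ₑ s)) (fst (b ⬝ₑ s))) fun r => lam (E a) fun u =>
  let H : Exp → Exp → Exp := fun b v => pi F.sh fun s => pi (A s) fun q =>
    pi (neg (eq (A s) (fst (a ⬝ₑ s)) q)) fun n => pi (neg (eq (A s) (fst (b ⬝ₑ s)) q)) fun n' =>
      eq (F.ps s) (fst (u ⬝ₑ s) ⬝ₑ pair q n) (fst (v ⬝ₑ s) ⬝ₑ pair q n')
  let m : Exp → Exp → Exp := fun b v => pair (lam F.sh fun s => pair (f ⬝ₑ s) (b ⬝ₑ s)) v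
  tp (fun b => pi (E b) fun v => arr (H b v) (eq (cart F (der G)) (m a u) (m b v)))
    (lam (E a) fun v => lam (H a v) fun h =>
      tp (fun v => eq (cart F (der G)) (m a u) (m a v)) (refl (m a u))
        (funextInv ⬝ₑ F.sh ⬝ₑ (lam F.sh fun s => equiv (remove (A s) (fst (a ⬝ₑ s))) (F.ps s)) ⬝ₑ
          u ⬝ₑ v ⬝ₑ lam F.sh fun s => equivPath ⬝ₑ remove (A s) (fst (a ⬝ₑ s)) ⬝ₑ F.ps s ⬝ₑ
            (u ⬝ₑ s) ⬝ₑ (v ⬝ₑ s) ⬝ₑ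
              lam (remove (A s) (fst (a ⬝ₑ s))) fun y => h ⬝ₑ s ⬝ₑ fst y ⬝ₑ snd y ⬝ₑ snd y))
    (funextInv ⬝ₑ F.sh ⬝ₑ (lam F.sh fun s => isolated (A s)) ⬝ₑ a ⬝ₑ b ⬝ₑ lam F.sh fun s =>
      sgPath ⬝ₑ A s ⬝ₑ (lam (A s) fun p => isIsolated (A s) p) ⬝ₑ (isPropIsIsolated ⬝ₑ A s) ⬝ₑ
        (a ⬝ₑ s) ⬝ₑ (b ⬝ₑ s) ⬝ₑ (r ⬝ₑ s))

/-! The same for maps on positions and proofs that they are equivalences that are given separately. -/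

/-- The type of families of maps of positions over `f`. -/
def psMap (F G : Con) (f : Exp → Exp) : Exp := pi F.sh fun s => arr (G.ps (f s)) (F.ps s)

/-- The type of proofs that all maps in the family `k` are equivalences. -/
def psIsEquiv (F G : Con) (f : Exp → Exp) (k : Exp) : Exp :=
  pi F.sh fun s => isEquiv (G.ps (f s)) (F.ps s) (k ⬝ₑ s)

def psPair (F : Con) (k e : Exp) : Exp := lam F.sh fun s => pair (k ⬝ₑ s) (e ⬝ₑ s)

def MorPath : Exp :=
  piCon fun F => piCon fun G => pi (arr F.sh G.sh) fun f =>
  let P := fun s => f ⬝ₑ s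
  pi (psMap F G P) fun k => pi (psIsEquiv F G P k) fun d =>
  pi (psMap F G P) fun l => pi (psIsEquiv F G P l) fun e =>
    arr (pi F.sh fun s => pi (G.ps (f ⬝ₑ s)) fun q => eq (F.ps s) (k ⬝ₑ s ⬝ₑ q) (l ⬝ₑ s ⬝ₑ q))
      (eq (cart F G) (pair f (psPair F k d)) (pair f (psPair F l e)))

def morPath (cartPath : Exp) : Exp :=
  lamCon fun F => lamCon fun G => lam (arr F.sh G.sh) fun f =>
  let P := fun s => f ⬝ₑ s
  lam (psMap F G P) fun k => lam (psIsEquiv F G P k) fun d =>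
  lam (psMap F G P) fun l => lam (psIsEquiv F G P l) fun e =>
    cartPath ⬝ₑ F.sh ⬝ₑ (lam F.sh F.ps) ⬝ₑ G.sh ⬝ₑ (lam G.sh G.ps) ⬝ₑ f ⬝ₑ psPair F k d ⬝ₑ
      psPair F l e

def MorPathSh : Exp :=
  piCon fun F => piCon fun G => pi (arr F.sh G.sh) fun f => pi (arr F.sh G.sh) fun g =>
  pi (homotopy F.sh G.sh f g) fun r =>
  pi (psMap F G fun s => f ⬝ₑ s) fun k => pi (psIsEquiv F G (fun s => f ⬝ₑ s) k) fun d =>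
  pi (psMap F G fun s => g ⬝ₑ s) fun l => pi (psIsEquiv F G (fun s => g ⬝ₑ s) l) fun e =>
    arr (pi F.sh fun s => pi (G.ps (f ⬝ₑ s)) fun q =>
        eq (F.ps s) (k ⬝ₑ s ⬝ₑ q) (l ⬝ₑ s ⬝ₑ tp G.ps q (r ⬝ₑ s)))
      (eq (cart F G) (pair f (psPair F k d)) (pair g (psPair F l e)))

def morPathSh (cartPathSh : Exp) : Exp :=
  lamCon fun F => lamCon fun G => lam (arr F.sh G.sh) fun f => lam (arr F.sh G.sh) fun g =>
  lam (homotopy F.sh G.sh f g) fun r =>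
  lam (psMap F G fun s => f ⬝ₑ s) fun k => lam (psIsEquiv F G (fun s => f ⬝ₑ s) k) fun d =>
  lam (psMap F G fun s => g ⬝ₑ s) fun l => lam (psIsEquiv F G (fun s => g ⬝ₑ s) l) fun e =>
    cartPathSh ⬝ₑ F.sh ⬝ₑ (lam F.sh F.ps) ⬝ₑ G.sh ⬝ₑ (lam G.sh G.ps) ⬝ₑ f ⬝ₑ g ⬝ₑ r ⬝ₑ
      psPair F k d ⬝ₑ psPair F l e

/-- `B f a i b j r k d l e`, for morphisms to `∂ G` with shapes `f`, isolated points `a` and `b`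
and maps on positions `k` and `l`. -/
def bindDer (b : Exp → (Exp → Exp) → Exp) (F G : Con)
    (B : Exp → Exp → Exp → Exp → Exp → Exp → Exp → Exp → Exp → Exp → Exp) : Exp :=
  b (arr F.sh G.sh) fun f =>
  let A : Exp → Exp := fun s => G.ps (f ⬝ₑ s)
  b (pi F.sh A) fun a => b (pi F.sh fun s => isIsolated (A s) (a ⬝ₑ s)) fun i =>
  b (pi F.sh A) fun a' => b (pi F.sh fun s => isIsolated (A s) (a' ⬝ₑ s)) fun i' =>
  b (pi F.sh fun s => eq (A s) (a ⬝ₑ s) (a' ⬝ₑ s)) fun r =>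
  let K : Exp → Exp := fun a => pi F.sh fun s => arr (remove (A s) (a ⬝ₑ s)) (F.ps s)
  let D : Exp → Exp → Exp := fun a k =>
    pi F.sh fun s => isEquiv (remove (A s) (a ⬝ₑ s)) (F.ps s) (k ⬝ₑ s)
  b (K a) fun k => b (D a k) fun d => b (K a') fun l => b (D a' l) fun e =>
    B f a i a' i' r k d l e

def MorPathDer : Exp :=
  piCon fun F => piCon fun G => bindDer pi F G fun f a i a' i' _ k d l e =>
  let A : Exp → Exp := fun s => G.ps (f ⬝ₑ s)
  let m : Exp → Exp → Exp → Exp → Exp := fun a i k d =>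
    pair (lam F.sh fun s => pair (f ⬝ₑ s) (pair (a ⬝ₑ s) (i ⬝ₑ s))) (psPair F k d)
  arr (pi F.sh fun s => pi (A s) fun q =>
      pi (neg (eq (A s) (a ⬝ₑ s) q)) fun n => pi (neg (eq (A s) (a' ⬝ₑ s) q)) fun n' =>
        eq (F.ps s) (k ⬝ₑ s ⬝ₑ pair q n) (l ⬝ₑ s ⬝ₑ pair q n')) <|
    eq (cart F (der G)) (m a i k d) (m a' i' l e)

def morPathDer (cartPathDer : Exp) : Exp :=
  lamCon fun F => lamCon fun G => bindDer lam F G fun f a i a' i' r k d l e =>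
    cartPathDer ⬝ₑ F.sh ⬝ₑ (lam F.sh F.ps) ⬝ₑ G.sh ⬝ₑ (lam G.sh G.ps) ⬝ₑ f ⬝ₑ psPair F a i ⬝ₑ
      psPair F a' i' ⬝ₑ r ⬝ₑ psPair F k d ⬝ₑ psPair F l e

/-! ## The laws -/

/-- The laws are established for every choice of the side proofs. These are then variables, which do
not compute, and independence of the choice comes for free. -/
def piProofs (B : Proofs → Exp) : Exp :=
  pi (compEType 0) fun compE => pi (sumEType 0) fun sumE => pi (invEType 0) fun invE =>
  pi (isoEType 0) fun isoE => pi (neqEType 0) fun neqE => pi (removeEType 0 neqE) fun removeE =>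
  pi (nothingEType 0) fun nothingE => pi (minusEType 0) fun minusE =>
  pi (replaceEType 0) fun replaceE =>
    B ⟨compE, sumE, invE, isoE, neqE, removeE, nothingE, minusE, replaceE⟩

def lamProofs (B : Proofs → Exp) : Exp :=
  lam (compEType 0) fun compE => lam (sumEType 0) fun sumE => lam (invEType 0) fun invE =>
  lam (isoEType 0) fun isoE => lam (neqEType 0) fun neqE => lam (removeEType 0 neqE) fun removeE =>
  lam (nothingEType 0) fun nothingE => lam (minusEType 0) fun minusE =>
  lam (replaceEType 0) fun replaceE =>
    B ⟨compE, sumE, invE, isoE, neqE, removeE, nothingE, minusE, replaceE⟩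

def lamCont (B : Con → Exp) : Exp := lam (cont 0) fun F => B (Con.of F)

def lamCart (F G : Con) (B : Mor → Exp) : Exp := lam (cart F G) fun f => B (Mor.of f)

/-- The path between morphisms `f` and `g` with the same map on shapes given by `h`. -/
def Mor.path (morPath : Exp) (F G : Con) (f g : Mor) (h : Exp → Exp → Exp) : Exp :=
  morPath ⬝ₑ F.sh ⬝ₑ lam F.sh F.ps ⬝ₑ G.sh ⬝ₑ lam G.sh G.ps ⬝ₑ lam F.sh f.sh ⬝ₑ
    lam F.sh (f.psFun G) ⬝ₑ lam F.sh f.pe ⬝ₑ lam F.sh (g.psFun G) ⬝ₑ lam F.sh g.pe ⬝ₑ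
    lam F.sh fun s => lam (G.ps (f.sh s)) fun q => h s q

/-- The path between morphisms `f` and `g` given by `r` and `h`. -/
def Mor.pathSh (morPathSh : Exp) (F G : Con) (f g : Mor) (r : Exp → Exp) (h : Exp → Exp → Exp) :
    Exp :=
  morPathSh ⬝ₑ F.sh ⬝ₑ lam F.sh F.ps ⬝ₑ G.sh ⬝ₑ lam G.sh G.ps ⬝ₑ lam F.sh f.sh ⬝ₑ lam F.sh g.sh ⬝ₑ
    lam F.sh r ⬝ₑ
    lam F.sh (f.psFun G) ⬝ₑ lam F.sh f.pe ⬝ₑ lam F.sh (g.psFun G) ⬝ₑ lam F.sh g.pe ⬝ₑ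
    lam F.sh fun s => lam (G.ps (f.sh s)) fun q => h s q

/-- The path between morphisms `f` and `g` from `F` to `∂ G` given by `r` and `h`. -/
def Mor.pathDer (morPathDer : Exp) (F G : Con) (f g : Mor) (r : Exp → Exp)
    (h : Exp → Exp → Exp → Exp → Exp) : Exp :=
  let A : Exp → Exp := fun s => G.ps (fst (f.sh s))
  morPathDer ⬝ₑ F.sh ⬝ₑ lam F.sh F.ps ⬝ₑ G.sh ⬝ₑ lam G.sh G.ps ⬝ₑ lam F.sh (fun s => fst (f.sh s)) ⬝ₑ
    lam F.sh (fun s => fst (snd (f.sh s))) ⬝ₑ lam F.sh (fun s => snd (snd (f.sh s))) ⬝ₑ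
    lam F.sh (fun s => fst (snd (g.sh s))) ⬝ₑ lam F.sh (fun s => snd (snd (g.sh s))) ⬝ₑ lam F.sh r ⬝ₑ
    lam F.sh (f.psFun (der G)) ⬝ₑ lam F.sh f.pe ⬝ₑ lam F.sh (g.psFun (der G)) ⬝ₑ lam F.sh g.pe ⬝ₑ
    lam F.sh fun s => lam (A s) fun q =>
      lam (neg (eq (A s) (fst (snd (f.sh s))) q)) fun n =>
      lam (neg (eq (A s) (fst (snd (g.sh s))) q)) fun n' => h s q n n'

/-- `f (f⁻¹ b) = b`. -/
def invRight (e b : Exp) : Exp := snd (fst (e ⬝ₑ b))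

/-- `f⁻¹ b = a` for `p : f a = b`. -/
def invEq (A e b a p : Exp) : Exp :=
  idInd (fun z _ => eq A (inv e b) (fst z)) (refl (inv e b)) (snd (e ⬝ₑ b) ⬝ₑ pair a p)

namespace Proofs

variable (w : Proofs)

/-- Both sides have the same maps on shapes and positions by computation; only the proofs of being
an equivalence differ, as in the associativity law. -/
def unitLawsProof (morPath : Exp) : Exp :=
  lamCont fun F => lamCont fun G => lamCart F G fun f =>
    pair (Mor.path morPath F G (w.comp F G G (idMor G) f) f fun s q => refl (f.ps s q))
      (Mor.path morPath F G (w.comp F F G f (idMor F)) f fun s q => refl (f.ps s q))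

def assocProof (morPath : Exp) : Exp :=
  lamCont fun F => lamCont fun G => lamCont fun H => lamCont fun K =>
  lamCart F G fun f => lamCart G H fun g => lamCart H K fun h =>
    Mor.path morPath F K (w.comp F H K h (w.comp F G H g f)) (w.comp F G K (w.comp G H K h g) f)
      fun s q => refl (f.ps s (g.ps (f.sh s) (h.ps (g.sh (f.sh s)) q)))

/-- `∂ id = id`, for any proof that the identity map is an equivalence. -/
def derIdFor : Exp :=
  piCont 0 fun F => pi (pi F.sh fun s => isEquiv (F.ps s) (F.ps s) (lam (F.ps s) fun q => q)) fun e =>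
    eqMor (der F) (der F) (w.derMap F F { idMor F with pe := fun s => e ⬝ₑ s }) (idMor (der F))

/-- With `e` a variable, the chosen preimage of a point does not compute to the point, and `invEq`
supplies the path. The complements agree on underlying points. -/
def derIdForProof (morPathDer removePath : Exp) : Exp :=
  lamCont fun F =>
  lam (pi F.sh fun s => isEquiv (F.ps s) (F.ps s) (lam (F.ps s) fun q => q)) fun e =>
    let m := w.derMap F F { idMor F with pe := fun s => e ⬝ₑ s }
    Mor.pathDer morPathDer (der F) F m (idMor (der F))
      (fun x => invEq (F.ps (fst x)) (e ⬝ₑ fst x) (fst (snd x)) (fst (snd x)) (refl (fst (snd x))))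
      fun x q n n' =>
        removePath ⬝ₑ F.ps (fst x) ⬝ₑ fst (snd x) ⬝ₑ m.ps x (pair q n) ⬝ₑ pair q n' ⬝ₑ refl q

/-- The isolated points agree because the preimage under a composite is the preimage of the
preimage; uniqueness of preimages reduces this to the two right-inverse laws. -/
def derCompProof (morPathDer removePath : Exp) : Exp :=
  lamCont fun F => lamCont fun G => lamCont fun H => lamCart F G fun f => lamCart G H fun g =>
    let c := w.comp F G H g f
    let m := w.derMap F H c
    let n := w.comp (der F) (der G) (der H) (w.derMap G H g) (w.derMap F G f)
    Mor.pathDer morPathDer (der F) H m n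
      (fun x =>
        let s := fst x
        let p := fst (snd x)
        let q := inv (f.pe s) p
        let r := inv (g.pe (f.sh s)) q
        invEq (H.ps (g.sh (f.sh s))) (c.pe s) p r
          (trans (F.ps s) (f.ps s (g.ps (f.sh s) r))
            (ap (F.ps s) (f.ps s) (g.ps (f.sh s) r) (invRight (g.pe (f.sh s)) q))
            (invRight (f.pe s) p)))
      fun x q k k' =>
        removePath ⬝ₑ F.ps (fst x) ⬝ₑ fst (snd x) ⬝ₑ m.ps x (pair q k) ⬝ₑ
          n.ps x (pair q k') ⬝ₑ refl (f.ps (fst x) (g.ps (f.sh (fst x)) q))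

/-- The application of a family `f` to `w`. -/
def appTo (f : Exp) : Exp :=
  f ⬝ₑ w.compE ⬝ₑ w.sumE ⬝ₑ w.invE ⬝ₑ w.isoE ⬝ₑ w.neqE ⬝ₑ w.removeE ⬝ₑ w.nothingE ⬝ₑ w.minusE ⬝ₑ
    w.replaceE

def derIdProof (derIdFor : Exp) : Exp :=
  lam (cont 0) fun F =>
    w.appTo derIdFor ⬝ₑ F ⬝ₑ lam (fst F) fun s => idIsEquiv ((Con.of F).ps s)

def mayIdProof (morPath : Exp) : Exp :=
  lamCont fun F =>
    let m := w.mayMap F F (idMor F)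
    Mor.path morPath (may F) (may F) m (idMor (may F)) fun x q =>
      sumInd (fun q => eq ((may F).ps x) (m.ps x q) q) (fun a => refl (inl a))
        (fun b => refl (inr b)) q

def mayCompProof (morPath : Exp) : Exp :=
  lamCont fun F => lamCont fun G => lamCont fun H => lamCart F G fun f => lamCart G H fun g =>
    let m := w.mayMap F H (w.comp F G H g f)
    let n := w.comp (may F) (may G) (may H) (w.mayMap G H g) (w.mayMap F G f)
    Mor.path morPath (may F) (may H) m n fun x q =>
      sumInd (fun q => eq ((may F).ps x) (m.ps x q) (n.ps x q))
        (fun a => refl (inl (f.ps (fst x) (g.ps (f.sh (fst x)) a)))) (fun b => refl (inr b)) q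

variable (w : Proofs)

/-- The point is `nothing` on both sides, as `f + id` sends `nothing` to itself. On the complement
only `inl` remains, where both maps compute to `f`; the case `inr` is refuted by `k'`. -/
def unitNatProof (morPathDer : Exp) : Exp :=
  lamCont fun F => lamCont fun G => lamCart F G fun f =>
    let k := w.mayMap F G f
    let m := w.comp F (der (may F)) (der (may G)) (w.derMap (may F) (may G) k) (w.unit F)
    let n := w.comp F G (der (may G)) (w.unit G) f
    let A : Exp → Exp := fun s => sum (G.ps (f.sh s)) one
    Mor.pathDer morPathDer F (may G) m n
      (fun s => invEq (A s) (k.pe (pair s star)) nothing nothing (refl nothing))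
      fun s q k k' =>
        let N : Exp → Exp := fun z => neg (eq (A s) (fst (snd (m.sh s))) z)
        let N' : Exp → Exp := fun z => neg (eq (A s) nothing z)
        let E : Exp → Exp → Exp → Exp := fun z k k' =>
          eq (F.ps s) (m.ps s (pair (the (A s) z) k)) (n.ps s (pair (the (A s) z) k'))
        sumInd (fun z => pi (N z) fun k => pi (N' z) fun k' => E z k k')
          (fun a => lam (N (inl a)) fun _ => lam (N' (inl a)) fun _ => refl (f.ps s a))
          (fun b => lam (N (inr b)) fun k => lam (N' (inr b)) fun k' =>
            zeroInd (fun _ => E (inr b) k k')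
              (k' ⬝ₑ oneInd (fun y => eq (A s) nothing (inr y)) (refl nothing) b)) q ⬝ₑ k ⬝ₑ k'

/-- The naturality of `ε` on positions. -/
def counitEq (F G : Con) (f : Mor) (x q : Exp) : Exp :=
  let k := w.mayMap (der F) (der G) (w.derMap F G f)
  let s := fst (fst x)
  let p := fst (snd (fst x))
  let P := F.ps s
  let Q := G.ps (f.sh s)
  let x' := k.sh x
  let e := w.replaceE ⬝ₑ P ⬝ₑ p ⬝ₑ snd (snd (fst x))
  let e' := w.replaceE ⬝ₑ Q ⬝ₑ fst (snd (fst x')) ⬝ₑ snd (snd (fst x'))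
  let R := fun z => replaceMap P p ⬝ₑ z
  let R' := fun z => replaceMap Q (inv (f.pe s) p) ⬝ₑ z
  let z := inv e' q
  let E := fun z => eq P (R (k.ps x z)) (f.ps s (R' z))
  -- The positions part of the counit inverts `replaceMap`, so it suffices to compare after applying
  -- `R`. By cases on `z`, `R` after `k` is `f` after `R'`, where the case `nothing` uses that `f`
  -- sends the chosen preimage of `p` to `p`; finally `R' z = q`.
  invEq ((may (der F)).ps x) e (f.ps s q) (k.ps x z)
    (trans P (R (k.ps x z))
      (sumInd E (fun y => refl (f.ps s (fst y)))
        (fun _ => sym P (f.ps s (inv (f.pe s) p)) (invRight (f.pe s) p)) z)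
      (ap P (f.ps s) (R' z) (invRight e' q)))

def counitNatProof (morPath : Exp) : Exp :=
  lamCont fun F => lamCont fun G => lamCart F G fun f =>
    let k := w.mayMap (der F) (der G) (w.derMap F G f)
    let m := w.comp (may (der F)) F G f (w.counit F)
    let n := w.comp (may (der F)) (may (der G)) G (w.counit G) k
    Mor.path morPath (may (der F)) G m n fun x q => w.counitEq F G f x q

end Proofs

/-- `C z k` for all points `z` of `A + 1` different from `nothing`, if this holds for `inl a`. -/
def minusInd (A : Exp) (C : Exp → Exp → Exp) (c : Exp → Exp → Exp) (z k : Exp) : Exp :=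
  let M := sum A one
  let N : Exp → Exp := fun z => neg (eq M nothing z)
  sumInd (fun z => pi (N z) fun k => C (the M z) k)
    (fun a => lam (N (inl a)) fun k => c a k)
    (fun b => lam (N (inr b)) fun k => zeroInd (fun _ => C (the M (inr b)) k)
      (k ⬝ₑ oneInd (fun y => eq M nothing (inr y)) (refl nothing) b)) z ⬝ₑ k

/-- `inl (minusMap ⬝ (z, n)) = z`. -/
def inlMinus (A z n : Exp) : Exp :=
  minusInd A (fun z n => eq (sum A one) (inl (minusMap A ⬝ₑ pair z n)) z)
    (fun a _ => refl (inl a)) z n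

/-- `minusMap ⬝ (z, k) = a` for `p : z = inl a`. -/
def minusEq (A a z k p : Exp) : Exp :=
  let M := sum A one
  let N : Exp → Exp := fun z => neg (eq M nothing z)
  tp (fun z => pi (N z) fun k => eq A (minusMap A ⬝ₑ pair (the M z) k) a)
    (lam (N (inl a)) fun _ => refl a) (sym M z p) ⬝ₑ k

namespace Proofs

variable (w : Proofs)

/-- The shapes `(s, •)` and `(s, u)` agree only after induction on the unit type, which has no
judgmental η; hence the version with a path of shapes. On positions the map induced by the unit
agrees with `replaceMap` at `nothing`, so it cancels the inverse in the counit. -/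
def zigzagMayProof (morPathSh : Exp) : Exp :=
  lamCont fun F =>
    let k := w.mayMap F (der (may F)) (w.unit F)
    let m := w.comp (may F) (may (der (may F))) (may F) (w.counit (may F)) k
    let r : Exp → Exp → Exp := fun s u =>
      oneInd (fun u => eq (may F).sh (pair s star) (pair s u)) (refl (pair s star)) u
    Mor.pathSh morPathSh (may F) (may F) m (idMor (may F)) (fun x => r (fst x) (snd x)) fun x q =>
      let s := fst x
      let M := sum (F.ps s) one
      let e := w.replaceE ⬝ₑ M ⬝ₑ nothing ⬝ₑ (w.nothingE ⬝ₑ F.ps s)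
      let R := fun z => replaceMap M nothing ⬝ₑ z
      oneInd (fun u => eq M (m.ps x q) (tp (may F).ps q (r s u)))
        (trans M (k.ps x (inv e q))
          (sumInd (fun z => eq M (k.ps x z) (R z))
            (fun y => inlMinus (F.ps s) (fst y) (snd y))
            (fun u => oneInd (fun u => eq M (inr u) nothing) (refl nothing) u) (inv e q))
          (invRight e q)) (snd x)

/-- Uniqueness of preimages is used twice for the points: the counit sends the removed point to
`nothing`, hence that point is the preimage of `nothing`. Other positions `q` go to `inl q`, which
`minusMap` sends back. -/
def zigzagDerProof (morPathDer : Exp) : Exp :=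
  lamCont fun G =>
    let ε := w.counit G
    let k := w.derMap (may (der G)) G ε
    let η := w.unit (der G)
    let m := w.comp (der G) (der (may (der G))) (der G) k η
    let e : Exp → Exp := fun y => w.replaceE ⬝ₑ G.ps (fst y) ⬝ₑ fst (snd y) ⬝ₑ snd (snd y)
    let R : Exp → Exp := fun y => remove (G.ps (fst y)) (fst (snd y))
    let M : Exp → Exp := fun y => sum (R y) one
    Mor.pathDer morPathDer (der G) G m (idMor (der G))
      (fun y => invEq (G.ps (fst y)) (ε.pe (pair y star)) nothing (fst (snd y))
        (invEq (M y) (e y) (fst (snd y)) nothing (refl (fst (snd y)))))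
      fun y q n n' =>
        minusEq (R y) (pair q n') (inv (e y) q) (snd (k.ps (η.sh y) (pair q n)))
          (invEq (M y) (e y) q (inl (pair q n')) (refl q))

/-- Both sides start with the same inverse of `replaceMap`; for an arbitrary value of it,
functoriality of adding one position is a case distinction. -/
def sharpNatLeftProof (morPath : Exp) : Exp :=
  lamCont fun F' => lamCont fun F => lamCont fun G => lamCart F' F fun h => lamCart F (der G) fun f =>
    let c := w.mayMap F' (der G) (w.comp F' F (der G) f h)
    let k := w.mayMap F' F h
    let l := w.mayMap F (der G) f
    Mor.path morPath (may F') G (w.sharp F' G (w.comp F' F (der G) f h))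
      (w.comp (may F') (may F) G (w.sharp F G f) k) fun x q =>
        let y := f.sh (h.sh (fst x))
        sumInd (fun z => eq ((may F').ps x) (c.ps x z) (k.ps x (l.ps (k.sh x) z)))
          (fun a => refl (inl (h.ps (fst x) (f.ps (h.sh (fst x)) a)))) (fun b => refl (inr b))
          (inv (w.replaceE ⬝ₑ G.ps (fst y) ⬝ₑ fst (snd y) ⬝ₑ snd (snd y)) q)

/-- Functoriality of adding one position, followed by naturality of the counit in the form
`counitEq`. -/
def sharpNatRightProof (morPath : Exp) : Exp :=
  lamCont fun F => lamCont fun G => lamCont fun H => lamCart F (der G) fun f => lamCart G H fun g =>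
    let d := w.derMap G H g
    let c := w.mayMap F (der H) (w.comp F (der G) (der H) d f)
    let k := w.mayMap F (der G) f
    let l := w.mayMap (der G) (der H) d
    Mor.path morPath (may F) H (w.sharp F H (w.comp F (der G) (der H) d f))
      (w.comp (may F) G H g (w.sharp F G f)) fun x q =>
        let A := (may F).ps x
        let y := d.sh (f.sh (fst x))
        let z := inv (w.replaceE ⬝ₑ H.ps (fst y) ⬝ₑ fst (snd y) ⬝ₑ snd (snd y)) q
        let v := f.sh (fst x)
        let t := inv (w.replaceE ⬝ₑ G.ps (fst v) ⬝ₑ fst (snd v) ⬝ₑ snd (snd v)) (g.ps (fst v) q)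
        trans A (c.ps x z)
          (sumInd (fun z => eq A (c.ps x z) (k.ps x (l.ps (k.sh x) z)))
            (fun a => refl (inl (f.ps (fst x) (d.ps v a)))) (fun b => refl (inr b)) z)
          (ap A (k.ps x) (l.ps (k.sh x) z)
            (sym ((may (der G)).ps (k.sh x)) t (w.counitEq G H g (k.sh x) q)))

end Proofs

/-! ## Equivalences to `B + 1` -/

/-- The type of isolated points `a` of `A` together with an equivalence `A ∖ a ≃ B`. -/
def splitting (A B : Exp) : Exp := sg (isolated A) fun a => equiv (remove A (fst a)) B

/-- `c` corresponds to the function `u : A → B + 1`. -/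
def isSplitting (A B u c : Exp) : Exp :=
  prod (eq (sum B one) (u ⬝ₑ fst (fst c)) nothing)
    (pi (remove A (fst (fst c))) fun z => eq (sum B one) (inl (fst (snd c) ⬝ₑ z)) (u ⬝ₑ fst z))

def at₃ (T A B e : Exp) : Exp := T ⬝ₑ A ⬝ₑ B ⬝ₑ e

/-- `b (A B : Type) (e : A ≃ B + 1), C A B e` for a binder `b`. -/
def bindEquiv (b : Exp → (Exp → Exp) → Exp) (C : Exp → Exp → Exp → Exp) : Exp :=
  b (univ 0) fun A => b (univ 0) fun B => b (equiv A (sum B one)) fun e => C A B e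

/-- `b (A B : Type) (c : splitting A B), C A B c` for a binder `b`. -/
def bindSplitting (b : Exp → (Exp → Exp) → Exp) (C : Exp → Exp → Exp → Exp) : Exp :=
  b (univ 0) fun A => b (univ 0) fun B => b (splitting A B) fun c => C A B c

/-- The type of functions that assign splittings to equivalences. -/
def SplitFun : Exp := bindEquiv pi fun A B _ => splitting A B

def IsSplit (t : Exp) : Exp := bindEquiv pi fun A B e => isSplitting A B (fst e) (at₃ t A B e)

/-- The isolated point is the preimage of `nothing`; the equivalence is the restriction to
complements followed by `(B + 1) ∖ nothing ≃ B`. -/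
def splitFun (compE isoE neqE removeE nothingE minusE : Exp) : Exp :=
  bindEquiv lam fun A B e =>
    let M := sum B one
    let u := fst e
    let a := inv (snd e) nothing
    let R := remove A a
    pair (pair a (isoE ⬝ₑ A ⬝ₑ M ⬝ₑ u ⬝ₑ snd e ⬝ₑ nothing ⬝ₑ (nothingE ⬝ₑ B)))
      (pair (lam R fun z => minusMap B ⬝ₑ pair (u ⬝ₑ fst z)
          (neqE ⬝ₑ A ⬝ₑ M ⬝ₑ u ⬝ₑ snd e ⬝ₑ nothing ⬝ₑ fst z ⬝ₑ snd z))
        (compE ⬝ₑ R ⬝ₑ remove M nothing ⬝ₑ B ⬝ₑ removeMap neqE A M u (snd e) nothing ⬝ₑ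
          minusMap B ⬝ₑ (removeE ⬝ₑ A ⬝ₑ M ⬝ₑ u ⬝ₑ snd e ⬝ₑ nothing) ⬝ₑ (minusE ⬝ₑ B)))

def isSplit (neqE : Exp) : Exp :=
  bindEquiv lam fun A B e =>
    let u := fst e
    pair (invRight (snd e) nothing) (lam (remove A (inv (snd e) nothing)) fun z =>
      inlMinus B (u ⬝ₑ fst z)
        (neqE ⬝ₑ A ⬝ₑ sum B one ⬝ₑ u ⬝ₑ snd e ⬝ₑ nothing ⬝ₑ fst z ⬝ₑ snd z))

/-- The existence of splittings. -/
def Split : Exp := sg SplitFun IsSplit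

def split (compE isoE neqE removeE nothingE minusE : Exp) : Exp :=
  pair (splitFun compE isoE neqE removeE nothingE minusE) (isSplit neqE)

/-- The type of functions that assign equivalences to splittings. -/
def UnsplitFun : Exp := bindSplitting pi fun A B _ => equiv A (sum B one)

/-- The equivalence of a splitting `c`, as a function. -/
def unsplitMap (replaceE A B c q : Exp) : Exp :=
  sumInd (fun _ => sum B one) (fun y => inl (fst (snd c) ⬝ₑ y)) (fun u => inr u)
    (inv (replaceE ⬝ₑ A ⬝ₑ fst (fst c) ⬝ₑ snd (fst c)) q)

def IsUnsplit (replaceE u : Exp) : Exp :=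
  bindSplitting pi fun A B c => pi A fun q =>
    eq (sum B one) (fst (at₃ u A B c) ⬝ₑ q) (unsplitMap replaceE A B c q)

/-- The binding of functions `t` and `u` that assign splittings to equivalences and vice versa. -/
def bindUnsplit (b : Exp → (Exp → Exp) → Exp) (C : Exp → Exp → Exp → Exp → Exp → Exp) : Exp :=
  b (replaceEType 0) fun r => b SplitFun fun t => b (IsSplit t) fun h =>
  b UnsplitFun fun u => b (IsUnsplit r u) fun h' => C r t h u h'

def IsLeftInverse (t u : Exp) : Exp :=
  bindSplitting pi fun A B c => eq (splitting A B) (at₃ t A B (at₃ u A B c)) c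

def IsRightInverse (t u : Exp) : Exp :=
  bindEquiv pi fun A B e => eq (equiv A (sum B one)) (at₃ u A B (at₃ t A B e)) e

def SplitUnsplit : Exp := bindUnsplit pi fun _ t _ u _ => IsLeftInverse t u

def UnsplitSplit : Exp := bindUnsplit pi fun _ t _ u _ => IsRightInverse t u

/-- Both the original splitting and the one recovered from its equivalence correspond to the same
function to `B + 1`, so `SplitUnique` identifies them. -/
def splitUnsplit (splitUnique : Exp) : Exp :=
  bindUnsplit lam fun replaceE t ht u hu => bindSplitting lam fun A B c =>
    let M := sum B one
    let a := fst (fst c)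
    let e := at₃ u A B c
    let d : Exp → Exp → Exp := fun q z =>
      trans M (fst e ⬝ₑ q) (hu ⬝ₑ A ⬝ₑ B ⬝ₑ c ⬝ₑ q)
        (ap M (fun z => sumInd (fun _ => M) (fun y => inl (fst (snd c) ⬝ₑ y)) (fun u => inr u) z)
          (inv (replaceE ⬝ₑ A ⬝ₑ a ⬝ₑ snd (fst c)) q)
          (invEq (sum (remove A a) one) (replaceE ⬝ₑ A ⬝ₑ a ⬝ₑ snd (fst c)) q z (refl q)))
    splitUnique ⬝ₑ A ⬝ₑ B ⬝ₑ e ⬝ₑ at₃ t A B e ⬝ₑ c ⬝ₑ at₃ ht A B e ⬝ₑ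
      pair (d a nothing)
        (lam (remove A a) fun z => sym M (fst e ⬝ₑ fst z) (d (fst z) (inl z)))

/-- Every `q` is the image under `replaceMap` of its inverse image, and on `(A ∖ a) + 1` the two
functions agree by the two clauses of `isSplitting`. -/
def unsplitSplit (equivPath : Exp) : Exp :=
  bindUnsplit lam fun replaceE t ht u hu => bindEquiv lam fun A B e =>
    let M := sum B one
    let c := at₃ t A B e
    let h := at₃ ht A B e
    let a := fst (fst c)
    let f := at₃ u A B c
    let r := replaceE ⬝ₑ A ⬝ₑ a ⬝ₑ snd (fst c)
    equivPath ⬝ₑ A ⬝ₑ M ⬝ₑ f ⬝ₑ e ⬝ₑ lam A fun q =>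
      let R := fun z => replaceMap A a ⬝ₑ z
      let j := fun z =>
        sumInd (fun _ => M) (fun y => inl (fst (snd c) ⬝ₑ y)) (fun u => inr u) z
      trans M (fst f ⬝ₑ q) (hu ⬝ₑ A ⬝ₑ B ⬝ₑ c ⬝ₑ q) <|
      trans M (j (inv r q))
        (sumInd (fun z => eq M (j z) (fst e ⬝ₑ R z)) (fun z => snd h ⬝ₑ z)
          (fun u => oneInd (fun u => eq M (inr u) (fst e ⬝ₑ a)) (sym M (fst e ⬝ₑ a) (fst h)) u)
          (inv r q))
        (ap M (fun z => fst e ⬝ₑ z) (R (inv r q)) (invRight r q))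

def SplitUnique : Exp :=
  pi (univ 0) fun A => pi (univ 0) fun B => pi (equiv A (sum B one)) fun e =>
  pi (splitting A B) fun c => pi (splitting A B) fun d =>
    arr (isSplitting A B (fst e) c) (arr (isSplitting A B (fst e) d) (eq (splitting A B) c d))

/-- The path `x = y` for `p : inl x = inl y`. -/
def inlInj (A x p : Exp) : Exp :=
  tp (fun z => sumInd (fun _ => univ 0) (fun a => eq A x a) (fun _ => zero) z) (refl x) p

def splitUnique (sgPath equivPath isPropIsIsolated : Exp) : Exp :=
  lam (univ 0) fun A => lam (univ 0) fun B => lam (equiv A (sum B one)) fun e =>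
  lam (splitting A B) fun c => lam (splitting A B) fun d =>
  lam (isSplitting A B (fst e) c) fun p => lam (isSplitting A B (fst e) d) fun q =>
    let M := sum B one
    let E : Exp → Exp := fun a => equiv (remove A (fst a)) B
    let N : Exp → Exp → Exp := fun a x => neg (eq A (fst a) x)
    let v := snd c
    let H : Exp → Exp → Exp := fun b v' => pi A fun x => pi (N (fst c) x) fun n => pi (N b x) fun n' =>
      eq B (fst v ⬝ₑ pair x n) (fst v' ⬝ₑ pair x n')
    -- Any point sent to `nothing` is the chosen preimage, so the isolated points of both splittings
    -- agree.
    let j : Exp → Exp → Exp := fun a p => invEq A (snd e) nothing a p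
    tp (fun b => pi (E b) fun v' => arr (H b v') (eq (splitting A B) c (pair b v')))
      (lam (E (fst c)) fun v' => lam (H (fst c) v') fun h =>
        ap (splitting A B) (fun v' => pair (fst c) v') v
          (equivPath ⬝ₑ remove A (fst (fst c)) ⬝ₑ B ⬝ₑ v ⬝ₑ v' ⬝ₑ
            lam (remove A (fst (fst c))) fun y => h ⬝ₑ fst y ⬝ₑ snd y ⬝ₑ snd y))
      (sgPath ⬝ₑ A ⬝ₑ (lam A fun a => isIsolated A a) ⬝ₑ (isPropIsIsolated ⬝ₑ A) ⬝ₑ fst c ⬝ₑ fst d ⬝ₑ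
        trans A (fst (fst c)) (sym A (inv (snd e) nothing) (j (fst (fst c)) (fst p)))
          (j (fst (fst d)) (fst q))) ⬝ₑ
      snd d ⬝ₑ
      (lam A fun x => lam (N (fst c) x) fun n => lam (N (fst d) x) fun n' =>
        -- Both equivalences agree with `u` after `inl`, and `inl` is injective.
        inlInj B (fst v ⬝ₑ pair x n)
          (trans M (inl (fst v ⬝ₑ pair x n)) (snd p ⬝ₑ pair x n)
            (sym M (inl (fst (snd d) ⬝ₑ pair x n')) (snd q ⬝ₑ pair x n'))))

/-- Morphisms to a derivative are equal if they are given by equal splittings. -/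
def CartPathSplit : Exp :=
  piCon fun F => piCon fun G => pi (arr F.sh G.sh) fun f =>
  let C := pi F.sh fun s => splitting (G.ps (f ⬝ₑ s)) (F.ps s)
  let m : Exp → Exp := fun c =>
    pair (lam F.sh fun s => pair (f ⬝ₑ s) (fst (c ⬝ₑ s))) (lam F.sh fun s => snd (c ⬝ₑ s))
  pi C fun c => pi C fun d =>
    arr (pi F.sh fun s => eq (splitting (G.ps (f ⬝ₑ s)) (F.ps s)) (c ⬝ₑ s) (d ⬝ₑ s))
      (eq (cart F (der G)) (m c) (m d))

def cartPathSplit (funextInv : Exp) : Exp :=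
  lamCon fun F => lamCon fun G => lam (arr F.sh G.sh) fun f =>
  let C := pi F.sh fun s => splitting (G.ps (f ⬝ₑ s)) (F.ps s)
  let m : Exp → Exp := fun c =>
    pair (lam F.sh fun s => pair (f ⬝ₑ s) (fst (c ⬝ₑ s))) (lam F.sh fun s => snd (c ⬝ₑ s))
  lam C fun c => lam C fun d =>
  lam (pi F.sh fun s => eq (splitting (G.ps (f ⬝ₑ s)) (F.ps s)) (c ⬝ₑ s) (d ⬝ₑ s)) fun h =>
    ap (cart F (der G)) m c
      (funextInv ⬝ₑ F.sh ⬝ₑ (lam F.sh fun s => splitting (G.ps (f ⬝ₑ s)) (F.ps s)) ⬝ₑ c ⬝ₑ d ⬝ₑ h)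

/-- The function `(F ⊸ ∂ G) → (F × Id ⊸ G)` given by `u`. -/
def sharpFun (u : Exp) (F G : Con) : Exp :=
  lam (cart F (der G)) fun f =>
    let f' := Mor.of f
    pair (lam (may F).sh fun x => fst (f'.sh (fst x)))
      (lam (may F).sh fun x =>
        at₃ u (G.ps (fst (f'.sh (fst x)))) (F.ps (fst x))
          (pair (snd (f'.sh (fst x))) (snd f ⬝ₑ fst x)))

/-- Only the mutual inverse laws of `t` and `u` matter here, so both functions are kept abstract. -/
def SharpFunIsEquiv : Exp :=
  pi SplitFun fun t => pi UnsplitFun fun u => arr (IsLeftInverse t u) <| arr (IsRightInverse t u) <|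
    piCont 0 fun F => piCont 0 fun G =>
      isEquiv (cart F (der G)) (cart (may F) G) (sharpFun u F G)

def sharpFunIsEquiv (equivOfInverse cartPathSplit morPathSh : Exp) : Exp :=
  lam SplitFun fun t => lam UnsplitFun fun u =>
  lam (IsLeftInverse t u) fun h => lam (IsRightInverse t u) fun h' =>
  lamCont fun F => lamCont fun G =>
    let P : Exp → Exp → Exp := fun k s => G.ps (fst k ⬝ₑ pair s star)
    let c : Exp → Exp → Exp := fun k s => at₃ t (P k s) (F.ps s) (snd k ⬝ₑ pair s star)
    equivOfInverse ⬝ₑ cart F (der G) ⬝ₑ cart (may F) G ⬝ₑ sharpFun u F G ⬝ₑ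
      (lam (cart (may F) G) fun k => pair (lam F.sh fun s => pair (fst k ⬝ₑ pair s star) (fst (c k s)))
        (lam F.sh fun s => snd (c k s))) ⬝ₑ
      (lam (cart (may F) G) fun k =>
        let m : Mor := ⟨fun x => fst k ⬝ₑ pair (fst x) star,
          fun x q => fst (at₃ u (P k (fst x)) (F.ps (fst x)) (c k (fst x))) ⬝ₑ q,
          fun x => snd (at₃ u (P k (fst x)) (F.ps (fst x)) (c k (fst x)))⟩
        -- The inverse construction sees `k` only at shapes `(s, •)`; induction on the unit type
        -- recovers its value at `(s, u)`.
        let r : Exp → Exp → Exp := fun s u =>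
          oneInd (fun u => eq G.sh (fst k ⬝ₑ pair s star) (fst k ⬝ₑ pair s u))
            (refl (fst k ⬝ₑ pair s star)) u
        Mor.pathSh morPathSh (may F) G m (Mor.of k) (fun x => r (fst x) (snd x)) fun x q =>
          let s := fst x
          oneInd (fun u => eq (sum (F.ps s) one) (m.ps x q)
              (fst (snd k ⬝ₑ pair s u) ⬝ₑ tp G.ps q (r s u)))
            (ap (sum (F.ps s) one) (fun e => fst e ⬝ₑ q) (at₃ u (P k s) (F.ps s) (c k s))
              (h' ⬝ₑ P k s ⬝ₑ F.ps s ⬝ₑ (snd k ⬝ₑ pair s star))) (snd x)) ⬝ₑ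
      (lam (cart F (der G)) fun f =>
        let f' := Mor.of f
        let A : Exp → Exp := fun s => G.ps (fst (f'.sh s))
        let d : Exp → Exp := fun s => pair (snd (f'.sh s)) (snd f ⬝ₑ s)
        cartPathSplit ⬝ₑ F.sh ⬝ₑ lam F.sh F.ps ⬝ₑ G.sh ⬝ₑ lam G.sh G.ps ⬝ₑ
          lam F.sh (fun s => fst (f'.sh s)) ⬝ₑ
          lam F.sh (fun s => at₃ t (A s) (F.ps s) (at₃ u (A s) (F.ps s) (d s))) ⬝ₑ lam F.sh d ⬝ₑ
          lam F.sh fun s => h ⬝ₑ A s ⬝ₑ F.ps s ⬝ₑ d s)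

namespace Proofs

variable (w : Proofs)

/-- The equivalence of positions of `f♯` as a function of the splitting given by `f`. -/
def unsplitFun : Exp :=
  bindSplitting lam fun A B c =>
    -- A splitting is a morphism from `1 ▷ B` to the derivative of `1 ▷ A`. Reading off the
    -- positions of its transpose gives the very equivalence occurring in `sharp`, including its
    -- proof, so that `sharpFun` and `sharp` agree by computation.
    let F : Con := ⟨one, fun _ => B⟩
    let G : Con := ⟨one, fun _ => A⟩
    let k := w.sharp F G
      ⟨fun _ => pair star (fst c), fun _ q => fst (snd c) ⬝ₑ q, fun _ => snd (snd c)⟩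
    pair (k.psFun G (pair star star)) (k.pe (pair star star))

def isUnsplit : Exp :=
  bindSplitting lam fun A B c => lam A fun q => refl (unsplitMap w.replaceE A B c q)

def sharpIsEquivProof (sharpFunIsEquiv splitUnsplit unsplitSplit split : Exp) : Exp :=
  let h := fun f => f ⬝ₑ w.replaceE ⬝ₑ fst split ⬝ₑ snd split ⬝ₑ w.unsplitFun ⬝ₑ w.isUnsplit
  sharpFunIsEquiv ⬝ₑ fst split ⬝ₑ w.unsplitFun ⬝ₑ h splitUnsplit ⬝ₑ h unsplitSplit

end Proofs

end HoTT

set_option maxHeartbeats 0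

namespace HoTT

open Tm

/-! ## Realized types -/

/-- `A` is a type in context `Γ` and has an element. -/
def Realized (Γ : Ctx) (A : Tm) : Prop := IsTy Γ A ∧ ∃ t, Der (.tm Γ t A)

theorem isTy_of_hasType {t A : Tm} (h : hasType t A = true) : IsTy [] A := by
  rw [hasType] at h
  rcases h' : infTy (run 1000).1 [] A with _ | r
  · rw [h'] at h; cases h
  · exact (infTy_sound (run_sound _).1 .nil h').eqTy.left

namespace Realized

theorem of_hasType {t A : Tm} (h : hasType t A = true) : Realized [] A :=
  ⟨isTy_of_hasType h, t, der_of_hasType h⟩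

/-- An `Exp` is an arbitrary function of the depth, so it must be tested that the codomain `B` at
depth 1 is the weakening of `B` at depth 0. -/
theorem mp {A B : Exp} (h : Realized [] (arr A B 0)) (ha : Realized [] (A 0))
    (e : (B 1).beq ((B 0).shift 1) = true := by decide +kernel) : Realized [] (B 0) := by
  obtain ⟨hT, t, ht⟩ := h
  obtain ⟨-, a, ha⟩ := ha
  have hT : IsTy [] (.pi (A 0) (B 1)) := hT
  have ht : Der (.tm [] t (.pi (A 0) (B 1))) := ht
  rw [eq_of_beq e] at hT ht
  refine ⟨?_, .app t a, ?_⟩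
  · have := hT.of_pi.2.inst .nil ha
    rwa [shift_one_inst] at this
  · have := Der.app ht ha
    rwa [shift_one_inst] at this

end Realized

/-! ### The auxiliary lemmas, checked by evaluation -/

theorem realized_funextInv : Realized [] (FunextInv 0) :=
  Realized.of_hasType (t := funextInv 0) (by decide +kernel)

theorem realized_sgPath : Realized [] (SgPath 0) :=
  Realized.of_hasType (t := sgPath 0) (by decide +kernel)

theorem realized_equivInd : Realized [] (EquivInd 0) :=
  Realized.of_hasType (t := equivInd 0) (by decide +kernel)

theorem realized_isPropOfIsContr : Realized [] (IsPropOfIsContr 0) :=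
  Realized.of_hasType (t := isPropOfIsContr 0) (by decide +kernel)

theorem realized_isSetOfIsProp : Realized [] (IsSetOfIsProp 0) :=
  Realized.of_hasType (t := isSetOfIsProp 0) (by decide +kernel)

theorem realized_isPropIsContr : Realized [] (IsPropIsContr 0) :=
  (Realized.of_hasType
    (A := (arr FunextInv <| arr SgPath <| arr IsPropOfIsContr <| arr IsSetOfIsProp <|
      IsPropIsContr) 0)
    (t := (lam FunextInv fun a => lam SgPath fun b => lam IsPropOfIsContr fun c => lam
      IsSetOfIsProp fun d => isPropIsContr a b c d) 0)
    (by decide +kernel)).mp realized_funextInv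
    |>.mp realized_sgPath
    |>.mp realized_isPropOfIsContr
    |>.mp realized_isSetOfIsProp

theorem realized_isPropIsEquiv : Realized [] (IsPropIsEquiv 0) :=
  (Realized.of_hasType
    (A := (arr FunextInv <| arr IsPropIsContr <| IsPropIsEquiv) 0)
    (t := (lam FunextInv fun a => lam IsPropIsContr fun b => isPropIsEquiv a b) 0)
    (by decide +kernel)).mp realized_funextInv
    |>.mp realized_isPropIsContr

theorem realized_equivPath : Realized [] (EquivPath 0) :=
  (Realized.of_hasType
    (A := (arr FunextInv <| arr SgPath <| arr IsPropIsEquiv <| EquivPath) 0)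
    (t := (lam FunextInv fun a => lam SgPath fun b => lam IsPropIsEquiv fun c => equivPath a
      b c) 0)
    (by decide +kernel)).mp realized_funextInv
    |>.mp realized_sgPath
    |>.mp realized_isPropIsEquiv

theorem realized_equivOfHomotopy : Realized [] (EquivOfHomotopy 0) :=
  (Realized.of_hasType
    (A := (arr FunextInv <| EquivOfHomotopy) 0)
    (t := (lam FunextInv fun a => equivOfHomotopy a) 0)
    (by decide +kernel)).mp realized_funextInv

theorem realized_isPropNeg : Realized [] (IsPropNeg 0) :=
  (Realized.of_hasType
    (A := (arr FunextInv <| IsPropNeg) 0)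
    (t := (lam FunextInv fun a => isPropNeg a) 0)
    (by decide +kernel)).mp realized_funextInv

theorem realized_isPropIsIsolated : Realized [] (IsPropIsIsolated 0) :=
  (Realized.of_hasType
    (A := (arr FunextInv <| arr IsPropNeg <| IsPropIsIsolated) 0)
    (t := (lam FunextInv fun a => lam IsPropNeg fun b => isPropIsIsolated a b) 0)
    (by decide +kernel)).mp realized_funextInv
    |>.mp realized_isPropNeg

theorem realized_equivOfInverse : Realized [] (EquivOfInverse 0) :=
  Realized.of_hasType (t := equivOfInverse 0) (by decide +kernel)

theorem realized_compE : Realized [] ((compEType 0) 0) :=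
  (Realized.of_hasType
    (A := (arr EquivInd <| (compEType 0)) 0)
    (t := (lam EquivInd fun a => compE a) 0)
    (by decide +kernel)).mp realized_equivInd

theorem realized_sumE : Realized [] ((sumEType 0) 0) :=
  (Realized.of_hasType
    (A := (arr EquivInd <| arr EquivOfHomotopy <| (sumEType 0)) 0)
    (t := (lam EquivInd fun a => lam EquivOfHomotopy fun b => sumE a b) 0)
    (by decide +kernel)).mp realized_equivInd
    |>.mp realized_equivOfHomotopy

theorem realized_invE : Realized [] ((invEType 0) 0) :=
  (Realized.of_hasType
    (A := (arr EquivInd <| (invEType 0)) 0)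
    (t := (lam EquivInd fun a => invE a) 0)
    (by decide +kernel)).mp realized_equivInd

theorem realized_isoE : Realized [] ((isoEType 0) 0) :=
  (Realized.of_hasType
    (A := (arr EquivInd <| (isoEType 0)) 0)
    (t := (lam EquivInd fun a => isoE a) 0)
    (by decide +kernel)).mp realized_equivInd

theorem realized_neqE : Realized [] ((neqEType 0) 0) :=
  (Realized.of_hasType
    (A := (arr EquivInd <| (neqEType 0)) 0)
    (t := (lam EquivInd fun a => neqE a) 0)
    (by decide +kernel)).mp realized_equivInd

/-- This type mentions a proof of `neqEType`, over which it is quantified so as to become closed. -/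
theorem realized_removeE : Realized [] ((pi (neqEType 0) fun n => removeEType 0 n) 0) :=
  (Realized.of_hasType
    (A := (arr EquivInd <| arr EquivOfHomotopy <| arr SgPath <| arr IsPropNeg <| (pi
      (neqEType 0) fun n => removeEType 0 n)) 0)
    (t := (lam EquivInd fun a => lam EquivOfHomotopy fun b => lam SgPath fun c => lam
      IsPropNeg fun d => lam (neqEType 0) fun n => removeE a b c d n) 0)
    (by decide +kernel)).mp realized_equivInd
    |>.mp realized_equivOfHomotopy
    |>.mp realized_sgPath
    |>.mp realized_isPropNeg

theorem realized_nothingE : Realized [] ((nothingEType 0) 0) :=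
  Realized.of_hasType (t := nothingE 0) (by decide +kernel)

theorem realized_minusE : Realized [] ((minusEType 0) 0) :=
  (Realized.of_hasType
    (A := (arr EquivOfInverse <| arr SgPath <| arr IsPropNeg <| (minusEType 0)) 0)
    (t := (lam EquivOfInverse fun a => lam SgPath fun b => lam IsPropNeg fun c => minusE a b
      c) 0)
    (by decide +kernel)).mp realized_equivOfInverse
    |>.mp realized_sgPath
    |>.mp realized_isPropNeg

theorem realized_replaceE : Realized [] ((replaceEType 0) 0) :=
  (Realized.of_hasType
    (A := (arr EquivOfInverse <| arr SgPath <| arr IsPropNeg <| (replaceEType 0)) 0)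
    (t := (lam EquivOfInverse fun a => lam SgPath fun b => lam IsPropNeg fun c => replaceE a
      b c) 0)
    (by decide +kernel)).mp realized_equivOfInverse
    |>.mp realized_sgPath
    |>.mp realized_isPropNeg

theorem realized_removePath : Realized [] (RemovePath 0) :=
  (Realized.of_hasType
    (A := (arr SgPath <| arr IsPropNeg <| RemovePath) 0)
    (t := (lam SgPath fun a => lam IsPropNeg fun b => removePath' a b) 0)
    (by decide +kernel)).mp realized_sgPath
    |>.mp realized_isPropNeg

theorem realized_homotopyInd : Realized [] (HomotopyInd 0) :=
  Realized.of_hasType (t := homotopyInd 0) (by decide +kernel)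

theorem realized_cartPath : Realized [] (CartPath 0) :=
  (Realized.of_hasType
    (A := (arr FunextInv <| arr EquivPath <| CartPath) 0)
    (t := (lam FunextInv fun a => lam EquivPath fun b => cartPath a b) 0)
    (by decide +kernel)).mp realized_funextInv
    |>.mp realized_equivPath

theorem realized_cartPathSh : Realized [] (CartPathSh 0) :=
  (Realized.of_hasType
    (A := (arr HomotopyInd <| arr CartPath <| CartPathSh) 0)
    (t := (lam HomotopyInd fun a => lam CartPath fun b => cartPathSh a b) 0)
    (by decide +kernel)).mp realized_homotopyInd
    |>.mp realized_cartPath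

theorem realized_cartPathDer : Realized [] (CartPathDer 0) :=
  (Realized.of_hasType
    (A := (arr FunextInv <| arr SgPath <| arr EquivPath <| arr IsPropIsIsolated <|
      CartPathDer) 0)
    (t := (lam FunextInv fun a => lam SgPath fun b => lam EquivPath fun c => lam
      IsPropIsIsolated fun d => cartPathDer a b c d) 0)
    (by decide +kernel)).mp realized_funextInv
    |>.mp realized_sgPath
    |>.mp realized_equivPath
    |>.mp realized_isPropIsIsolated

theorem realized_morPath : Realized [] (MorPath 0) :=
  (Realized.of_hasType
    (A := (arr CartPath <| MorPath) 0)
    (t := (lam CartPath fun a => morPath a) 0)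
    (by decide +kernel)).mp realized_cartPath

theorem realized_morPathSh : Realized [] (MorPathSh 0) :=
  (Realized.of_hasType
    (A := (arr CartPathSh <| MorPathSh) 0)
    (t := (lam CartPathSh fun a => morPathSh a) 0)
    (by decide +kernel)).mp realized_cartPathSh

theorem realized_morPathDer : Realized [] (MorPathDer 0) :=
  (Realized.of_hasType
    (A := (arr CartPathDer <| MorPathDer) 0)
    (t := (lam CartPathDer fun a => morPathDer a) 0)
    (by decide +kernel)).mp realized_cartPathDer

/-! ### The laws of the adjunction, for arbitrary side proofs -/

theorem realized_unitLaws : Realized [] ((piProofs fun w => w.unitLaws 0) 0) :=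
  (Realized.of_hasType
    (A := (arr MorPath <| (piProofs fun w => w.unitLaws 0)) 0)
    (t := (lam MorPath fun a => lamProofs fun w => w.unitLawsProof a) 0)
    (by decide +kernel)).mp realized_morPath

theorem realized_assocLaw : Realized [] ((piProofs fun w => w.assocLaw 0) 0) :=
  (Realized.of_hasType
    (A := (arr MorPath <| (piProofs fun w => w.assocLaw 0)) 0)
    (t := (lam MorPath fun a => lamProofs fun w => w.assocProof a) 0)
    (by decide +kernel)).mp realized_morPath

theorem realized_derIdFor : Realized [] ((piProofs fun w => w.derIdFor) 0) :=
  (Realized.of_hasType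
    (A := (arr MorPathDer <| arr RemovePath <| (piProofs fun w => w.derIdFor)) 0)
    (t := (lam MorPathDer fun a => lam RemovePath fun b => lamProofs fun w => w.derIdForProof
      a b) 0)
    (by decide +kernel)).mp realized_morPathDer
    |>.mp realized_removePath

theorem realized_derId : Realized [] ((piProofs fun w => w.derId 0) 0) :=
  (Realized.of_hasType
    (A := (arr (piProofs fun w => w.derIdFor) <| (piProofs fun w => w.derId 0)) 0)
    (t := (lam (piProofs fun w => w.derIdFor) fun a => lamProofs fun w => w.derIdProof a) 0)
    (by decide +kernel)).mp realized_derIdFor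

theorem realized_derComp : Realized [] ((piProofs fun w => w.derComp 0) 0) :=
  (Realized.of_hasType
    (A := (arr MorPathDer <| arr RemovePath <| (piProofs fun w => w.derComp 0)) 0)
    (t := (lam MorPathDer fun a => lam RemovePath fun b => lamProofs fun w => w.derCompProof
      a b) 0)
    (by decide +kernel)).mp realized_morPathDer
    |>.mp realized_removePath

theorem realized_mayId : Realized [] ((piProofs fun w => w.mayId 0) 0) :=
  (Realized.of_hasType
    (A := (arr MorPath <| (piProofs fun w => w.mayId 0)) 0)
    (t := (lam MorPath fun a => lamProofs fun w => w.mayIdProof a) 0)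
    (by decide +kernel)).mp realized_morPath

theorem realized_mayComp : Realized [] ((piProofs fun w => w.mayComp 0) 0) :=
  (Realized.of_hasType
    (A := (arr MorPath <| (piProofs fun w => w.mayComp 0)) 0)
    (t := (lam MorPath fun a => lamProofs fun w => w.mayCompProof a) 0)
    (by decide +kernel)).mp realized_morPath

theorem realized_unitNat : Realized [] ((piProofs fun w => w.unitNat 0) 0) :=
  (Realized.of_hasType
    (A := (arr MorPathDer <| (piProofs fun w => w.unitNat 0)) 0)
    (t := (lam MorPathDer fun a => lamProofs fun w => w.unitNatProof a) 0)
    (by decide +kernel)).mp realized_morPathDer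

theorem realized_counitNat : Realized [] ((piProofs fun w => w.counitNat 0) 0) :=
  (Realized.of_hasType
    (A := (arr MorPath <| (piProofs fun w => w.counitNat 0)) 0)
    (t := (lam MorPath fun a => lamProofs fun w => w.counitNatProof a) 0)
    (by decide +kernel)).mp realized_morPath

theorem realized_zigzagMay : Realized [] ((piProofs fun w => w.zigzagMay 0) 0) :=
  (Realized.of_hasType
    (A := (arr MorPathSh <| (piProofs fun w => w.zigzagMay 0)) 0)
    (t := (lam MorPathSh fun a => lamProofs fun w => w.zigzagMayProof a) 0)
    (by decide +kernel)).mp realized_morPathSh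

theorem realized_zigzagDer : Realized [] ((piProofs fun w => w.zigzagDer 0) 0) :=
  (Realized.of_hasType
    (A := (arr MorPathDer <| (piProofs fun w => w.zigzagDer 0)) 0)
    (t := (lam MorPathDer fun a => lamProofs fun w => w.zigzagDerProof a) 0)
    (by decide +kernel)).mp realized_morPathDer

/-! ### The equivalence of hom-types and its naturality -/

theorem realized_splitUnique : Realized [] (SplitUnique 0) :=
  (Realized.of_hasType
    (A := (arr SgPath <| arr EquivPath <| arr IsPropIsIsolated <| SplitUnique) 0)
    (t := (lam SgPath fun a => lam EquivPath fun b => lam IsPropIsIsolated fun c =>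
      splitUnique a b c) 0)
    (by decide +kernel)).mp realized_sgPath
    |>.mp realized_equivPath
    |>.mp realized_isPropIsIsolated

theorem realized_split : Realized [] (Split 0) :=
  (Realized.of_hasType
    (A := (arr (compEType 0) <| arr (isoEType 0) <| arr (neqEType 0) <| arr (pi (neqEType 0)
      fun n => removeEType 0 n) <| arr (nothingEType 0) <| arr (minusEType 0) <| Split) 0)
    (t := (lam (compEType 0) fun a => lam (isoEType 0) fun b => lam (neqEType 0) fun c => lam
      (pi (neqEType 0) fun n => removeEType 0 n) fun d => lam (nothingEType 0) fun e => lam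
      (minusEType 0) fun f => split a b c (d ⬝ₑ c) e f) 0)
    (by decide +kernel)).mp realized_compE
    |>.mp realized_isoE
    |>.mp realized_neqE
    |>.mp realized_removeE
    |>.mp realized_nothingE
    |>.mp realized_minusE

theorem realized_cartPathSplit : Realized [] (CartPathSplit 0) :=
  (Realized.of_hasType
    (A := (arr FunextInv <| CartPathSplit) 0)
    (t := (lam FunextInv fun a => cartPathSplit a) 0)
    (by decide +kernel)).mp realized_funextInv

theorem realized_splitUnsplit : Realized [] (SplitUnsplit 0) :=
  (Realized.of_hasType
    (A := (arr SplitUnique <| SplitUnsplit) 0)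
    (t := (lam SplitUnique fun a => splitUnsplit a) 0)
    (by decide +kernel)).mp realized_splitUnique

theorem realized_unsplitSplit : Realized [] (UnsplitSplit 0) :=
  (Realized.of_hasType
    (A := (arr EquivPath <| UnsplitSplit) 0)
    (t := (lam EquivPath fun a => unsplitSplit a) 0)
    (by decide +kernel)).mp realized_equivPath

theorem realized_sharpFunIsEquiv : Realized [] (SharpFunIsEquiv 0) :=
  (Realized.of_hasType
    (A := (arr EquivOfInverse <| arr CartPathSplit <| arr MorPathSh <| SharpFunIsEquiv) 0)
    (t := (lam EquivOfInverse fun a => lam CartPathSplit fun b => lam MorPathSh fun c =>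
      sharpFunIsEquiv a b c) 0)
    (by decide +kernel)).mp realized_equivOfInverse
    |>.mp realized_cartPathSplit
    |>.mp realized_morPathSh

theorem realized_sharpIsEquiv : Realized [] ((piProofs fun w => w.sharpIsEquiv 0) 0) :=
  (Realized.of_hasType
    (A := (arr SharpFunIsEquiv <| arr SplitUnsplit <| arr UnsplitSplit <| arr Split <|
      (piProofs fun w => w.sharpIsEquiv 0)) 0)
    (t := (lam SharpFunIsEquiv fun a => lam SplitUnsplit fun b => lam UnsplitSplit fun c =>
      lam Split fun d => lamProofs fun w => w.sharpIsEquivProof a b c d) 0)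
    (by decide +kernel)).mp realized_sharpFunIsEquiv
    |>.mp realized_splitUnsplit
    |>.mp realized_unsplitSplit
    |>.mp realized_split

theorem realized_sharpNatLeft : Realized [] ((piProofs fun w => w.sharpNatLeft 0) 0) :=
  (Realized.of_hasType
    (A := (arr MorPath <| (piProofs fun w => w.sharpNatLeft 0)) 0)
    (t := (lam MorPath fun a => lamProofs fun w => w.sharpNatLeftProof a) 0)
    (by decide +kernel)).mp realized_morPath

theorem realized_sharpNatRight : Realized [] ((piProofs fun w => w.sharpNatRight 0) 0) :=
  (Realized.of_hasType
    (A := (arr MorPath <| (piProofs fun w => w.sharpNatRight 0)) 0)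
    (t := (lam MorPath fun a => lamProofs fun w => w.sharpNatRightProof a) 0)
    (by decide +kernel)).mp realized_morPath

/-! ## Putting the laws together -/

theorem Der.ctx_tail {Γ : Ctx} {A : Tm} (h : Der (.ctx (A :: Γ))) : Der (.ctx Γ) := by
  cases h with
  | cons h => exact h.base

namespace Realized

theorem ctx {Γ : Ctx} {A : Tm} (h : Realized Γ A) : Der (.ctx Γ) := by
  obtain ⟨⟨_, h⟩, -⟩ := h
  exact h.base

/-- A closed element can be used in any context; the test confirms that the type is the same term at
its new depth. -/
theorem of_nil {Γ : Ctx} {A A' : Tm} (hΓ : Der (.ctx Γ)) (h : Realized [] A)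
    (e : A.beq A' = true := by decide +kernel) : Realized Γ A' := by
  rw [← eq_of_beq e]
  obtain ⟨hA, t, ht⟩ := h
  have hσ : Sb Γ var [] := fun n B hB => by simp at hB
  refine ⟨?_, t.subst var, ?_⟩
  · have := hσ.isTy hΓ hA
    rwa [subst_var] at this
  · have := hσ.tm hΓ ht
    rwa [subst_var A] at this

/-- A weakened function applied to the new variable; this turns a quantified law into one over the
context of its hypotheses. -/
theorem of_pi {Γ : Ctx} {A B : Tm} (h : Realized Γ (.pi A B)) : Realized (A :: Γ) B := by
  obtain ⟨hT, t, ht⟩ := h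
  obtain ⟨hA, hB⟩ := hT.of_pi
  refine ⟨hB, .app (t.shift 1) (var 0), ?_⟩
  have ht : Der (.tm (A :: Γ) (t.shift 1) (.pi (A.shift 1) (B.rename (upr fun n => n + 1)))) :=
    Der.wk hA.ctx_cons ht
  have := Der.app ht (.var hA.ctx_cons rfl)
  rwa [rename_eq_subst, ← up_var_comp, inst_var_zero] at this

theorem sg {Γ : Ctx} {A B : Tm} (h : Realized (A :: Γ) B) (ha : Realized Γ A) :
    Realized Γ (.sg A B) := by
  obtain ⟨hB, b, hb⟩ := h
  obtain ⟨hA, a, ha⟩ := ha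
  exact ⟨hA.sg hB, .pair a (b.inst a), .pair hB.choose_spec ha (.inst ha.base hb ha)⟩

theorem sg_of_nil {Γ : Ctx} {A A' B : Tm} (h : Realized (A :: Γ) B) (ha : Realized [] A')
    (e : A'.beq A = true := by decide +kernel) : Realized Γ (.sg A B) :=
  h.sg (of_nil h.ctx.ctx_tail ha e)

end Realized

/-- The proofs given by the nine innermost variables. -/
def varProofs : Proofs :=
  ⟨fun m => var (m - 1), fun m => var (m - 2), fun m => var (m - 3), fun m => var (m - 4),
    fun m => var (m - 5), fun m => var (m - 6), fun m => var (m - 7), fun m => var (m - 8),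
    fun m => var (m - 9)⟩

/-- Each type is evaluated at the number of variables before it. Only `removeEType` refers to one of
them, the proof of `neqEType` immediately preceding it. -/
def proofsCtx : Ctx :=
  [replaceEType 0 8, minusEType 0 7, nothingEType 0 6, removeEType 0 varProofs.neqE 5, neqEType 0 4,
    isoEType 0 3, invEType 0 2, sumEType 0 1, compEType 0 0]

/-- `Γ` extends `proofsCtx` by `k` variables. -/
def ExtendsProofs (Γ : Ctx) (k : ℕ) : Prop :=
  Der (.ctx Γ) ∧ Sb Γ (fun n => var (n + k)) proofsCtx

namespace Realized

/-- Stripping the nine quantifiers gives the law over `proofsCtx`, which is then weakened to `Γ`.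
The test identifies this weakening with the law written at the greater depth. -/
theorem of_piProofs {B : Proofs → Exp} {Γ : Ctx} {k : ℕ} (h : Realized [] (piProofs B 0))
    (hΓ : ExtendsProofs Γ k)
    (e : (B varProofs (9 + k)).beq ((B varProofs 9).lift k 0) = true := by decide +kernel) :
    Realized Γ (B varProofs (9 + k)) := by
  obtain ⟨hB, b, hb⟩ : Realized proofsCtx (B varProofs 9) :=
    h.of_pi.of_pi.of_pi.of_pi.of_pi.of_pi.of_pi.of_pi.of_pi
  rw [eq_of_beq e, lift_eq]
  exact ⟨hΓ.2.isTy hΓ.1 hB, _, hΓ.2.tm hΓ.1 hb⟩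

/-- A product is a Σ-type with a dummy variable, so each factor lives under one variable more than
its predecessor; `k` counts these. -/
theorem prod {Γ : Ctx} {A B : Exp} {k : ℕ} (hΓ : ExtendsProofs Γ k)
    (ha : ExtendsProofs Γ k → Realized Γ (A (9 + k)))
    (hb : ExtendsProofs (A (9 + k) :: Γ) (k + 1) →
      Realized (A (9 + k) :: Γ) (B (9 + (k + 1)))) :
    Realized Γ (HoTT.prod A B (9 + k)) :=
  have hA := (ha hΓ).1.ctx_cons
  sg (hb ⟨hA, hΓ.2.comp_wk hA⟩) (ha hΓ)

end Realized

theorem realized_laws :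
    Realized proofsCtx ((prod (varProofs.unitLaws 0) <| prod (varProofs.assocLaw 0) <|
      prod (varProofs.derId 0) <| prod (varProofs.derComp 0) <|
      prod (varProofs.mayId 0) <| prod (varProofs.mayComp 0) <|
      prod (varProofs.unitNat 0) <| prod (varProofs.counitNat 0) <|
      prod (varProofs.zigzagMay 0) <| prod (varProofs.zigzagDer 0) <|
      prod (varProofs.sharpIsEquiv 0) <| prod (varProofs.sharpNatLeft 0)
        (varProofs.sharpNatRight 0)) 9) :=
  have hΓ := (realized_unitLaws.of_pi.of_pi.of_pi.of_pi.of_pi.of_pi.of_pi.of_pi.of_pi).ctx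
  .prod (k := 0) ⟨hΓ, .id hΓ⟩ (.of_piProofs (B := fun w => w.unitLaws 0) realized_unitLaws) fun hΓ =>
  .prod hΓ (.of_piProofs (B := fun w => w.assocLaw 0) realized_assocLaw) fun hΓ =>
  .prod hΓ (.of_piProofs (B := fun w => w.derId 0) realized_derId) fun hΓ =>
  .prod hΓ (.of_piProofs (B := fun w => w.derComp 0) realized_derComp) fun hΓ =>
  .prod hΓ (.of_piProofs (B := fun w => w.mayId 0) realized_mayId) fun hΓ =>
  .prod hΓ (.of_piProofs (B := fun w => w.mayComp 0) realized_mayComp) fun hΓ =>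
  .prod hΓ (.of_piProofs (B := fun w => w.unitNat 0) realized_unitNat) fun hΓ =>
  .prod hΓ (.of_piProofs (B := fun w => w.counitNat 0) realized_counitNat) fun hΓ =>
  .prod hΓ (.of_piProofs (B := fun w => w.zigzagMay 0) realized_zigzagMay) fun hΓ =>
  .prod hΓ (.of_piProofs (B := fun w => w.zigzagDer 0) realized_zigzagDer) fun hΓ =>
  .prod hΓ (.of_piProofs (B := fun w => w.sharpIsEquiv 0) realized_sharpIsEquiv) fun hΓ =>
  .prod hΓ (.of_piProofs (B := fun w => w.sharpNatLeft 0) realized_sharpNatLeft) fun hΓ =>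
  .of_piProofs (B := fun w => w.sharpNatRight 0) realized_sharpNatRight hΓ

/-- The nine side proofs are paired from the innermost outwards; instantiating each variable
specialises the laws proved for arbitrary proofs. -/
theorem isInhabited_derivativeAdjunction_zero : IsInhabited (derivativeAdjunction 0) := by
  have h := ((realized_laws.sg_of_nil realized_replaceE).sg_of_nil realized_minusE).sg_of_nil
    realized_nothingE
  have hΓ := h.ctx.ctx_tail.ctx_tail
  -- The type of `removeE` is not closed, so its quantified form is moved into the context ending
  -- before `neqE` and one quantifier is stripped.
  have hr : Realized _ (.pi (neqEType 0 4) (removeEType 0 varProofs.neqE 5)) :=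
    .of_nil hΓ realized_removeE
  exact (((((h.sg hr.of_pi).sg_of_nil realized_neqE).sg_of_nil realized_isoE).sg_of_nil
    realized_invE).sg_of_nil realized_sumE).sg_of_nil realized_compE |>.2

end HoTT

theorem mainTheorem1 (i : ℕ) : HoTT.IsInhabited (HoTT.derivativeAdjunction i) := by
  exact HoTT.isInhabited_derivativeAdjunction_zero.raise i (HoTT.derivativeAdjunction_raise i)
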